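/- Let $\kappa_j:\mathbb R\to\mathbb R$ ($j\ge 0$) be a smooth dyadic partition of unity: $\sum_{j\ge0}\kappa_j^2=1$, $\kappa_j$ is supported in $\{2^j\le\max\{|\xi|,1\}\le 2^{j+2}\}$, and for every $m$ one has $\sup_{j,\xi}2^{jm}|\kappa_j^{(m)}(\xi)|<\infty$. For $j>0$ let $\kappa_j^{+}=1_{\xi\ge0}\kappa_j$, $\kappa_j^-=1_{\xi\le0}\kappa_j$, and let $\kappa_0^+=\kappa_0$, $\kappa_0^-=0$. Write $D_t=-i\partial_t$. Let $X$ be a complex Hilbert space and let $A(t),B(t)$, $t\in[0,1]$, be bounded self-adjoint operators on $X$ depending smoothly on $t$. Let $S(t,s)$ be the unitary evolution generated by $D_t+A$, i.e. $\partial_tS(t,s)=-iA(t)S(t,s)$, $S(s,s)=I$, and assume that $$\|(B(t)S(t,s)-S(t,s)B(s))x\|\le C\,|t-s|\,(\|B(s)x\|+\|x\|),\qquad t,s\in[0,1],\ x\in X.$$ Let $V^2_A$ be the space of right continuous functions $u:[0,1]\to X$ with finite norm $$\|u\|_{V^2_A}^2=\|u(0)\|^2+\sup_{t_0\le\dots\le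 t_n}\sum_j\|u(t_{j+1})-S(t_{j+1},t_j)u(t_j)\|^2,$$ the supremum being over finite increasing sequences in $[0,1]$, and let $(V^2_A)^*$ be the dual space of $V^2_A\cap C([0,1];X)$, whose elements are paired with functions through $\langle f,v\rangle=\int_0^1\langle f(t),v(t)\rangle\,dt$ (inner products are conjugate linear in the first variable). Let $H$ be the operator with kernel $$H(t,s)=1_{t>s}\sum_j\kappa_j^-(B(t))S(t,s)\kappa_j^-(B(s))e^{(t-s)B(s)}-1_{t<s}\sum_j\kappa_j^+(B(t))S(t,s)\kappa_j^+(B(s))e^{(t-s)B(s)},$$ defined on $(V^2_A)^*$ by duality, $\langle Hf,\varphi\rangle=\langle f,H^*\varphi\rangle$ for $\varphi\in C([0,1];X)$, where $(H^*\varphi)(s)=\int_0^1H(t,s)^*\varphi(t)\,dt$. Then $H^*\varphi\in V^2_A\cap C$ for every $\varphi\in C([0,1];X)$, and there is a constant $K$ depending only on $C$ and on the partition $(\kappa_j)$ (not on $X$, $A$, $B$, nor on any bounds for the norms or derivatives of $A$, $B$) such that for every $f\in(V^2_A)^*$: $$Hf\in V^2_A,\qquad \|Hf\|_{V^2_A}\le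 K\|f\|_{(V^2_A)^*},$$ and, with the derivative taken in the sense of distributions on $(0,1)$, $$(D_t+A+iB)(iHf)-f\in L^\infty(0,1;X),\qquad \|(D_t+A+iB)(iHf)-f\|_{L^\infty}\le K\|f\|_{(V^2_A)^*}.$$ Here $Hf$, a priori a distribution, is identified with a right continuous representative. -/

import Mathlib

open Set MeasureTheory
open scoped ENNReal NNReal ContDiff

noncomputable section

set_option linter.unusedSectionVars false

section Evolution

variable {X : Type*} [NormedAddCommGroup X] [InnerProductSpace ℂ X] [CompleteSpace X]

/-- The terms of the Dyson series of `D_t + A`, where `D_t = -i ∂_t`: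
`D₀ = 1`, `D_{n+1}(t) = ∫_s^t (-i A(r)) D_n(r) dr`. -/
def dysonTerm (A : ℝ → X →L[ℂ] X) (s : ℝ) : ℕ → ℝ → X →L[ℂ] X
  | 0, _ => 1
  | n + 1, t => ∫ r in s..t, (-Complex.I) • (A r * dysonTerm A s n r)

/-- The evolution `S(t,s)` generated by `D_t + A`, i.e. the solution operator of
`∂_t S(t,s) = -i A(t) S(t,s)`, `S(s,s) = 1` (see `evolution_self` and
`hasDerivWithinAt_evolution`). -/
def evolution (A : ℝ → X →L[ℂ] X) (t s : ℝ) : X →L[ℂ] X :=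
  ∑' n, dysonTerm A s n t

theorem dysonTerm_succ_self (A : ℝ → X →L[ℂ] X) (s : ℝ) (n : ℕ) :
    dysonTerm A s (n + 1) s = 0 := by
  simp [dysonTerm]

theorem evolution_self (A : ℝ → X →L[ℂ] X) (s : ℝ) : evolution A s s = 1 := by
  unfold evolution
  rw [tsum_eq_single 0]
  · rfl
  · intro n hn
    obtain ⟨m, rfl⟩ := Nat.exists_eq_succ_of_ne_zero hn
    exact dysonTerm_succ_self A s m

theorem continuous_dysonTerm {A : ℝ → X →L[ℂ] X} (hA : Continuous A) (s : ℝ) (n : ℕ) :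
    Continuous (dysonTerm A s n) := by
  induction n with
  | zero => exact continuous_const
  | succ n ih =>
    have h : Continuous fun r => (-Complex.I) • (A r * dysonTerm A s n r) :=
      (hA.mul ih).const_smul (-Complex.I)
    exact intervalIntegral.continuous_primitive (fun a b => h.intervalIntegrable a b) s

theorem hasDerivAt_dysonTerm {A : ℝ → X →L[ℂ] X} (hA : Continuous A) (s t : ℝ) (n : ℕ) :
    HasDerivAt (dysonTerm A s (n + 1)) ((-Complex.I) • (A t * dysonTerm A s n t)) t := by
  have h : Continuous fun r => (-Complex.I) • (A r * dysonTerm A s n r) :=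
    Continuous.const_smul (hA.mul (continuous_dysonTerm hA s n)) (-Complex.I)
  exact intervalIntegral.integral_hasDerivAt_right (h.intervalIntegrable s t)
    (h.stronglyMeasurableAtFilter _ _) h.continuousAt

theorem norm_dysonTerm_le {A : ℝ → X →L[ℂ] X} {M : ℝ}
    (hM : ∀ r, ‖A r‖ ≤ M) (s t : ℝ) (n : ℕ) :
    ‖dysonTerm A s n t‖ ≤ (M * |t - s|) ^ n / n.factorial := by
  have hM0 : 0 ≤ M := (norm_nonneg _).trans (hM 0)
  induction n generalizing t with
  | zero => simpa [dysonTerm] using! ContinuousLinearMap.norm_id_le (𝕜 := ℂ) (E := X)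
  | succ n ih =>
    have hcont : Continuous fun r : ℝ => M * ((M * |r - s|) ^ n / n.factorial) := by fun_prop
    calc ‖dysonTerm A s (n + 1) t‖
        ≤ ∫ r in uIoc s t, ‖(-Complex.I) • (A r * dysonTerm A s n r)‖ :=
          intervalIntegral.norm_integral_le_integral_norm_uIoc
      _ ≤ ∫ r in uIoc s t, M * ((M * |r - s|) ^ n / n.factorial) := by
          refine integral_mono_of_nonneg (.of_forall fun r => norm_nonneg _)
            (hcont.integrableOn_uIoc) (.of_forall fun r => ?_)
          simp only [norm_smul, norm_neg, Complex.norm_I, one_mul]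
          exact (norm_mul_le _ _).trans
            (mul_le_mul (hM r) (ih r) (norm_nonneg _) hM0)
      _ = (M * |t - s|) ^ (n + 1) / (n + 1).factorial := by
          have : (fun r : ℝ => M * ((M * |r - s|) ^ n / n.factorial)) =
              fun r => (M ^ (n + 1) / n.factorial) * |r - s| ^ n := by
            ext r; rw [mul_pow]; ring
          rw [this, integral_const_mul, integral_pow_abs_sub_uIoc, Nat.factorial_succ, mul_pow]
          push_cast
          field_simp

theorem summable_dysonTerm {A : ℝ → X →L[ℂ] X} {M : ℝ} (hM : ∀ r, ‖A r‖ ≤ M) (s t : ℝ) :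
    Summable fun n => dysonTerm A s n t :=
  Summable.of_norm_bounded (Real.summable_pow_div_factorial (M * |t - s|))
    (norm_dysonTerm_le hM s t)

theorem tsum_mul_dysonTerm {A : ℝ → X →L[ℂ] X} {M : ℝ} (hM : ∀ r, ‖A r‖ ≤ M) (s t : ℝ) :
    ∑' n, (-Complex.I) • (A t * dysonTerm A s n t) = (-Complex.I) • (A t * evolution A t s) :=
  (((summable_dysonTerm hM s t).hasSum.mul_left (A t)).const_smul (-Complex.I)).tsum_eq

theorem norm_mul_dysonTerm_le {A : ℝ → X →L[ℂ] X} {M : ℝ} (hM : ∀ r, ‖A r‖ ≤ M)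
    {s r R : ℝ} (hr : r ∈ Metric.ball s R) (n : ℕ) :
    ‖(-Complex.I) • (A r * dysonTerm A s n r)‖ ≤ M * ((M * R) ^ n / n.factorial) := by
  have hM0 : 0 ≤ M := (norm_nonneg _).trans (hM 0)
  have h1 : ‖dysonTerm A s n r‖ ≤ (M * R) ^ n / n.factorial := by
    refine (norm_dysonTerm_le hM s r n).trans ?_
    have : |r - s| ≤ R := by
      rw [Metric.mem_ball, Real.dist_eq] at hr
      exact hr.le
    gcongr
  rw [norm_smul, norm_neg, Complex.norm_I, one_mul]
  exact (norm_mul_le _ _).trans (mul_le_mul (hM r) h1 (norm_nonneg _) hM0)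

theorem hasDerivAt_evolution_of_continuous {A : ℝ → X →L[ℂ] X} (hA : Continuous A) {M : ℝ}
    (hM : ∀ r, ‖A r‖ ≤ M) (s t : ℝ) :
    HasDerivAt (fun r => evolution A r s) ((-Complex.I) • (A t * evolution A t s)) t := by
  have ht : t ∈ Metric.ball s (|t - s| + 1) := by
    rw [Metric.mem_ball, Real.dist_eq]; linarith
  have hsum : Summable fun n : ℕ => M * ((M * (|t - s| + 1)) ^ n / n.factorial) :=
    (Real.summable_pow_div_factorial _).mul_left M
  have h0 : Summable fun n => dysonTerm A s (n + 1) t :=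
    (summable_nat_add_iff 1).2 (summable_dysonTerm hM s t)
  have key := hasDerivAt_tsum_of_isPreconnected hsum Metric.isOpen_ball
    (convex_ball s (|t - s| + 1)).isPreconnected
    (fun n r _ => hasDerivAt_dysonTerm hA s r n)
    (fun n r hr => norm_mul_dysonTerm_le hM hr n) ht h0 ht
  rw [tsum_mul_dysonTerm hM] at key
  have e2 : (fun r => evolution A r s) = fun r => 1 + ∑' n, dysonTerm A s (n + 1) r :=
    funext fun r => (summable_dysonTerm hM s r).tsum_eq_zero_add
  rw [e2]
  exact key.const_add (1 : X →L[ℂ] X)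

theorem dysonTerm_congr {A A' : ℝ → X →L[ℂ] X} (h : EqOn A A' (Icc 0 1)) {s : ℝ}
    (hs : s ∈ Icc (0 : ℝ) 1) (n : ℕ) {t : ℝ} (ht : t ∈ Icc (0 : ℝ) 1) :
    dysonTerm A s n t = dysonTerm A' s n t := by
  induction n generalizing t with
  | zero => rfl
  | succ n ih =>
    refine intervalIntegral.integral_congr fun r hr => ?_
    have hr' : r ∈ Icc (0 : ℝ) 1 := (convex_Icc (0 : ℝ) 1).ordConnected.uIcc_subset hs ht hr
    simp only [h hr', ih hr']

/-- `(D_t + A(t)) S(t,s) = 0` on `[0,1]`. -/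
theorem hasDerivWithinAt_evolution {A : ℝ → X →L[ℂ] X} (hA : ContinuousOn A (Icc 0 1))
    {s t : ℝ} (hs : s ∈ Icc (0 : ℝ) 1) (ht : t ∈ Icc (0 : ℝ) 1) :
    HasDerivWithinAt (fun r => evolution A r s) ((-Complex.I) • (A t * evolution A t s))
      (Icc 0 1) t := by
  set A' : ℝ → X →L[ℂ] X := IccExtend zero_le_one ((Icc (0 : ℝ) 1).domRestrict A) with hA'
  have hc : Continuous A' := (continuousOn_iff_continuous_domRestrict.1 hA).Icc_extend'
  have hE : EqOn A A' (Icc 0 1) := fun r hr => by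
    rw [hA', IccExtend_of_mem _ _ hr]; rfl
  obtain ⟨M, hM⟩ := (isCompact_Icc (a := (0 : ℝ)) (b := 1)).exists_bound_of_continuousOn hA
  have hM' : ∀ r, ‖A' r‖ ≤ M := fun r => hM _ (Subtype.coe_prop _)
  have hev : ∀ r ∈ Icc (0 : ℝ) 1, evolution A r s = evolution A' r s := fun r hr =>
    tsum_congr fun n => dysonTerm_congr hE hs n hr
  have := (hasDerivAt_evolution_of_continuous hc hM' s t).hasDerivWithinAt (s := Icc 0 1)
  rw [hE ht, hev t ht]
  exact this.congr hev (hev t ht)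

end Evolution

section VariationSpace

variable {X : Type*} [NormedAddCommGroup X] [InnerProductSpace ℂ X] [CompleteSpace X]

/-- The square of the `V²_A` norm of `u` on `[0,1]`,
`‖u(0)‖² + sup ∑_j ‖u(t_{j+1}) - S(t_{j+1},t_j) u(t_j)‖²`, the supremum over all finite
increasing sequences `t_0 ≤ t_1 ≤ ⋯ ≤ t_n` in `[0,1]`. -/
def v2NormSq (A : ℝ → X →L[ℂ] X) (u : ℝ → X) : ℝ≥0∞ :=
  ‖u 0‖ₑ ^ 2 +
    ⨆ p : ℕ × {t : ℕ → ℝ // Monotone t ∧ ∀ j, t j ∈ Icc (0 : ℝ) 1},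
      ∑ j ∈ Finset.range p.1,
        ‖u (p.2.1 (j + 1)) - evolution A (p.2.1 (j + 1)) (p.2.1 j) (u (p.2.1 j))‖ₑ ^ 2

/-- The `V²_A` norm (`∞` if `u` does not have bounded 2-variation along the flow). -/
def v2Norm (A : ℝ → X →L[ℂ] X) (u : ℝ → X) : ℝ≥0∞ :=
  v2NormSq A u ^ (1 / 2 : ℝ)

/-- Membership in `V²_A`: right continuous functions on `[0,1]` of finite `V²_A` norm.
Only the values of `u` on `[0,1]` matter. -/
def MemV2 (A : ℝ → X →L[ℂ] X) (u : ℝ → X) : Prop :=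
  (∀ t ∈ Ico (0 : ℝ) 1, ContinuousWithinAt u (Ici t) t) ∧ v2Norm A u < ⊤

theorem v2Norm_lt_top {A : ℝ → X →L[ℂ] X} {u : ℝ → X} :
    v2Norm A u < ⊤ ↔ v2NormSq A u < ⊤ := by
  unfold v2Norm
  exact ENNReal.rpow_lt_top_iff_of_pos (by norm_num)

theorem enorm_add_sq_le (x y : X) : ‖x + y‖ₑ ^ 2 ≤ 2 * (‖x‖ₑ ^ 2 + ‖y‖ₑ ^ 2) := by
  have h : ‖x + y‖ ^ 2 ≤ 2 * (‖x‖ ^ 2 + ‖y‖ ^ 2) := by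
    have := norm_add_le x y
    nlinarith [norm_nonneg (x + y), sq_nonneg (‖x‖ - ‖y‖), norm_nonneg x, norm_nonneg y]
  simp only [enorm_eq_nnnorm]
  exact_mod_cast h

theorem v2NormSq_add_le (A : ℝ → X →L[ℂ] X) (u v : ℝ → X) :
    v2NormSq A (u + v) ≤ 2 * (v2NormSq A u + v2NormSq A v) := by
  have hsup : ∀ w : ℝ → X, ∀ p : ℕ × {t : ℕ → ℝ // Monotone t ∧ ∀ j, t j ∈ Icc (0 : ℝ) 1},
      ‖w 0‖ₑ ^ 2 + ∑ j ∈ Finset.range p.1,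
        ‖w (p.2.1 (j + 1)) - evolution A (p.2.1 (j + 1)) (p.2.1 j) (w (p.2.1 j))‖ₑ ^ 2
        ≤ v2NormSq A w := fun w p => by
    unfold v2NormSq
    gcongr
    exact le_iSup (fun p : ℕ × {t : ℕ → ℝ // Monotone t ∧ ∀ j, t j ∈ Icc (0 : ℝ) 1} =>
      ∑ j ∈ Finset.range p.1,
        ‖w (p.2.1 (j + 1)) - evolution A (p.2.1 (j + 1)) (p.2.1 j) (w (p.2.1 j))‖ₑ ^ 2) p
  have : Nonempty (ℕ × {t : ℕ → ℝ // Monotone t ∧ ∀ j, t j ∈ Icc (0 : ℝ) 1}) :=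
    ⟨(0, ⟨fun _ => 0, monotone_const, fun _ => by simp⟩)⟩
  conv_lhs => unfold v2NormSq
  rw [ENNReal.add_iSup]
  refine iSup_le fun p => ?_
  refine le_trans ?_ (mul_le_mul_right (add_le_add (hsup u p) (hsup v p)) 2)
  have e : ∀ a b c d : ℝ≥0∞, 2 * ((a + b) + (c + d)) = 2 * (a + c) + 2 * (b + d) := by
    intros; ring
  rw [e, ← Finset.sum_add_distrib, Finset.mul_sum]
  refine add_le_add (enorm_add_sq_le _ _) (Finset.sum_le_sum fun j _ => ?_)
  refine le_trans (le_of_eq ?_) (enorm_add_sq_le _ _)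
  congr 2
  simp only [Pi.add_apply, map_add]
  abel

theorem v2NormSq_smul_le (A : ℝ → X →L[ℂ] X) (c : ℂ) (u : ℝ → X) :
    v2NormSq A (c • u) ≤ ‖c‖ₑ ^ 2 * v2NormSq A u := by
  unfold v2NormSq
  rw [mul_add, ENNReal.mul_iSup]
  refine add_le_add (by simp [enorm_smul, mul_pow]) (iSup_mono fun p => ?_)
  rw [Finset.mul_sum]
  refine Finset.sum_le_sum fun j _ => ?_
  simp only [Pi.smul_apply, map_smul, ← smul_sub, enorm_smul, mul_pow, le_refl]

/-- The space `V²_A ∩ C` of continuous functions on `[0,1]` of finite `V²_A` norm. -/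
def V2C (A : ℝ → X →L[ℂ] X) : Submodule ℂ (ℝ → X) where
  carrier := {v | ContinuousOn v (Icc 0 1) ∧ v2Norm A v < ⊤}
  zero_mem' := by
    refine ⟨continuousOn_const, v2Norm_lt_top.2 ?_⟩
    simp [v2NormSq]
  add_mem' := by
    rintro u v ⟨hu, hu'⟩ ⟨hv, hv'⟩
    refine ⟨hu.add hv, v2Norm_lt_top.2 ?_⟩
    rw [v2Norm_lt_top] at hu' hv'
    exact (v2NormSq_add_le A u v).trans_lt
      (ENNReal.mul_lt_top (by norm_num) (ENNReal.add_lt_top.2 ⟨hu', hv'⟩))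
  smul_mem' := by
    rintro c u ⟨hu, hu'⟩
    refine ⟨hu.const_smul c, v2Norm_lt_top.2 ?_⟩
    rw [v2Norm_lt_top] at hu'
    exact (v2NormSq_smul_le A c u).trans_lt
      (ENNReal.mul_lt_top (ENNReal.pow_lt_top enorm_lt_top) hu')

/-- The norm on `(V²_A)^*`, the dual space of `V²_A ∩ C`. A linear functional `f` on `V²_A ∩ C`
belongs to `(V²_A)^*` iff this is finite. A function or measure `F` with values in `X` is
identified with the functional `f(v) = ∫ ⟪F(t), v(t)⟫ dt`; so `f₀ δ_{t₀}` is
`v ↦ ⟪f₀, v(t₀)⟫`. (The inner product is conjugate linear in its first variable.) -/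
def v2DualNorm (A : ℝ → X →L[ℂ] X) (f : V2C A →ₗ[ℂ] ℂ) : ℝ≥0∞ :=
  ⨆ (v : V2C A) (_ : v2Norm A (v : ℝ → X) ≤ 1), ‖f v‖ₑ

end VariationSpace

section Parametrix

/-- A dyadic partition of unity `1 = ∑_j κ_j²` with `κ_j` supported in
`{2^j ≤ max{|ξ|,1} ≤ 2^{j+2}}` and smooth on the scale of its support. -/
structure IsDyadicPartition (κ : ℕ → ℝ → ℝ) : Prop where
  smooth : ∀ j, ContDiff ℝ ∞ (κ j)
  support : ∀ j ξ, κ j ξ ≠ 0 → 2 ^ j ≤ max |ξ| 1 ∧ max |ξ| 1 ≤ 2 ^ (j + 2)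
  scale : ∀ m : ℕ, ∃ c : ℝ, ∀ j ξ, (2 ^ j) ^ m * |iteratedDeriv m (κ j) ξ| ≤ c
  sum_sq : ∀ ξ, HasSum (fun j => κ j ξ ^ 2) 1

/-- `κ_j⁺`: the part of `κ_j` on `[0,∞)` for `j > 0`, and `κ_0⁺ = κ_0`. -/
def kappaPlus (κ : ℕ → ℝ → ℝ) (j : ℕ) (ξ : ℝ) : ℝ :=
  if j = 0 ∨ 0 ≤ ξ then κ j ξ else 0

/-- `κ_j⁻`: the part of `κ_j` on `(-∞,0]` for `j > 0`, and `κ_0⁻ = 0`. -/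
def kappaMinus (κ : ℕ → ℝ → ℝ) (j : ℕ) (ξ : ℝ) : ℝ :=
  if j ≠ 0 ∧ ξ ≤ 0 then κ j ξ else 0

variable {X : Type*} [NormedAddCommGroup X] [InnerProductSpace ℂ X] [CompleteSpace X]

/-- The kernel of the parametrix,
`H(t,s) = 1_{t>s} ∑_j κ_j⁻(B(t)) S(t,s) κ_j⁻(B(s)) e^{(t-s)B(s)}
  - 1_{t<s} ∑_j κ_j⁺(B(t)) S(t,s) κ_j⁺(B(s)) e^{(t-s)B(s)}`.
For bounded `B` the sums have only finitely many nonzero terms. -/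
def parametrix (κ : ℕ → ℝ → ℝ) (A B : ℝ → X →L[ℂ] X) (t s : ℝ) : X →L[ℂ] X :=
  (if s < t then
    ∑' j, cfc (kappaMinus κ j) (B t) * evolution A t s * cfc (kappaMinus κ j) (B s)
      * cfc (fun ξ : ℝ => Real.exp ((t - s) * ξ)) (B s) else 0)
  - (if t < s then
    ∑' j, cfc (kappaPlus κ j) (B t) * evolution A t s * cfc (kappaPlus κ j) (B s)
      * cfc (fun ξ : ℝ => Real.exp ((t - s) * ξ)) (B s) else 0)

/-- The adjoint `(H^* φ)(s) = ∫_0^1 H(t,s)^* φ(t) dt` of the operator with kernel `H`. -/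
def parametrixAdjoint (κ : ℕ → ℝ → ℝ) (A B : ℝ → X →L[ℂ] X) (φ : ℝ → X) (s : ℝ) : X :=
  ∫ t in (0 : ℝ)..1, (ContinuousLinearMap.adjoint (parametrix κ A B t s)) (φ t)

/-- `u = H f` for a functional `f` on `V²_A ∩ C`, where formally `(H f)(t) = ∫ H(t,s) f(s) ds`.
This is defined by duality: `⟨H f, φ⟩ = f(H^* φ)` for all continuous `φ` on `[0,1]`, which
includes that `H^* φ` belongs to `V²_A ∩ C`. -/
def IsParametrixImage (κ : ℕ → ℝ → ℝ) (A B : ℝ → X →L[ℂ] X) (f : V2C A →ₗ[ℂ] ℂ)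
    (u : ℝ → X) : Prop :=
  ∀ φ : ℝ → X, ContinuousOn φ (Icc 0 1) →
    ∃ h : parametrixAdjoint κ A B φ ∈ V2C A,
      ∫ t in (0 : ℝ)..1, inner ℂ (u t) (φ t) = f ⟨parametrixAdjoint κ A B φ, h⟩

/-- The distribution `(D_t + A + iB) w` on `(0,1)`, with `D_t = -i ∂_t`, applied to a test
function: `⟨(D_t + A + iB) w, ψ⟩ = ∫ ⟪w, (D_t + A - iB) ψ⟫ dt`. -/
def applyDtAB (A B : ℝ → X →L[ℂ] X) (w ψ : ℝ → X) : ℂ :=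
  ∫ t in (0 : ℝ)..1,
    inner ℂ (w t) ((-Complex.I) • deriv ψ t + A t (ψ t) - Complex.I • B t (ψ t))

/-- The equation `(D_t + A + iB) w - f = g` in the sense of distributions on `(0,1)`. -/
def IsWeakError (A B : ℝ → X →L[ℂ] X) (w : ℝ → X) (f : V2C A →ₗ[ℂ] ℂ) (g : ℝ → X) : Prop :=
  ∀ ψ : ℝ → X, ContDiff ℝ ∞ ψ → HasCompactSupport ψ → tsupport ψ ⊆ Ioo 0 1 →
    ∃ h : ψ ∈ V2C A,
      applyDtAB A B w ψ - f ⟨ψ, h⟩ = ∫ t in (0 : ℝ)..1, inner ℂ (g t) (ψ t)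

end Parametrix

end

/-! The flow is removed by a change of coordinates. With `U(t) = S(t,0)`, which is unitary, and
`b(t) = U(t)* B(t) U(t)`, the norm of `V²_A` becomes the ordinary 2-variation norm, the commutator
hypothesis becomes the relative Lipschitz bound `‖(b(t) - b(s))x‖ ≤ C|t - s|(‖b(s)x‖ + ‖x‖)`
(`isRelLipschitz_flowConj`), and `H(t,s)*` becomes a signed sum of terms `1_{ε(t-s)>0} e^{(t-s)b(s)}
c_j(b(s)) c_j(b(t))`, where `c_j` is `κ_j⁻` for `ε = 1` and `κ_j⁺` for `ε = -1` (`star_parametrix`).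
By duality the theorem reduces to `V²` bounds in `s` for this kernel and for an error kernel. Since
`b` is bounded on `[0,1]`, only indices `j < J` occur; no constant depends on `J`.

Two estimates carry the kernel bounds. First, if `μ_j` is smooth on the scale `2^j`, then `x ↦
(μ_j(b(t))x)_j` is Lipschitz in `t` as an operator from `X` to `ℓ²(X)` (`sum_norm_cfc_sub_sq_le`).
Fourier inversion writes `μ_j(b)` as a superposition of the unitaries `e^{iξb}`, Duhamel's formula
compares these and gains `2^{-j}`, localization by `κ_k` gives decay `2^{-|j-k|}`, and Schur's test
sums. Second, `c_j(ξ)e^{ετξ}` is a layer cake `∫_{σ > 2^j τ} μ_{j,σ}(ξ) dσ` whose densities are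
exponentially small in `σ`. The discontinuity at `s = t` then sits only in the windows `0 < ε(t-s) <
2^{-j}σ`, whose 2-variation is bounded, and Minkowski's inequality in `σ` gives
`HalfPartition.v2Le_sum_halfSemigroup`.

Duality turns bounds for the kernel into bounds for `Hf`. The map `φ ↦ f(H*φ)` is bounded in the
`L¹` norm, so it is given by a bounded function. Testing with differences of short averages along a
partition bounds its 2-variation at Lebesgue points, and a right continuous representative inherits
the bound (`IsVariationKernel.exists_rightContinuous_representing`).

For the equation, differentiate `e^{(t-s)b(s)} ∑_j c_j(b(s)) c_j(b(t)) ψ(t)` in `t`. This is the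
kernel applied to `ψ' + bψ`, plus an error kernel that contains `∂_t c_j(b(t))` and `(b(s) -
b(t))c_j(b(t))`. After integration the boundary terms at `t = s` of the two halves combine to
`-ψ(s)` by the partition of unity. The error kernel is bounded in `V²` in `s`, uniformly in `t`: the
derivative is controlled by the Lipschitz estimate, and in the other term the factor `2^j|t-s|` is
at most `σ` on the window. Hence it maps `f` to a bounded function. -/

set_option linter.unusedSectionVars false

/-! ### Calculus of the 2-variation norm without the flow. -/

section FlatVariation

variable {X : Type*} [NormedAddCommGroup X] [InnerProductSpace ℂ X] [CompleteSpace X]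

/-- The initial value and the increments of `u` along the partition `t`, as a vector in `ℓ²`. -/
noncomputable def increments (t : ℕ → ℝ) (n : ℕ) :
    (ℝ → X) →ₗ[ℂ] PiLp 2 (fun _ : Option (Fin n) => X) where
  toFun u := WithLp.toLp 2 fun o => o.elim (u 0) fun i => u (t (i + 1)) - u (t i)
  map_add' u v := by
    ext o; cases o <;> simp; abel
  map_smul' c u := by
    ext o; cases o <;> simp [smul_sub]

/-- `u` has `V²` norm at most `K` on `[0,1]`. -/
def V2Le (u : ℝ → X) (K : ℝ) : Prop :=
  ∀ (n : ℕ) (t : ℕ → ℝ), Monotone t → (∀ j, t j ∈ Icc (0 : ℝ) 1) → ‖increments t n u‖ ≤ K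

theorem norm_increments_sq (t : ℕ → ℝ) (n : ℕ) (u : ℝ → X) :
    ‖increments t n u‖ ^ 2 =
      ‖u 0‖ ^ 2 + ∑ j ∈ Finset.range n, ‖u (t (j + 1)) - u (t j)‖ ^ 2 := by
  rw [PiLp.norm_sq_eq_of_L2, Fintype.sum_option, Finset.sum_range]
  rfl

theorem V2Le.sq_le {u : ℝ → X} {K : ℝ} (h : V2Le u K) {n : ℕ} {t : ℕ → ℝ} (ht : Monotone t)
    (ht' : ∀ j, t j ∈ Icc (0 : ℝ) 1) :
    ‖u 0‖ ^ 2 + ∑ j ∈ Finset.range n, ‖u (t (j + 1)) - u (t j)‖ ^ 2 ≤ K ^ 2 := by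
  rw [← norm_increments_sq]
  exact pow_le_pow_left₀ (norm_nonneg _) (h n t ht ht') 2

theorem V2Le.of_sq {u : ℝ → X} {K : ℝ} (hK : 0 ≤ K)
    (h : ∀ (n : ℕ) (t : ℕ → ℝ), Monotone t → (∀ j, t j ∈ Icc (0 : ℝ) 1) →
      ‖u 0‖ ^ 2 + ∑ j ∈ Finset.range n, ‖u (t (j + 1)) - u (t j)‖ ^ 2 ≤ K ^ 2) : V2Le u K := by
  intro n t ht ht'
  refine (abs_le_of_sq_le_sq' ?_ hK).2
  rw [norm_increments_sq]
  exact h n t ht ht'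

theorem V2Le.nonneg {u : ℝ → X} {K : ℝ} (h : V2Le u K) : 0 ≤ K :=
  (norm_nonneg _).trans (h 0 (fun _ => 0) monotone_const fun _ => by simp)

theorem V2Le.mono {u : ℝ → X} {K K' : ℝ} (h : V2Le u K) (hK : K ≤ K') : V2Le u K' :=
  fun n t ht ht' => (h n t ht ht').trans hK

theorem V2Le.congr {u v : ℝ → X} {K : ℝ} (h : V2Le u K) (huv : EqOn u v (Icc 0 1)) :
    V2Le v K := by
  refine V2Le.of_sq h.nonneg fun n t ht ht' => ?_
  have := h.sq_le (n := n) ht ht'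
  rw [huv (by simp)] at this
  simpa only [huv (ht' _)] using this

theorem V2Le.add {u v : ℝ → X} {K L : ℝ} (hu : V2Le u K) (hv : V2Le v L) :
    V2Le (fun s => u s + v s) (K + L) := by
  intro n t ht ht'
  have : (fun s => u s + v s) = u + v := rfl
  rw [this, map_add]
  exact (norm_add_le _ _).trans (add_le_add (hu n t ht ht') (hv n t ht ht'))

theorem V2Le.const_smul {u : ℝ → X} {K : ℝ} (hu : V2Le u K) (c : ℂ) :
    V2Le (fun s => c • u s) (‖c‖ * K) := by
  intro n t ht ht'
  have : (fun s => c • u s) = c • u := rfl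
  rw [this, map_smul, norm_smul]
  exact mul_le_mul_of_nonneg_left (hu n t ht ht') (norm_nonneg _)

theorem V2Le.neg {u : ℝ → X} {K : ℝ} (hu : V2Le u K) : V2Le (fun s => -u s) K := by
  simpa using hu.const_smul (-1)

theorem V2Le.sub {u v : ℝ → X} {K L : ℝ} (hu : V2Le u K) (hv : V2Le v L) :
    V2Le (fun s => u s - v s) (K + L) := by
  simpa only [sub_eq_add_neg] using hu.add hv.neg

theorem V2Le.zero : V2Le (fun _ => 0 : ℝ → X) 0 :=
  V2Le.of_sq le_rfl fun n t _ _ => by simp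

theorem V2Le.sum {ι : Type*} (J : Finset ι) {u : ι → ℝ → X} {K : ι → ℝ}
    (hu : ∀ i ∈ J, V2Le (u i) (K i)) : V2Le (fun s => ∑ i ∈ J, u i s) (∑ i ∈ J, K i) := by
  classical
  induction J using Finset.induction_on with
  | empty => simpa using V2Le.zero
  | insert i J hi ih =>
    simp only [Finset.sum_insert hi]
    exact (hu i (by simp)).add (ih fun j hj => hu j (by simp [hj]))

/-- The partition `0, s, s, …` has one nontrivial increment, so `‖u 0‖` and `‖u s - u 0‖` are both
at most `K`. -/
theorem V2Le.norm_le {u : ℝ → X} {K : ℝ} (hu : V2Le u K) {s : ℝ} (hs : s ∈ Icc (0 : ℝ) 1) :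
    ‖u s‖ ≤ 2 * K := by
  have hm : Monotone fun j : ℕ => if j = 0 then (0 : ℝ) else s := by
    intro i j hij
    by_cases hi : i = 0
    · by_cases hj : j = 0 <;> simp [hi, hj, hs.1]
    · have hj : j ≠ 0 := by omega
      simp [hi, hj]
  have h := hu.sq_le (n := 1) hm fun j => by by_cases hj : j = 0 <;> simp [hj, hs.1, hs.2]
  simp only [Finset.range_one, Finset.sum_singleton, zero_add, one_ne_zero, if_false,
    if_true] at h
  have h1 := norm_le_norm_add_norm_sub (u 0) (u s)
  have h0 := hu.nonneg
  have e1 : ‖u 0‖ ≤ K := by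
    refine abs_le_of_sq_le_sq' ?_ h0 |>.2; nlinarith [sq_nonneg ‖u s - u 0‖]
  have e2 : ‖u s - u 0‖ ≤ K := by
    refine abs_le_of_sq_le_sq' ?_ h0 |>.2; nlinarith [sq_nonneg ‖u 0‖]
  have := norm_sub_rev (u 0) (u s)
  linarith

theorem V2Le.const (y : X) : V2Le (fun _ => y) ‖y‖ :=
  V2Le.of_sq (norm_nonneg _) fun n t _ _ => by simp

/-- Minkowski's inequality for the `V²` norm. -/
theorem V2Le.integral {Θ : Type*} [MeasurableSpace Θ] {ν : Measure Θ} {q : Θ → ℝ → X}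
    {ρ : Θ → ℝ} (hint : ∀ s ∈ Icc (0 : ℝ) 1, Integrable (fun θ => q θ s) ν)
    (hq : ∀ᵐ θ ∂ν, V2Le (q θ) (ρ θ)) (hρ : Integrable ρ ν) :
    V2Le (fun s => ∫ θ, q θ s ∂ν) (∫ θ, ρ θ ∂ν) := by
  intro n t ht ht'
  have hi : ∀ o, Integrable (fun θ => (increments t n (q θ)) o) ν := by
    rintro (_ | i)
    · exact hint 0 (by simp)
    · exact (hint _ (ht' _)).sub (hint _ (ht' _))
  have hI : Integrable (fun θ => increments t n (q θ)) ν := Integrable.of_eval_piLp hi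
  have : increments t n (fun s => ∫ θ, q θ s ∂ν) = ∫ θ, increments t n (q θ) ∂ν := by
    ext o
    rw [eval_integral_piLp hi]
    rcases o with _ | i
    · rfl
    · exact (integral_sub (hint _ (ht' _)) (hint _ (ht' _))).symm
  rw [this]
  exact norm_integral_le_of_norm_le hρ (hq.mono fun θ h => h n t ht ht')

theorem sum_abs_sub_le_one_of_antitone {χ : ℝ → ℝ} (hχ : Antitone χ)
    (h01 : ∀ s, χ s ∈ Icc (0 : ℝ) 1) {t : ℕ → ℝ} (ht : Monotone t) (n : ℕ) :
    ∑ j ∈ Finset.range n, |χ (t (j + 1)) - χ (t j)| ≤ 1 := by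
  have : ∀ j, |χ (t (j + 1)) - χ (t j)| = χ (t j) - χ (t (j + 1)) := fun j => by
    rw [abs_of_nonpos (sub_nonpos.2 (hχ (ht j.le_succ)))]; ring
  simp only [this]
  rw [Finset.sum_range_sub' (fun j => χ (t j))]
  linarith [(h01 (t 0)).2, (h01 (t n)).1]

/-- Cauchy–Schwarz after splitting `|e k|` into two square roots. -/
theorem norm_sum_smul_sq_le {ι : Type*} (J : Finset ι) (e : ι → ℝ) (y : ι → X) :
    ‖∑ k ∈ J, e k • y k‖ ^ 2 ≤ (∑ k ∈ J, |e k|) * ∑ k ∈ J, |e k| * ‖y k‖ ^ 2 := by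
  have h1 : ‖∑ k ∈ J, e k • y k‖ ≤ ∑ k ∈ J, √|e k| * (√|e k| * ‖y k‖) := by
    refine (norm_sum_le _ _).trans (Finset.sum_le_sum fun k _ => ?_)
    rw [norm_smul, Real.norm_eq_abs, ← mul_assoc, Real.mul_self_sqrt (abs_nonneg _)]
  refine (pow_le_pow_left₀ (norm_nonneg _) h1 2).trans
    ((Finset.sum_mul_sq_le_sq_mul_sq _ _ _).trans (le_of_eq ?_))
  simp only [mul_pow, Real.sq_sqrt (abs_nonneg _)]

/-- A superposition of differences of consecutive cut-offs has `V²` norm controlled by the `ℓ²`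
norm of its values. -/
theorem V2Le.step {χ : ℕ → ℝ → ℝ} (hanti : ∀ k, Antitone (χ k)) (hmono : ∀ s, Monotone (χ · s))
    (h01 : ∀ k s, χ k s ∈ Icc (0 : ℝ) 1) (m : ℕ) (y : ℕ → X) {R : ℝ} (hR : 0 ≤ R)
    (hy : ∑ k ∈ Finset.range m, ‖y k‖ ^ 2 ≤ R ^ 2) :
    V2Le (fun s => ∑ k ∈ Finset.range m, (χ (k + 1) s - χ k s) • y k) (3 * R) := by
  set d : ℕ → ℝ → ℝ := fun k s => χ (k + 1) s - χ k s with hd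
  have hd0 : ∀ k s, 0 ≤ d k s := fun k s => sub_nonneg.2 (hmono s k.le_succ)
  have hd1 : ∀ s, ∑ k ∈ Finset.range m, d k s ≤ 1 := fun s => by
    rw [Finset.sum_range_sub (fun k => χ k s)]
    linarith [(h01 m s).2, (h01 0 s).1]
  have hdle : ∀ k s, d k s ≤ 1 := fun k s => by
    simp only [hd]; linarith [(h01 (k + 1) s).2, (h01 k s).1]
  refine V2Le.of_sq (by positivity) fun n t ht _ => ?_
  have h0 : ‖∑ k ∈ Finset.range m, d k 0 • y k‖ ^ 2 ≤ R ^ 2 := by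
    refine (norm_sum_smul_sq_le _ _ _).trans ?_
    simp only [abs_of_nonneg (hd0 _ _)]
    calc _ ≤ 1 * ∑ k ∈ Finset.range m, 1 * ‖y k‖ ^ 2 := by
          gcongr
          · exact Finset.sum_nonneg fun k _ => mul_nonneg (hd0 _ _) (sq_nonneg _)
          · exact hd1 0
          · exact hdle _ _
      _ ≤ R ^ 2 := by simpa using hy
  have hstep : ∀ s s', ‖∑ k ∈ Finset.range m, d k s' • y k - ∑ k ∈ Finset.range m, d k s • y k‖ ^ 2
      ≤ 2 * ∑ k ∈ Finset.range m, |d k s' - d k s| * ‖y k‖ ^ 2 := fun s s' => by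
    rw [← Finset.sum_sub_distrib]
    simp only [← sub_smul]
    refine (norm_sum_smul_sq_le _ _ _).trans ?_
    gcongr
    calc _ ≤ ∑ k ∈ Finset.range m, (d k s' + d k s) := Finset.sum_le_sum fun k _ => by
          rw [abs_le]; constructor <;> linarith [hd0 k s, hd0 k s']
      _ ≤ 2 := by rw [Finset.sum_add_distrib]; linarith [hd1 s, hd1 s']
  have hvar : ∀ k, ∑ j ∈ Finset.range n, |d k (t (j + 1)) - d k (t j)| ≤ 2 := fun k => by
    have h1 := sum_abs_sub_le_one_of_antitone (hanti (k + 1)) (h01 _) ht n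
    have h2 := sum_abs_sub_le_one_of_antitone (hanti k) (h01 _) ht n
    calc _ ≤ ∑ j ∈ Finset.range n, (|χ (k + 1) (t (j + 1)) - χ (k + 1) (t j)|
          + |χ k (t (j + 1)) - χ k (t j)|) := Finset.sum_le_sum fun j _ => by
          simp only [hd]
          refine le_trans (le_of_eq ?_) (abs_sub _ _)
          congr 1; ring
      _ ≤ 2 := by rw [Finset.sum_add_distrib]; linarith
  -- Interchanging the sums charges each `‖y k‖²` with the total variation of `d k` alone, at most
  -- 2. This is what makes the bound depend on the `ℓ²` norm of `y`.
  have htot : ∑ j ∈ Finset.range n, ‖∑ k ∈ Finset.range m, d k (t (j + 1)) • y k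
      - ∑ k ∈ Finset.range m, d k (t j) • y k‖ ^ 2 ≤ 4 * R ^ 2 := by
    calc _ ≤ ∑ j ∈ Finset.range n,
          2 * ∑ k ∈ Finset.range m, |d k (t (j + 1)) - d k (t j)| * ‖y k‖ ^ 2 :=
          Finset.sum_le_sum fun j _ => hstep _ _
      _ = 2 * ∑ k ∈ Finset.range m,
          (∑ j ∈ Finset.range n, |d k (t (j + 1)) - d k (t j)|) * ‖y k‖ ^ 2 := by
          rw [← Finset.mul_sum, Finset.sum_comm]
          simp only [Finset.sum_mul]
      _ ≤ 2 * ∑ k ∈ Finset.range m, 2 * ‖y k‖ ^ 2 := by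
          gcongr with k hk; exact hvar k
      _ ≤ 4 * R ^ 2 := by rw [← Finset.mul_sum]; linarith
  change ‖∑ k ∈ Finset.range m, d k 0 • y k‖ ^ 2 + ∑ j ∈ Finset.range n,
    ‖∑ k ∈ Finset.range m, d k (t (j + 1)) • y k - ∑ k ∈ Finset.range m, d k (t j) • y k‖ ^ 2 ≤ _
  nlinarith

/-- Product rule for increments. A jump of the cut-off multiplies a vector of norm at most `2R`, and
since the jumps are at most 2 their squares are controlled by the total variation. This adds up to
`34 R² ≤ (6R)²`. -/
theorem V2Le.smul_cutoff {χ₁ χ₂ : ℝ → ℝ} (h₁ : Antitone χ₁) (h₂ : Antitone χ₂)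
    (h₁' : ∀ s, χ₁ s ∈ Icc (0 : ℝ) 1) (h₂' : ∀ s, χ₂ s ∈ Icc (0 : ℝ) 1)
    {r : ℝ → X} {R : ℝ} (hr : V2Le r R) :
    V2Le (fun s => (χ₂ s - χ₁ s) • r s) (6 * R) := by
  have hR := hr.nonneg
  refine V2Le.of_sq (by positivity) fun n t ht ht' => ?_
  have hd : ∀ s, |χ₂ s - χ₁ s| ≤ 1 := fun s => by
    rw [abs_le]; constructor <;> linarith [(h₁' s).1, (h₁' s).2, (h₂' s).1, (h₂' s).2]
  have hvar : ∑ j ∈ Finset.range n,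
      |(χ₂ (t (j + 1)) - χ₁ (t (j + 1))) - (χ₂ (t j) - χ₁ (t j))| ≤ 2 := by
    have e1 := sum_abs_sub_le_one_of_antitone h₁ h₁' ht n
    have e2 := sum_abs_sub_le_one_of_antitone h₂ h₂' ht n
    calc _ ≤ ∑ j ∈ Finset.range n, (|χ₂ (t (j + 1)) - χ₂ (t j)|
          + |χ₁ (t (j + 1)) - χ₁ (t j)|) := Finset.sum_le_sum fun j _ => by
          refine le_trans (le_of_eq ?_) (abs_sub _ _)
          congr 1; ring
      _ ≤ 2 := by rw [Finset.sum_add_distrib]; linarith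
  have h0 : ‖(χ₂ 0 - χ₁ 0) • r 0‖ ^ 2 ≤ ‖r 0‖ ^ 2 := by
    rw [norm_smul]
    refine pow_le_pow_left₀ (by positivity) ?_ 2
    exact mul_le_of_le_one_left (norm_nonneg _) (hd 0)
  have hj : ∀ j, ‖(χ₂ (t (j + 1)) - χ₁ (t (j + 1))) • r (t (j + 1))
      - (χ₂ (t j) - χ₁ (t j)) • r (t j)‖ ^ 2 ≤
      2 * (2 * (2 * R) ^ 2 * |(χ₂ (t (j + 1)) - χ₁ (t (j + 1))) - (χ₂ (t j) - χ₁ (t j))|)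
        + 2 * ‖r (t (j + 1)) - r (t j)‖ ^ 2 := fun j => by
    set p := χ₂ (t (j + 1)) - χ₁ (t (j + 1))
    set p' := χ₂ (t j) - χ₁ (t j)
    have hp : |p - p'| ≤ 2 := (abs_sub _ _).trans (by linarith [hd (t (j + 1)), hd (t j)])
    have e : p • r (t (j + 1)) - p' • r (t j) =
        (p - p') • r (t (j + 1)) + p' • (r (t (j + 1)) - r (t j)) := by
      simp only [sub_smul, smul_sub]; abel
    have n1 : ‖(p - p') • r (t (j + 1))‖ ^ 2 ≤ 2 * (2 * R) ^ 2 * |p - p'| := by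
      rw [norm_smul, mul_pow, Real.norm_eq_abs]
      have := pow_le_pow_left₀ (norm_nonneg _) (hr.norm_le (ht' (j + 1))) 2
      calc |p - p'| ^ 2 * ‖r (t (j + 1))‖ ^ 2 ≤ (2 * |p - p'|) * (2 * R) ^ 2 := by
            gcongr; nlinarith [abs_nonneg (p - p')]
        _ = _ := by ring
    have n2 : ‖p' • (r (t (j + 1)) - r (t j))‖ ^ 2 ≤ ‖r (t (j + 1)) - r (t j)‖ ^ 2 := by
      rw [norm_smul]
      refine pow_le_pow_left₀ (by positivity) ?_ 2
      exact mul_le_of_le_one_left (norm_nonneg _) (hd _)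
    have n3 := norm_add_le ((p - p') • r (t (j + 1))) (p' • (r (t (j + 1)) - r (t j)))
    rw [← e] at n3
    nlinarith [norm_nonneg (p • r (t (j + 1)) - p' • r (t j)),
      sq_nonneg (‖(p - p') • r (t (j + 1))‖ - ‖p' • (r (t (j + 1)) - r (t j))‖),
      norm_nonneg ((p - p') • r (t (j + 1))), norm_nonneg (p' • (r (t (j + 1)) - r (t j)))]
  have hs := Finset.sum_le_sum fun j (_ : j ∈ Finset.range n) => hj j
  rw [Finset.sum_add_distrib, ← Finset.mul_sum, ← Finset.mul_sum, ← Finset.mul_sum] at hs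
  have := hr.sq_le (n := n) ht ht'
  have h2 : 2 * (2 * (2 * R) ^ 2 * ∑ j ∈ Finset.range n,
      |(χ₂ (t (j + 1)) - χ₁ (t (j + 1))) - (χ₂ (t j) - χ₁ (t j))|) ≤
      2 * (2 * (2 * R) ^ 2 * 2) := by gcongr
  nlinarith [sq_nonneg ‖r 0‖]

/-- The `ℓ²` norm of the increments is at most their `ℓ¹` norm. The clock `ρ` allows a path to be
frozen outside a short interval, so that only the length `ℓ` of that interval enters. -/
theorem V2Le.of_lipschitz {r : ℝ → X} {ρ : ℝ → ℝ} (hρ : Monotone ρ) {ℓ L R : ℝ} (hL : 0 ≤ L)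
    (hℓ : ∀ s s', ρ s' - ρ s ≤ ℓ) (h0 : ‖r 0‖ ≤ R)
    (hr : ∀ s ∈ Icc (0 : ℝ) 1, ∀ s' ∈ Icc (0 : ℝ) 1, ‖r s' - r s‖ ≤ L * |ρ s' - ρ s|) :
    V2Le r (R + L * ℓ) := by
  have hℓ0 : 0 ≤ ℓ := by simpa using hℓ 0 0
  have hR : 0 ≤ R := (norm_nonneg _).trans h0
  refine V2Le.of_sq (by positivity) fun n t ht ht' => ?_
  have h1 : ∑ j ∈ Finset.range n, ‖r (t (j + 1)) - r (t j)‖ ^ 2 ≤ (L * ℓ) ^ 2 := by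
    refine (Finset.sum_sq_le_sq_sum_of_nonneg fun j _ => norm_nonneg _).trans ?_
    refine pow_le_pow_left₀ (Finset.sum_nonneg fun j _ => norm_nonneg _) ?_ 2
    calc _ ≤ ∑ j ∈ Finset.range n, L * (ρ (t (j + 1)) - ρ (t j)) :=
          Finset.sum_le_sum fun j _ => by
            have := hr _ (ht' j) _ (ht' (j + 1))
            rwa [abs_of_nonneg (sub_nonneg.2 (hρ (ht j.le_succ)))] at this
      _ ≤ L * ℓ := by
          rw [← Finset.mul_sum, Finset.sum_range_sub (fun j => ρ (t j))]
          exact mul_le_mul_of_nonneg_left (hℓ _ _) hL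
  nlinarith [pow_le_pow_left₀ (norm_nonneg _) h0 2, mul_nonneg hR (mul_nonneg hL hℓ0)]

/-- Synthesis with an almost orthogonal Lipschitz family of operators. -/
theorem V2Le.synthesis {ι : Type*} (J : Finset ι) {M : ι → ℝ → X →L[ℂ] X} {a : ℝ} (ha : 0 ≤ a)
    (h1 : ∀ s ∈ Icc (0 : ℝ) 1, ∀ w : ι → X,
      ‖∑ j ∈ J, M j s (w j)‖ ^ 2 ≤ a ^ 2 * ∑ j ∈ J, ‖w j‖ ^ 2)
    (h2 : ∀ s ∈ Icc (0 : ℝ) 1, ∀ s' ∈ Icc (0 : ℝ) 1, ∀ w : ι → X,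
      ‖∑ j ∈ J, (M j s' - M j s) (w j)‖ ^ 2 ≤ (a * |s' - s|) ^ 2 * ∑ j ∈ J, ‖w j‖ ^ 2)
    {q : ι → ℝ → X} {k : ι → ℝ} {R : ℝ} (hq : ∀ j ∈ J, V2Le (q j) (k j)) (hR : 0 ≤ R)
    (hk : ∑ j ∈ J, k j ^ 2 ≤ R ^ 2) :
    V2Le (fun s => ∑ j ∈ J, M j s (q j s)) (4 * a * R) := by
  refine V2Le.of_sq (by positivity) fun n t ht ht' => ?_
  have hl : ∀ l, ‖∑ j ∈ J, M j (t (l + 1)) (q j (t (l + 1))) - ∑ j ∈ J, M j (t l) (q j (t l))‖ ^ 2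
      ≤ 2 * (a ^ 2 * ∑ j ∈ J, ‖q j (t (l + 1)) - q j (t l)‖ ^ 2)
        + 2 * (a ^ 2 * (t (l + 1) - t l) * (4 * R ^ 2)) := fun l => by
    have e : ∑ j ∈ J, M j (t (l + 1)) (q j (t (l + 1))) - ∑ j ∈ J, M j (t l) (q j (t l)) =
        ∑ j ∈ J, M j (t (l + 1)) (q j (t (l + 1)) - q j (t l))
          + ∑ j ∈ J, (M j (t (l + 1)) - M j (t l)) (q j (t l)) := by
      rw [← Finset.sum_sub_distrib, ← Finset.sum_add_distrib]
      refine Finset.sum_congr rfl fun j _ => ?_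
      simp
    have n1 := h1 _ (ht' (l + 1)) fun j => q j (t (l + 1)) - q j (t l)
    have n2 := h2 _ (ht' l) _ (ht' (l + 1)) fun j => q j (t l)
    -- One factor `t (l + 1) - t l` is replaced by 1; the other telescopes over the partition.
    have n4 : (a * |t (l + 1) - t l|) ^ 2 * ∑ j ∈ J, ‖q j (t l)‖ ^ 2 ≤
        a ^ 2 * (t (l + 1) - t l) * (4 * R ^ 2) := by
      have hd : 0 ≤ t (l + 1) - t l := sub_nonneg.2 (ht l.le_succ)
      have hd1 : t (l + 1) - t l ≤ 1 := by linarith [(ht' (l + 1)).2, (ht' l).1]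
      rw [mul_pow, sq_abs]
      have : ∑ j ∈ J, ‖q j (t l)‖ ^ 2 ≤ 4 * R ^ 2 := by
        calc _ ≤ ∑ j ∈ J, 4 * k j ^ 2 := Finset.sum_le_sum fun j hj => by
              have := pow_le_pow_left₀ (norm_nonneg _) ((hq j hj).norm_le (ht' l)) 2
              linarith
          _ ≤ _ := by rw [← Finset.mul_sum]; linarith
      gcongr
      nlinarith
    rw [e]
    set x := ∑ j ∈ J, M j (t (l + 1)) (q j (t (l + 1)) - q j (t l))
    set y := ∑ j ∈ J, (M j (t (l + 1)) - M j (t l)) (q j (t l))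
    have n3 := norm_add_le x y
    nlinarith [norm_nonneg (x + y), sq_nonneg (‖x‖ - ‖y‖), norm_nonneg x, norm_nonneg y]
  have h0 := h1 0 (by simp) fun j => q j 0
  have hs := Finset.sum_le_sum fun l (_ : l ∈ Finset.range n) => hl l
  rw [Finset.sum_add_distrib, ← Finset.mul_sum, ← Finset.mul_sum, ← Finset.mul_sum,
    ← Finset.sum_mul, ← Finset.mul_sum, Finset.sum_range_sub] at hs
  have hq' : ∑ j ∈ J, ‖q j 0‖ ^ 2 + ∑ l ∈ Finset.range n, ∑ j ∈ J,
      ‖q j (t (l + 1)) - q j (t l)‖ ^ 2 ≤ R ^ 2 := by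
    rw [Finset.sum_comm, ← Finset.sum_add_distrib]
    exact (Finset.sum_le_sum fun j hj => (hq j hj).sq_le ht ht').trans hk
  have ht1 : a ^ 2 * (t n - t 0) * (4 * R ^ 2) ≤ a ^ 2 * 1 * (4 * R ^ 2) := by
    gcongr
    linarith [(ht' n).2, (ht' 0).1]
  have hq'' := mul_le_mul_of_nonneg_left hq' (sq_nonneg a)
  rw [mul_add] at hq''
  have : 0 ≤ a ^ 2 * ∑ j ∈ J, ‖q j 0‖ ^ 2 :=
    mul_nonneg (sq_nonneg a) (Finset.sum_nonneg fun j _ => sq_nonneg _)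
  have : 0 ≤ a ^ 2 * R ^ 2 := by positivity
  nlinarith

end FlatVariation

/-! ### Operator Lipschitz estimates from Fourier inversion and Duhamel's formula. -/

section Fourier
variable {X : Type*} [NormedAddCommGroup X] [InnerProductSpace ℂ X] [CompleteSpace X]

/-- The unitary group `e^{iηB}`. -/
noncomputable def expI (B : X →L[ℂ] X) (η : ℝ) : X →L[ℂ] X :=
  NormedSpace.exp (η • (Complex.I • B))

theorem hasDerivAt_expI (B : X →L[ℂ] X) (η : ℝ) :
    HasDerivAt (expI B) (expI B η * (Complex.I • B)) η :=
  hasDerivAt_exp_smul_const (𝕂 := ℝ) (Complex.I • B) η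

theorem expI_zero (B : X →L[ℂ] X) : expI B 0 = 1 := by
  simp [expI]

theorem commute_expI (B : X →L[ℂ] X) (η : ℝ) : Commute B (expI B η) := by
  let +nondep : NormedAlgebra ℚ (X →L[ℂ] X) := .restrictScalars ℚ ℂ _
  refine Commute.exp_right ?_
  exact ((Commute.refl B).smul_right _).smul_right _

theorem expI_mem_unitary {B : X →L[ℂ] X} (hB : IsSelfAdjoint B) (η : ℝ) :
    expI B η ∈ unitary (X →L[ℂ] X) := by
  let +nondep : NormedAlgebra ℚ (X →L[ℂ] X) := .restrictScalars ℚ ℂ _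
  refine NormedSpace.exp_mem_unitary_of_mem_skewAdjoint ?_
  rw [skewAdjoint.mem_iff, star_smul, star_smul, hB.star_eq]
  simp

theorem norm_expI_apply {B : X →L[ℂ] X} (hB : IsSelfAdjoint B) (η : ℝ) (x : X) :
    ‖expI B η x‖ = ‖x‖ :=
  ContinuousLinearMap.norm_map_of_mem_unitary (expI_mem_unitary hB η) x

theorem norm_apply_expI {B : X →L[ℂ] X} (hB : IsSelfAdjoint B) (η : ℝ) (x : X) :
    ‖B (expI B η x)‖ = ‖B x‖ := by
  have := DFunLike.congr_fun (commute_expI B η).eq x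
  simp only [mul_apply_eq_comp] at this
  rw [this, norm_expI_apply hB]

theorem norm_expI_le {B : X →L[ℂ] X} (hB : IsSelfAdjoint B) (η : ℝ) : ‖expI B η‖ ≤ 1 :=
  ContinuousLinearMap.opNorm_le_bound _ zero_le_one fun x => by
    rw [norm_expI_apply hB, one_mul]

/-- Duhamel's formula as an estimate. -/
theorem norm_expI_sub_apply_le {B₀ B₁ : X →L[ℂ] X} (h₁ : IsSelfAdjoint B₁) {x : X} {M : ℝ}
    (hM : ∀ η : ℝ, ‖(B₁ - B₀) (expI B₀ η x)‖ ≤ M) (ξ : ℝ) :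
    ‖(expI B₁ ξ - expI B₀ ξ) x‖ ≤ |ξ| * M := by
  have hd : ∀ η : ℝ, HasDerivAt (fun η => (expI B₁ (ξ - η) * expI B₀ η) x)
      (-(Complex.I • expI B₁ (ξ - η) ((B₁ - B₀) (expI B₀ η x)))) η := fun η => by
    have d1 : HasDerivAt (fun η => expI B₁ (ξ - η)) (-(expI B₁ (ξ - η) * (Complex.I • B₁))) η := by
      simpa using (hasDerivAt_expI B₁ (ξ - η)).comp_const_sub ξ η
    have d2 := hasDerivAt_expI B₀ η
    have d3 := ((ContinuousLinearMap.apply ℂ X x).restrictScalars ℝ).hasFDerivAt.comp_hasDerivAt η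
      (d1.mul d2)
    refine d3.congr_deriv ?_
    have hc := DFunLike.congr_fun (commute_expI B₀ η).eq x
    simp only [mul_apply_eq_comp] at hc
    simp [← hc, smul_sub]
    abel
  -- The Duhamel path from `e^{iξB₁}` to `e^{iξB₀}` is run over `θ ∈ [0,1]` with `η = θξ`, which
  -- treats both signs of `ξ` at once.
  have := norm_image_sub_le_of_norm_deriv_le_segment_01' (f := fun θ : ℝ =>
      (expI B₁ (ξ - θ * ξ) * expI B₀ (θ * ξ)) x) (C := |ξ| * M)
      (f' := fun θ => ξ • (-(Complex.I • expI B₁ (ξ - θ * ξ) ((B₁ - B₀) (expI B₀ (θ * ξ) x)))))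
      (fun θ _ => by
        have h := (hd (θ * ξ)).scomp θ ((hasDerivAt_id θ).mul_const ξ)
        exact h.hasDerivWithinAt.congr_deriv (by simp)) fun θ _ => by
        rw [norm_smul, norm_neg, norm_smul, Complex.norm_I, one_mul, norm_expI_apply h₁]
        exact mul_le_mul_of_nonneg_left (hM _) (abs_nonneg _)
  rw [← norm_neg]
  simpa [expI_zero] using this

theorem cfc_const_mul_exp {B : X →L[ℂ] X} (hB : IsSelfAdjoint B) (c : ℂ) (η : ℝ) :
    cfc (fun z : ℂ => c * Complex.exp ((η * Complex.I) * z)) B = c • expI B η := by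
  have hn : IsStarNormal B := hB.isStarNormal
  rw [cfc_const_mul c _ B (by fun_prop)]
  have := cfc_comp_const_mul ((η : ℂ) * Complex.I) Complex.exp B (by fun_prop) hn
  rw [this]
  have hn' : IsStarNormal (((η : ℂ) * Complex.I) • B) := by
    constructor
    simp only [star_smul, hB.star_eq]
    exact ((Commute.refl B).smul_left _).smul_right _
  rw [CFC.complex_exp_eq_normedSpace_exp hn']
  unfold expI
  rw [mul_smul]
  rfl

open scoped FourierTransform in
/-- Functional calculus in terms of the unitary group. -/
theorem cfc_eq_integral_expI {g : ℝ → ℝ} (hg : ContDiff ℝ ∞ g) (hc : HasCompactSupport g)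
    {B : X →L[ℂ] X} (hB : IsSelfAdjoint B) :
    cfc g B = ∫ ξ : ℝ, (𝓕 (fun η => (g η : ℂ)) ξ) • expI B (2 * Real.pi * ξ) := by
  have hn : IsStarNormal B := hB.isStarNormal
  have hc' : HasCompactSupport fun η => (g η : ℂ) := hc.comp_left Complex.ofReal_zero
  have hg' : ContDiff ℝ ∞ fun η => (g η : ℂ) := Complex.ofRealCLM.contDiff.comp hg
  set gs := hc'.toSchwartzMap hg' with hgs
  have hcoe : (gs : ℝ → ℂ) = fun η => (g η : ℂ) := rfl
  set G := 𝓕 (fun η => (g η : ℂ)) with hG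
  have hGs : G = (𝓕 gs : SchwartzMap ℝ ℂ) := by rw [hG, ← hcoe, SchwartzMap.fourier_coe]
  have hGc : Continuous G := by rw [hGs]; exact SchwartzMap.continuous _
  have hGi : Integrable G := by rw [hGs]; exact SchwartzMap.integrable _
  have hinv : ∀ η : ℝ, (g η : ℂ) =
      ∫ ξ : ℝ, G ξ * Complex.exp (((2 * Real.pi * ξ : ℝ) * Complex.I) * (η : ℂ)) := fun η => by
    have h1 := congrFun (Continuous.fourierInv_fourier_eq hg'.continuous gs.integrable hGi) η
    rw [← h1, Real.fourierInv_eq']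
    refine integral_congr_ae (.of_forall fun ξ => ?_)
    simp only [smul_eq_mul]
    rw [mul_comm]
    congr 2
    simp
    ring
  rw [cfc_real_eq_complex g hB]
  simp only [← cfc_const_mul_exp hB]
  -- The spectrum is real, so the exponentials have modulus one there and `‖G ξ‖` is an integrable
  -- majorant for exchanging the functional calculus with the integral.
  rw [← cfc_integral (fun ξ z => G ξ * Complex.exp (((2 * Real.pi * ξ : ℝ) * Complex.I) * z))
    (fun ξ => ‖G ξ‖) B (by fun_prop) (.of_forall fun ξ z hz => ?_) hGi.norm.2]
  · refine cfc_congr fun z hz => ?_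
    have hz' := hB.mem_spectrum_eq_re hz
    change ((g z.re : ℝ) : ℂ) = _
    rw [hinv]
    simp only [← hz']
  · have hz' := hB.mem_spectrum_eq_re hz
    rw [norm_mul, hz', mul_right_comm, ← Complex.ofReal_mul, Complex.norm_exp_ofReal_mul_I,
      mul_one]

theorem tsupport_subset_Icc_of_ne_zero {g : ℝ → ℝ} {r : ℝ} (hs : ∀ η, g η ≠ 0 → |η| ≤ r) :
    tsupport g ⊆ Icc (-r) r :=
  closure_minimal (fun η hη => abs_le.1 (hs η hη)) isClosed_Icc

theorem hasCompactSupport_of_ne_zero {g : ℝ → ℝ} {r : ℝ} (hs : ∀ η, g η ≠ 0 → |η| ≤ r) :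
    HasCompactSupport g :=
  isCompact_Icc.of_isClosed_subset (isClosed_tsupport g) (tsupport_subset_Icc_of_ne_zero hs)

theorem iteratedDeriv_ofReal_comp {g : ℝ → ℝ} (hg : ContDiff ℝ ∞ g) (n : ℕ) :
    iteratedDeriv n (fun η => (g η : ℂ)) = fun η => ((iteratedDeriv n g η : ℝ) : ℂ) := by
  induction n with
  | zero => simp
  | succ n ih =>
    rw [iteratedDeriv_succ, ih]
    ext η
    rw [iteratedDeriv_succ]
    have hd : DifferentiableAt ℝ (iteratedDeriv n g) η :=
      hg.differentiable_iteratedDeriv n (by exact_mod_cast WithTop.coe_lt_top _) η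
    exact hd.hasDerivAt.ofReal_comp.deriv

theorem support_iteratedDeriv_subset (g : ℝ → ℝ) (m : ℕ) :
    Function.support (iteratedDeriv m g) ⊆ tsupport g := by
  intro η hη
  by_contra h
  rw [notMem_tsupport_iff_eventuallyEq] at h
  exact hη ((h.iteratedDeriv_eq m).trans (by simp))

open scoped FourierTransform in
theorem integrable_fourier_ofReal {g : ℝ → ℝ} (hg : ContDiff ℝ ∞ g) (hc : HasCompactSupport g) :
    Integrable (𝓕 fun η => (g η : ℂ)) := by
  have hc' : HasCompactSupport fun η => (g η : ℂ) := hc.comp_left Complex.ofReal_zero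
  have hg' : ContDiff ℝ ∞ fun η => (g η : ℂ) := Complex.ofRealCLM.contDiff.comp hg
  have h : (𝓕 fun η => (g η : ℂ)) = (𝓕 (hc'.toSchwartzMap hg') : SchwartzMap ℝ ℂ) := by
    rw [SchwartzMap.fourier_coe]; rfl
  rw [h]
  exact SchwartzMap.integrable _

theorem continuous_expI (B : X →L[ℂ] X) : Continuous (expI B) :=
  continuous_iff_continuousAt.2 fun η => (hasDerivAt_expI B η).continuousAt

open scoped FourierTransform in
theorem integrable_fourier_smul_expI {g : ℝ → ℝ} (hg : ContDiff ℝ ∞ g) (hc : HasCompactSupport g)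
    {B : X →L[ℂ] X} (hB : IsSelfAdjoint B) :
    Integrable fun ξ : ℝ => (𝓕 (fun η => (g η : ℂ)) ξ) • expI B (2 * Real.pi * ξ) := by
  refine (integrable_fourier_ofReal hg hc).smul_bdd 1 ?_ (.of_forall fun ξ => norm_expI_le hB _)
  exact ((continuous_expI B).comp (by fun_prop)).aestronglyMeasurable

-- The left side is the norm of the Fourier transform of the `n`-th derivative, which is bounded by
-- `a` and lives on `[-4,4]`, an interval of length 8.
open scoped FourierTransform in
theorem norm_fourier_pow_mul_le {g : ℝ → ℝ} (hg : ContDiff ℝ ∞ g)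
    (hs : ∀ η, g η ≠ 0 → |η| ≤ 4) {a : ℝ} {n : ℕ} (ha : ∀ η, |iteratedDeriv n g η| ≤ a) (ξ : ℝ) :
    |2 * Real.pi * ξ| ^ n * ‖𝓕 (fun η => (g η : ℂ)) ξ‖ ≤ 8 * a := by
  have hc : HasCompactSupport g := hasCompactSupport_of_ne_zero hs
  have hts := tsupport_subset_Icc_of_ne_zero hs
  have hg' : ContDiff ℝ ∞ fun η => (g η : ℂ) := Complex.ofRealCLM.contDiff.comp hg
  have hsup : ∀ m, Function.support (iteratedDeriv m g) ⊆ tsupport g := fun m =>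
    support_iteratedDeriv_subset g m
  have hint : ∀ m : ℕ, Integrable (iteratedDeriv m fun η => (g η : ℂ)) := fun m => by
    rw [iteratedDeriv_ofReal_comp hg]
    refine Integrable.ofReal ?_
    refine Continuous.integrable_of_hasCompactSupport
      (hg.continuous_iteratedDeriv m (by exact_mod_cast le_top)) ?_
    exact hc.of_isClosed_subset (isClosed_tsupport _) (closure_minimal (hsup m) (isClosed_tsupport _))
  have key := congrFun (Real.fourier_iteratedDeriv (N := ⊤) (n := n) hg' (fun m _ => hint m) le_top) ξ
  have e1 : |2 * Real.pi * ξ| ^ n * ‖𝓕 (fun η => (g η : ℂ)) ξ‖ =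
      ‖𝓕 (iteratedDeriv n fun η => (g η : ℂ)) ξ‖ := by
    rw [key, norm_smul, norm_pow]
    congr 2
    simp [abs_mul]
  rw [e1, Real.fourier_eq']
  have hres : ∫ v : ℝ, Complex.exp (↑(-2 * Real.pi * inner ℝ v ξ) * Complex.I)
      • iteratedDeriv n (fun η => (g η : ℂ)) v = ∫ v in Icc (-4 : ℝ) 4,
      Complex.exp (↑(-2 * Real.pi * inner ℝ v ξ) * Complex.I)
      • iteratedDeriv n (fun η => (g η : ℂ)) v := by
    refine (setIntegral_eq_integral_of_forall_compl_eq_zero fun v hv => ?_).symm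
    rw [iteratedDeriv_ofReal_comp hg]
    have : iteratedDeriv n g v = 0 := by
      by_contra h
      exact hv (hts (hsup n h))
    simp [this]
  rw [hres]
  refine (norm_setIntegral_le_of_norm_le_const (C := a) (by simp) fun v _ => ?_).trans
    (le_of_eq ?_)
  · rw [norm_smul, Complex.norm_exp_ofReal_mul_I, one_mul, iteratedDeriv_ofReal_comp hg]
    simpa using ha v
  · rw [Real.volume_real_Icc_of_le (by norm_num)]; ring

-- Adding the decay bounds of orders 1 and 3 gives the integrable weight `(1 + ξ²)⁻¹`. The factor
-- `|2πξ|` is the one that Duhamel's formula loses; because of it no bound on `g` itself is needed.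
open scoped FourierTransform in
theorem norm_fourier_mul_le {g : ℝ → ℝ} (hg : ContDiff ℝ ∞ g)
    (hs : ∀ η, g η ≠ 0 → |η| ≤ 4) {a : ℝ} (h1 : ∀ η, |iteratedDeriv 1 g η| ≤ a)
    (h3 : ∀ η, |iteratedDeriv 3 g η| ≤ a) (ξ : ℝ) :
    ‖𝓕 (fun η => (g η : ℂ)) ξ‖ * |2 * Real.pi * ξ| ≤ 16 * a * (1 + ξ ^ 2)⁻¹ := by
  have e1 := norm_fourier_pow_mul_le hg hs h1 ξ
  have e3 := norm_fourier_pow_mul_le hg hs h3 ξ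
  rw [← div_eq_mul_inv, le_div_iff₀ (by positivity)]
  have hx : ξ ^ 2 ≤ |2 * Real.pi * ξ| ^ 2 := by
    rw [sq_abs, mul_pow]
    have : 1 ≤ (2 * Real.pi) ^ 2 := by nlinarith [Real.pi_gt_three]
    nlinarith [sq_nonneg ξ]
  set F := ‖𝓕 (fun η => (g η : ℂ)) ξ‖
  have hF : 0 ≤ F * |2 * Real.pi * ξ| := by positivity
  nlinarith [mul_le_mul_of_nonneg_left hx hF]

/-- Operator Lipschitz estimate along the unitary group. -/
theorem norm_cfc_sub_apply_le_of_expI {g : ℝ → ℝ} (hg : ContDiff ℝ ∞ g)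
    (hs : ∀ η, g η ≠ 0 → |η| ≤ 4) {a : ℝ} (h1 : ∀ η, |iteratedDeriv 1 g η| ≤ a)
    (h3 : ∀ η, |iteratedDeriv 3 g η| ≤ a) {B₀ B₁ : X →L[ℂ] X} (hB₀ : IsSelfAdjoint B₀)
    (hB₁ : IsSelfAdjoint B₁) {x : X} {M : ℝ} (hM : ∀ η : ℝ, ‖(B₁ - B₀) (expI B₀ η x)‖ ≤ M) :
    ‖(cfc g B₁ - cfc g B₀) x‖ ≤ 64 * a * M := by
  have hc := hasCompactSupport_of_ne_zero hs
  have hM0 : 0 ≤ M := (norm_nonneg _).trans (hM 0)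
  have ha : 0 ≤ a := (abs_nonneg _).trans (h1 0)
  have i0 := integrable_fourier_smul_expI hg hc hB₀
  have i1 := integrable_fourier_smul_expI hg hc hB₁
  rw [cfc_eq_integral_expI hg hc hB₀, cfc_eq_integral_expI hg hc hB₁, ← integral_sub i1 i0]
  have happ := ContinuousLinearMap.integral_apply (i1.sub i0) x
  simp only [Pi.sub_apply] at happ
  rw [happ]
  have hdom : Integrable fun ξ : ℝ => 16 * a * M * (1 + ξ ^ 2)⁻¹ :=
    integrable_inv_one_add_sq.const_mul _
  refine (norm_integral_le_of_norm_le hdom (.of_forall fun ξ => ?_)).trans ?_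
  · rw [← smul_sub, smul_apply, norm_smul]
    have e1 := norm_expI_sub_apply_le hB₁ hM (2 * Real.pi * ξ)
    have e2 := norm_fourier_mul_le hg hs h1 h3 ξ
    calc _ ≤ _ := mul_le_mul_of_nonneg_left e1 (norm_nonneg _)
      _ ≤ 16 * a * (1 + ξ ^ 2)⁻¹ * M := by
        rw [← mul_assoc]
        exact mul_le_mul_of_nonneg_right e2 hM0
      _ = _ := by ring
  -- The integral equals `π < 4`, whence `64 = 16 · 4`.
  · rw [integral_const_mul, integral_univ_inv_one_add_sq]
    nlinarith [Real.pi_lt_four, mul_nonneg ha hM0]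

/-- Operator Lipschitz estimate for a perturbation that is bounded relative to `B₀`; the function
`μ` is smooth on the scale `l` of its support. -/
theorem norm_cfc_sub_apply_le {μ : ℝ → ℝ} (hμ : ContDiff ℝ ∞ μ) {l : ℝ} (hl : 0 < l)
    (hs : ∀ ξ, μ ξ ≠ 0 → |ξ| ≤ 4 * l) {a : ℝ} (h1 : ∀ ξ, l * |iteratedDeriv 1 μ ξ| ≤ a)
    (h3 : ∀ ξ, l ^ 3 * |iteratedDeriv 3 μ ξ| ≤ a) {B₀ B₁ : X →L[ℂ] X} (hB₀ : IsSelfAdjoint B₀)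
    (hB₁ : IsSelfAdjoint B₁) {δ : ℝ} (hδ : ∀ x, ‖(B₁ - B₀) x‖ ≤ δ * (‖B₀ x‖ + ‖x‖)) (x : X) :
    ‖(cfc μ B₁ - cfc μ B₀) x‖ ≤ 64 * a * (l⁻¹ * (δ * (‖B₀ x‖ + ‖x‖))) := by
  -- Rescaling `B` by `l⁻¹` reduces to scale one; the perturbation picks up the gain `l⁻¹`.
  set g : ℝ → ℝ := fun η => μ (l * η) with hgdef
  have hg : ContDiff ℝ ∞ g := hμ.comp (by fun_prop)
  have hd : ∀ n : ℕ, ∀ η, iteratedDeriv n g η = l ^ n * iteratedDeriv n μ (l * η) := fun n η => by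
    rw [hgdef, iteratedDeriv_comp_const_mul (hμ.of_le (by exact_mod_cast le_top))]
  have hcfc : ∀ B : X →L[ℂ] X, IsSelfAdjoint B → cfc μ B = cfc g (l⁻¹ • B) := fun B hB => by
    rw [← cfc_comp_smul l⁻¹ g B hg.continuous.continuousOn hB]
    congr 1
    ext η
    simp [hgdef, hl.ne']
  have hsa : ∀ B : X →L[ℂ] X, IsSelfAdjoint B → IsSelfAdjoint (l⁻¹ • B) := fun B hB =>
    IsSelfAdjoint.smul (IsSelfAdjoint.all _) hB
  rw [hcfc B₀ hB₀, hcfc B₁ hB₁]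
  refine norm_cfc_sub_apply_le_of_expI hg (fun η hη => ?_) (fun η => ?_) (fun η => ?_) (hsa _ hB₀)
    (hsa _ hB₁) fun η => ?_
  · have := hs _ hη
    rw [abs_mul, abs_of_pos hl] at this
    nlinarith
  · rw [hd, abs_mul, abs_of_pos (by positivity)]; simpa using h1 (l * η)
  · rw [hd, abs_mul, abs_of_pos (by positivity)]; exact h3 (l * η)
  -- The unitary group of `l⁻¹B₀` is isometric and commutes with `B₀`, so it preserves both `‖B₀ x‖`
  -- and `‖x‖`. A bound relative to `B₀` therefore holds uniformly along the orbit of `x`.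
  · rw [← smul_sub, smul_apply, norm_smul, Real.norm_eq_abs,
      abs_of_pos (inv_pos.2 hl)]
    refine mul_le_mul_of_nonneg_left ?_ (inv_pos.2 hl).le
    refine (hδ _).trans (le_of_eq ?_)
    have e1 := norm_expI_apply (hsa _ hB₀) η x
    have e2 := norm_apply_expI (hsa _ hB₀) η x
    simp only [smul_apply, norm_smul] at e2
    rw [e1, mul_left_cancel₀ (by simpa using hl.ne') e2]

-- Up to a phase this is the Fourier transform of the derivative, which is again smooth with compact
-- support.
open scoped FourierTransform in
theorem integrable_mul_fourier_ofReal {g : ℝ → ℝ} (hg : ContDiff ℝ ∞ g)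
    (hc : HasCompactSupport g) :
    Integrable fun ξ : ℝ => |2 * Real.pi * ξ| * ‖𝓕 (fun η => (g η : ℂ)) ξ‖ := by
  have hc' : HasCompactSupport fun η => (g η : ℂ) := hc.comp_left Complex.ofReal_zero
  have hg' : ContDiff ℝ ∞ fun η => (g η : ℂ) := Complex.ofRealCLM.contDiff.comp hg
  have hd : deriv (fun η => (g η : ℂ)) = fun η => ((deriv g η : ℝ) : ℂ) := by
    simpa [iteratedDeriv_one] using iteratedDeriv_ofReal_comp hg 1
  have hgd : ContDiff ℝ ∞ (deriv g) := by
    have := hg.iterate_deriv 1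
    simpa using this
  have i1 := (integrable_fourier_ofReal hgd hc.deriv).norm
  have hi : Integrable (deriv fun η => (g η : ℂ)) :=
    (hg'.continuous_deriv (by exact_mod_cast le_top)).integrable_of_hasCompactSupport hc'.deriv
  have hft := Real.fourier_deriv (hg'.continuous.integrable_of_hasCompactSupport hc')
    (hg'.differentiable (by simp)) hi
  rw [← hd, hft] at i1
  refine i1.congr (.of_forall fun ξ => ?_)
  simp [abs_mul]

theorem contDiff_exp_clm : ContDiff ℝ ∞ (NormedSpace.exp : (X →L[ℂ] X) → X →L[ℂ] X) :=
  (AnalyticOnNhd.contDiff (fun x _ => NormedSpace.exp_analytic (𝕂 := ℝ) x))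

-- Differentiation under the integral in the Fourier representation. This is only qualitative: it
-- makes `∂_t c_j(b(t))` meaningful, while the uniform bounds come from difference quotients in
-- `HalfPartition.sum_norm_deriv_cfc_sq_le`.
open scoped FourierTransform in
theorem differentiableAt_cfc {g : ℝ → ℝ} (hg : ContDiff ℝ ∞ g) (hc : HasCompactSupport g)
    {b : ℝ → X →L[ℂ] X} (hb : ∀ t, IsSelfAdjoint (b t)) {t₀ L : ℝ} (hL0 : 0 ≤ L)
    (hd : DifferentiableAt ℝ b t₀)
    (hL : ∀ t ∈ Metric.ball t₀ 1, ∀ t' ∈ Metric.ball t₀ 1, ‖b t - b t'‖ ≤ L * |t - t'|) :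
    DifferentiableAt ℝ (fun t => cfc g (b t)) t₀ := by
  have e : (fun t => cfc g (b t)) = fun t => ∫ ξ : ℝ, (𝓕 (fun η => (g η : ℂ)) ξ)
      • expI (b t) (2 * Real.pi * ξ) := funext fun t => cfc_eq_integral_expI hg hc (hb t)
  rw [e]
  set G := 𝓕 (fun η => (g η : ℂ)) with hG
  have hexp : ∀ ξ : ℝ, HasDerivAt (fun t => expI (b t) (2 * Real.pi * ξ))
      (fderiv ℝ (NormedSpace.exp : (X →L[ℂ] X) → X →L[ℂ] X)
        ((2 * Real.pi * ξ) • (Complex.I • b t₀))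
        ((2 * Real.pi * ξ) • (Complex.I • deriv b t₀))) t₀ := fun ξ => by
    have h1 : HasDerivAt (fun t => (2 * Real.pi * ξ) • (Complex.I • b t))
        ((2 * Real.pi * ξ) • (Complex.I • deriv b t₀)) t₀ :=
      (hd.hasDerivAt.const_smul Complex.I).const_smul (2 * Real.pi * ξ)
    have h2 := ((contDiff_exp_clm (X := X)).differentiable (by simp)
      ((2 * Real.pi * ξ) • (Complex.I • b t₀))).hasFDerivAt
    exact h2.comp_hasDerivAt t₀ h1
  have hmeas : AEStronglyMeasurable (fun ξ : ℝ => G ξ •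
      (fderiv ℝ (NormedSpace.exp : (X →L[ℂ] X) → X →L[ℂ] X)
        ((2 * Real.pi * ξ) • (Complex.I • b t₀))
        ((2 * Real.pi * ξ) • (Complex.I • deriv b t₀)))) volume := by
    refine (integrable_fourier_ofReal hg hc).1.smul (Continuous.aestronglyMeasurable ?_)
    have := (contDiff_exp_clm (X := X)).continuous_fderiv (by simp)
    exact (this.comp (by fun_prop)).clm_apply (by fun_prop)
  refine (hasDerivAt_integral_of_dominated_loc_of_lip
    (bound := fun ξ => L * (|2 * Real.pi * ξ| * ‖G ξ‖)) (Metric.ball_mem_nhds t₀ one_pos)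
    (.of_forall fun t => (integrable_fourier_smul_expI hg hc (hb t)).1)
    (integrable_fourier_smul_expI hg hc (hb t₀)) hmeas (.of_forall fun ξ => ?_)
    ((integrable_mul_fourier_ofReal hg hc).const_mul L)
    (.of_forall fun ξ => (hexp ξ).const_smul (G ξ))).2.differentiableAt
  -- Duhamel's estimate bounds the variation of the integrand by `L |2πξ| ‖G ξ‖`, which is
  -- integrable.
  refine LipschitzOnWith.of_dist_le_mul fun t ht t' ht' => ?_
  rw [dist_eq_norm, ← smul_sub, norm_smul, Real.coe_nnabs,
    abs_of_nonneg (mul_nonneg hL0 (by positivity)), Real.dist_eq]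
  have : ‖expI (b t) (2 * Real.pi * ξ) - expI (b t') (2 * Real.pi * ξ)‖ ≤
      |2 * Real.pi * ξ| * (L * |t - t'|) := by
    refine ContinuousLinearMap.opNorm_le_bound _ (by positivity) fun x => ?_
    refine (norm_expI_sub_apply_le (B₀ := b t') (M := L * |t - t'| * ‖x‖) (hb t)
      (fun η => ?_) _).trans (le_of_eq (mul_assoc _ _ _).symm)
    refine (ContinuousLinearMap.le_opNorm _ _).trans ?_
    rw [norm_expI_apply (hb t')]
    exact mul_le_mul_of_nonneg_right (hL t ht t' ht') (norm_nonneg _)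
  calc _ ≤ ‖G ξ‖ * (|2 * Real.pi * ξ| * (L * |t - t'|)) :=
        mul_le_mul_of_nonneg_left this (norm_nonneg _)
    _ = _ := by ring

end Fourier

/-! ### Square functions and almost orthogonality for the functional calculus. -/

section SquareFunction
variable {X : Type*} [NormedAddCommGroup X] [InnerProductSpace ℂ X] [CompleteSpace X]

theorem isSelfAdjoint_cfc (f : ℝ → ℝ) (B : X →L[ℂ] X) : IsSelfAdjoint (cfc f B) :=
  cfc_predicate f B

theorem IsSelfAdjoint.inner_apply_apply {T : X →L[ℂ] X} (hT : IsSelfAdjoint T) (x y : X) :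
    inner ℂ (T x) y = inner ℂ x (T y) := by
  conv_lhs => rw [← hT.star_eq]
  rw [ContinuousLinearMap.star_eq_adjoint, ContinuousLinearMap.adjoint_inner_left]

theorem inner_cfc_sq {f : ℝ → ℝ} (hf : Continuous f) (B : X →L[ℂ] X) (x : X) :
    RCLike.re (inner ℂ x (cfc (fun ξ => f ξ ^ 2) B x)) = ‖cfc f B x‖ ^ 2 := by
  have : cfc (fun ξ => f ξ ^ 2) B = cfc f B * cfc f B := by
    simp only [sq]
    exact cfc_mul f f B hf.continuousOn hf.continuousOn
  rw [this, mul_apply_eq_comp, ← (isSelfAdjoint_cfc f B).inner_apply_apply, inner_self_eq_norm_sq]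

/-- The function `g² - ∑ f_j²` is the square of a continuous `h`, so the difference of the two sides
is `‖h(B)x‖²`. -/
theorem sum_norm_cfc_sq_le {ι : Type*} (J : Finset ι) {f : ι → ℝ → ℝ} {g : ℝ → ℝ}
    (hf : ∀ j ∈ J, Continuous (f j)) (hg : Continuous g) (h : ∀ ξ, ∑ j ∈ J, f j ξ ^ 2 ≤ g ξ ^ 2)
    (B : X →L[ℂ] X) (x : X) :
    ∑ j ∈ J, ‖cfc (f j) B x‖ ^ 2 ≤ ‖cfc g B x‖ ^ 2 := by
  have hsum : Continuous fun ξ => ∑ j ∈ J, f j ξ ^ 2 :=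
    continuous_finsetSum _ fun j hj => (hf j hj).pow 2
  have hcont : Continuous fun ξ => √(g ξ ^ 2 - ∑ j ∈ J, f j ξ ^ 2) := by
    exact ((hg.pow 2).sub hsum).sqrt
  have key := inner_cfc_sq hcont B x
  have e1 : cfc (fun ξ => √(g ξ ^ 2 - ∑ j ∈ J, f j ξ ^ 2) ^ 2) B =
      cfc (fun ξ => g ξ ^ 2) B - ∑ j ∈ J, cfc (fun ξ => f j ξ ^ 2) B := by
    rw [← cfc_sum (fun j ξ => f j ξ ^ 2) B J fun j hj => ((hf j hj).pow 2).continuousOn]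
    have hs' : ContinuousOn (∑ j ∈ J, fun ξ => f j ξ ^ 2) (spectrum ℝ B) := by
      have : (∑ j ∈ J, fun ξ => f j ξ ^ 2) = fun ξ => ∑ j ∈ J, f j ξ ^ 2 := by
        ext ξ; simp
      rw [this]; exact hsum.continuousOn
    rw [← cfc_sub (fun ξ => g ξ ^ 2) _ B (hg.pow 2).continuousOn hs']
    refine cfc_congr fun ξ _ => ?_
    rw [Finset.sum_apply]
    exact Real.sq_sqrt (sub_nonneg.2 (h ξ))
  rw [e1] at key
  simp only [sub_apply, sum_apply, inner_sub_right, inner_sum, map_sub,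
    map_sum] at key
  rw [inner_cfc_sq hg, Finset.sum_congr rfl fun j hj => inner_cfc_sq (hf j hj) B x] at key
  nlinarith [sq_nonneg ‖cfc (fun ξ => √(g ξ ^ 2 - ∑ j ∈ J, f j ξ ^ 2)) B x‖]

theorem norm_cfc_apply_le_of_abs_le {f g : ℝ → ℝ} (hf : Continuous f) (hg : Continuous g)
    (h : ∀ ξ, |f ξ| ≤ |g ξ|) (B : X →L[ℂ] X) (x : X) :
    ‖cfc f B x‖ ≤ ‖cfc g B x‖ := by
  have := sum_norm_cfc_sq_le {()} (f := fun _ => f) (fun _ _ => hf) hg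
    (fun ξ => by simpa using sq_le_sq.2 (h ξ)) B x
  simp only [Finset.sum_singleton] at this
  exact (abs_le_of_sq_le_sq' this (norm_nonneg _)).2

theorem norm_cfc_apply_le_mul {f g : ℝ → ℝ} (hf : Continuous f) (hg : Continuous g) {c : ℝ}
    (hc : 0 ≤ c) (h : ∀ ξ, |f ξ| ≤ c * |g ξ|) (B : X →L[ℂ] X) (x : X) :
    ‖cfc f B x‖ ≤ c * ‖cfc g B x‖ := by
  have := norm_cfc_apply_le_of_abs_le hf (hg.const_mul c)
    (fun ξ => by rw [abs_mul, abs_of_nonneg hc]; exact h ξ) B x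
  rwa [cfc_const_mul c g B hg.continuousOn, smul_apply, norm_smul, Real.norm_of_nonneg hc] at this

theorem norm_cfc_apply_le {f : ℝ → ℝ} (hf : Continuous f) {c : ℝ}
    (hc : 0 ≤ c) (h : ∀ ξ, |f ξ| ≤ c) {B : X →L[ℂ] X} (hB : IsSelfAdjoint B) (x : X) :
    ‖cfc f B x‖ ≤ c * ‖x‖ := by
  have := norm_cfc_apply_le_mul hf continuous_const (g := fun _ => 1) hc (by simpa using h) B x
  rwa [cfc_const_one ℝ B, one_apply_eq_self] at this

/-- Duality between square functions and synthesis. -/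
theorem norm_sum_apply_sq_le {ι : Type*} (J : Finset ι) {T : ι → X →L[ℂ] X}
    (hT : ∀ j ∈ J, IsSelfAdjoint (T j)) {c : ℝ}
    (h : ∀ x, ∑ j ∈ J, ‖T j x‖ ^ 2 ≤ c ^ 2 * ‖x‖ ^ 2) (w : ι → X) :
    ‖∑ j ∈ J, T j (w j)‖ ^ 2 ≤ c ^ 2 * ∑ j ∈ J, ‖w j‖ ^ 2 := by
  set z := ∑ j ∈ J, T j (w j) with hz
  have h1 : ‖z‖ ^ 2 ≤ ∑ j ∈ J, ‖w j‖ * ‖T j z‖ := by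
    rw [← inner_self_eq_norm_sq (𝕜 := ℂ)]
    conv_lhs => enter [2, 2]; rw [hz]
    rw [sum_inner, map_sum]
    refine Finset.sum_le_sum fun j hj => ?_
    rw [(hT j hj).inner_apply_apply]
    exact re_inner_le_norm _ _
  have h2 := Finset.sum_mul_sq_le_sq_mul_sq J (fun j => ‖w j‖) fun j => ‖T j z‖
  have h3 : (‖z‖ ^ 2) ^ 2 ≤ (∑ j ∈ J, ‖w j‖ ^ 2) * (c ^ 2 * ‖z‖ ^ 2) :=
    (pow_le_pow_left₀ (sq_nonneg _) h1 2).trans (h2.trans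
      (mul_le_mul_of_nonneg_left (h z) (Finset.sum_nonneg fun j _ => sq_nonneg _)))
  -- The inequality `h3` has a factor `‖z‖²` on both sides, which can be cancelled only if it is
  -- positive.
  rcases (sq_nonneg ‖z‖).eq_or_lt with h0 | h0
  · rw [← h0]
    exact mul_nonneg (sq_nonneg _) (Finset.sum_nonneg fun j _ => sq_nonneg _)
  · nlinarith

theorem abs_le_norm_of_mem_spectrum {B : X →L[ℂ] X} {ξ : ℝ} (h : ξ ∈ spectrum ℝ B) :
    |ξ| ≤ ‖B‖ := by
  have h1 := spectrum.norm_le_norm_mul_of_mem h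
  have h2 : ‖(1 : X →L[ℂ] X)‖ ≤ 1 := ContinuousLinearMap.norm_id_le
  rw [Real.norm_eq_abs] at h1
  nlinarith [norm_nonneg B]

/-- Functions dominated by a dyadic partition and smooth on its scale, with constant `a`. -/
structure IsDyadicFamily (κ μ : ℕ → ℝ → ℝ) (a : ℝ) : Prop where
  smooth : ∀ j, ContDiff ℝ ∞ (μ j)
  abs_le : ∀ j ξ, |μ j ξ| ≤ a * |κ j ξ|
  deriv_one : ∀ j ξ, 2 ^ j * |iteratedDeriv 1 (μ j) ξ| ≤ a
  deriv_three : ∀ j ξ, (2 ^ j) ^ 3 * |iteratedDeriv 3 (μ j) ξ| ≤ a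

variable {κ μ : ℕ → ℝ → ℝ} {a : ℝ}

namespace IsDyadicPartition

theorem abs_le_one (hκ : IsDyadicPartition κ) (j : ℕ) (ξ : ℝ) : |κ j ξ| ≤ 1 := by
  have := (hκ.sum_sq ξ).summable.le_tsum j fun i _ => sq_nonneg _
  rw [(hκ.sum_sq ξ).tsum_eq] at this
  rwa [sq_le_one_iff_abs_le_one] at this

theorem sum_sq_le_one (hκ : IsDyadicPartition κ) (J : Finset ℕ) (ξ : ℝ) :
    ∑ j ∈ J, κ j ξ ^ 2 ≤ 1 :=
  sum_le_hasSum _ (fun _ _ => sq_nonneg _) (hκ.sum_sq ξ)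

theorem abs_le_of_ne_zero (hκ : IsDyadicPartition κ) {j : ℕ} {ξ : ℝ} (h : κ j ξ ≠ 0) :
    |ξ| ≤ 4 * 2 ^ j := by
  have := (hκ.support j ξ h).2
  rw [pow_add] at this
  linarith [le_max_left |ξ| 1]

theorem eq_zero_of_lt (hκ : IsDyadicPartition κ) {j : ℕ} {ξ : ℝ} (h : |ξ| < 2 ^ j) (hj : j ≠ 0) :
    κ j ξ = 0 := by
  by_contra hne
  have h1 := (hκ.support j ξ hne).1
  have h2 : (1 : ℝ) < 2 ^ j := one_lt_pow₀ (by norm_num) hj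
  exact absurd h1 (not_le.2 (max_lt h h2))

theorem sum_range_sq_eq_one (hκ : IsDyadicPartition κ) {N : ℕ} {ξ : ℝ} (h : |ξ| < 2 ^ N)
    (hN : N ≠ 0) : ∑ j ∈ Finset.range N, κ j ξ ^ 2 = 1 := by
  refine (hasSum_sum_of_ne_finset_zero fun j hj => ?_).unique (hκ.sum_sq ξ)
  have hj' : N ≤ j := by simpa using hj
  rw [hκ.eq_zero_of_lt (h.trans_le (pow_le_pow_right₀ (by norm_num) hj')) (by omega)]
  simp

end IsDyadicPartition

namespace IsDyadicFamily

theorem nonneg (hμ : IsDyadicFamily κ μ a) : 0 ≤ a :=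
  (by positivity : (0 : ℝ) ≤ 2 ^ 0 * |iteratedDeriv 1 (μ 0) 0|).trans (hμ.deriv_one 0 0)

theorem ne_zero (hμ : IsDyadicFamily κ μ a) {j : ℕ} {ξ : ℝ} (h : μ j ξ ≠ 0) : κ j ξ ≠ 0 := by
  intro h0
  have := hμ.abs_le j ξ
  rw [h0, abs_zero, mul_zero] at this
  exact h (abs_nonpos_iff.1 this)

theorem sum_norm_sq_le (hκ : IsDyadicPartition κ) (hμ : IsDyadicFamily κ μ a) (J : Finset ℕ)
    {B : X →L[ℂ] X} (hB : IsSelfAdjoint B) (x : X) :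
    ∑ j ∈ J, ‖cfc (μ j) B x‖ ^ 2 ≤ a ^ 2 * ‖x‖ ^ 2 := by
  have := sum_norm_cfc_sq_le J (f := μ) (g := fun _ => a) (fun j _ => (hμ.smooth j).continuous)
    continuous_const (fun ξ => ?_) B x
  · rw [cfc_const a B hB, Algebra.algebraMap_eq_smul_one, smul_apply, norm_smul, mul_pow,
      Real.norm_eq_abs, sq_abs] at this
    simpa using this
  · calc _ ≤ ∑ j ∈ J, a ^ 2 * κ j ξ ^ 2 := Finset.sum_le_sum fun j _ => by
          rw [← mul_pow]
          refine sq_le_sq.2 ?_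
          rw [abs_mul, abs_of_nonneg hμ.nonneg]
          exact hμ.abs_le j ξ
      _ ≤ a ^ 2 * 1 := by
          rw [← Finset.mul_sum]
          exact mul_le_mul_of_nonneg_left (hκ.sum_sq_le_one J ξ) (sq_nonneg _)
      _ = a ^ 2 := mul_one _

theorem abs_le' (hκ : IsDyadicPartition κ) (hμ : IsDyadicFamily κ μ a) (j : ℕ) (ξ : ℝ) :
    |μ j ξ| ≤ a :=
  (hμ.abs_le j ξ).trans (mul_le_of_le_one_right hμ.nonneg (hκ.abs_le_one j ξ))

/-- `‖B μ_j(B) x‖ ≤ 2^{j+2} ‖μ_j(B) x‖`. -/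
theorem norm_apply_cfc_le (hκ : IsDyadicPartition κ) (hμ : IsDyadicFamily κ μ a) (j : ℕ)
    {B : X →L[ℂ] X} (hB : IsSelfAdjoint B) (x : X) :
    ‖B (cfc (μ j) B x)‖ ≤ 4 * 2 ^ j * ‖cfc (μ j) B x‖ := by
  have hc := (hμ.smooth j).continuous
  have e : B (cfc (μ j) B x) = cfc (fun ξ => ξ * μ j ξ) B x := by
    rw [cfc_mul (fun ξ => ξ) (μ j) B continuousOn_id hc.continuousOn, cfc_id' ℝ B hB]
    rfl
  rw [e]
  refine norm_cfc_apply_le_mul (continuous_id.mul hc) hc (by positivity) (fun ξ => ?_) B x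
  by_cases h : μ j ξ = 0
  · simp [h]
  · rw [Pi.mul_apply, id, abs_mul]
    exact mul_le_mul_of_nonneg_right (hκ.abs_le_of_ne_zero (hμ.ne_zero h)) (abs_nonneg _)

theorem norm_apply_cfc_add_le (hκ : IsDyadicPartition κ) (hμ : IsDyadicFamily κ μ a) (j : ℕ)
    {B : X →L[ℂ] X} (hB : IsSelfAdjoint B) (x : X) :
    ‖B (cfc (μ j) B x)‖ + ‖cfc (μ j) B x‖ ≤ 5 * 2 ^ j * ‖cfc (μ j) B x‖ := by
  have := hμ.norm_apply_cfc_le hκ j hB x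
  have h2 : (1 : ℝ) ≤ 2 ^ j := one_le_pow₀ (by norm_num)
  nlinarith [norm_nonneg (cfc (μ j) B x)]

theorem norm_sub_apply_le (hκ : IsDyadicPartition κ) (hμ : IsDyadicFamily κ μ a) (j : ℕ)
    {B₀ B₁ : X →L[ℂ] X} (hB₀ : IsSelfAdjoint B₀) (hB₁ : IsSelfAdjoint B₁) {δ : ℝ}
    (hδ : ∀ x, ‖(B₁ - B₀) x‖ ≤ δ * (‖B₀ x‖ + ‖x‖)) (x : X) :
    ‖(cfc (μ j) B₁ - cfc (μ j) B₀) x‖ ≤ 64 * a * ((2 ^ j)⁻¹ * (δ * (‖B₀ x‖ + ‖x‖))) :=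
  norm_cfc_sub_apply_le (hμ.smooth j) (by positivity)
    (fun _ h => hκ.abs_le_of_ne_zero (hμ.ne_zero h)) (hμ.deriv_one j) (hμ.deriv_three j)
    hB₀ hB₁ hδ x

end IsDyadicFamily

/-- With truncated subtraction the exponent is `|j - k|`, and this is the row sum for Schur's test.
The correction `-(1/2)^j` makes the induction close exactly: shifting `j` and `k` together leaves
only the new term `k = 0`. -/
theorem sum_half_pow_dist_le (N j : ℕ) :
    ∑ k ∈ Finset.range N, (1 / 2 : ℝ) ^ ((j - k) + (k - j)) ≤ 4 - (1 / 2) ^ j := by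
  induction j generalizing N with
  | zero =>
    simp only [Nat.zero_sub, Nat.sub_zero, zero_add, pow_zero]
    have := sum_geometric_two_le N
    linarith
  | succ j ih =>
    cases N with
    | zero =>
      have : (1 / 2 : ℝ) ^ (j + 1) ≤ 1 := pow_le_one₀ (by norm_num) (by norm_num)
      simp only [Finset.range_zero, Finset.sum_empty]; linarith
    | succ N =>
      rw [Finset.sum_range_succ']
      simp only [Nat.add_sub_add_right, Nat.sub_zero, Nat.zero_sub, add_zero]
      have := ih N
      have e : (1 / 2 : ℝ) ^ (j + 1) = (1 / 2) ^ j / 2 := by rw [pow_succ]; ring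
      linarith

/-- Almost orthogonality: differences of the functional calculus have off-diagonal decay. -/
theorem norm_cfc_sub_mul_cfc_le (hκ : IsDyadicPartition κ) {aκ : ℝ} (haκ : 1 ≤ aκ)
    (hκκ : IsDyadicFamily κ κ aκ) (hμ : IsDyadicFamily κ μ a)
    {B₀ B₁ : X →L[ℂ] X} (hB₀ : IsSelfAdjoint B₀) (hB₁ : IsSelfAdjoint B₁) {δ : ℝ} (hδ0 : 0 ≤ δ)
    (hδ : ∀ x, ‖(B₁ - B₀) x‖ ≤ δ * (‖B₀ x‖ + ‖x‖))
    (hδ' : ∀ x, ‖(B₀ - B₁) x‖ ≤ δ * (‖B₁ x‖ + ‖x‖)) (j k : ℕ) :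
    ‖(cfc (μ j) B₁ - cfc (μ j) B₀) * cfc (κ k) B₀‖ ≤
      5120 * aκ * a * δ * (1 / 2) ^ ((j - k) + (k - j)) := by
  have ha := hμ.nonneg
  rcases le_or_gt k (j + 2) with hjk | hjk
  · refine ContinuousLinearMap.opNorm_le_bound _ (by positivity) fun x => ?_
    rw [mul_apply_eq_comp]
    refine (hμ.norm_sub_apply_le hκ j hB₀ hB₁ hδ _).trans ?_
    have h1 := hκκ.norm_apply_cfc_add_le hκ k hB₀ x
    have h2 := norm_cfc_apply_le (hκ.smooth k).continuous zero_le_one (hκ.abs_le_one k) hB₀ x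
    -- Equality without the 16 when `k ≤ j`; for `k = j + d` with `d ≤ 2` the loss is `4^d ≤ 16`.
    have h3 : (2 ^ j : ℝ)⁻¹ * 2 ^ k ≤ 16 * (1 / 2) ^ ((j - k) + (k - j)) := by
      rcases le_or_gt k j with h | h
      · obtain ⟨d, rfl⟩ := Nat.exists_eq_add_of_le h
        rw [show (k + d - k) + (k - (k + d)) = d by omega, pow_add, mul_inv, mul_right_comm,
          inv_mul_cancel₀ (by positivity), one_mul, one_div, inv_pow]
        linarith [inv_nonneg.2 (by positivity : (0 : ℝ) ≤ 2 ^ d)]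
      · obtain ⟨d, rfl⟩ := Nat.exists_eq_add_of_le h.le
        rw [show (j - (j + d)) + (j + d - j) = d by omega, pow_add, ← mul_assoc,
          inv_mul_cancel₀ (by positivity), one_mul]
        have hd : d ≤ 2 := by omega
        interval_cases d <;> norm_num
    calc 64 * a * ((2 ^ j)⁻¹ * (δ * (‖B₀ (cfc (κ k) B₀ x)‖ + ‖cfc (κ k) B₀ x‖)))
        ≤ 64 * a * ((2 ^ j)⁻¹ * (δ * (5 * 2 ^ k * (1 * ‖x‖)))) := by
          gcongr
          exact h1.trans (mul_le_mul_of_nonneg_left h2 (by positivity))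
      _ = 320 * 1 * a * δ * ((2 ^ j)⁻¹ * 2 ^ k) * ‖x‖ := by ring
      _ ≤ 320 * aκ * a * δ * (16 * (1 / 2) ^ ((j - k) + (k - j))) * ‖x‖ := by gcongr
      _ = _ := by ring
  · have hz : cfc (μ j) B₀ * cfc (κ k) B₀ = 0 ∧ cfc (κ k) B₁ * cfc (μ j) B₁ = 0 := by
      have h0 : ∀ ξ, μ j ξ = 0 ∨ κ k ξ = 0 := fun ξ => by
        by_contra! h
        have h1 := (hκ.support j ξ (hμ.ne_zero h.1)).2
        have h2 := (hκ.support k ξ h.2).1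
        have h3 : (2 : ℝ) ^ (j + 2) < 2 ^ k := pow_lt_pow_right₀ (by norm_num) hjk
        linarith
      constructor
      · rw [← cfc_mul _ _ B₀ (hμ.smooth j).continuous.continuousOn
          (hκ.smooth k).continuous.continuousOn, ← cfc_zero ℝ B₀]
        refine cfc_congr fun ξ _ => ?_
        rcases h0 ξ with h | h <;> simp [h]
      · rw [← cfc_mul _ _ B₁ (hκ.smooth k).continuous.continuousOn
          (hμ.smooth j).continuous.continuousOn, ← cfc_zero ℝ B₁]
        refine cfc_congr fun ξ _ => ?_
        rcases h0 ξ with h | h <;> simp [h]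
    -- When `k > j + 2` the supports are disjoint, so the product reduces to `μ_j(B₁) κ_k(B₀)`. This
    -- is the adjoint of a difference of the calculus for `κ_k`, localized by `μ_j(B₁)`, and now the
    -- gain is `2^{-k}` from the larger frequency.
    have e1 : (cfc (μ j) B₁ - cfc (μ j) B₀) * cfc (κ k) B₀ =
        star ((cfc (κ k) B₀ - cfc (κ k) B₁) * cfc (μ j) B₁) := by
      rw [sub_mul, hz.1, sub_zero, sub_mul, hz.2, sub_zero, star_mul,
        (isSelfAdjoint_cfc _ _).star_eq, (isSelfAdjoint_cfc _ _).star_eq]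
    rw [e1, norm_star]
    refine ContinuousLinearMap.opNorm_le_bound _ (by positivity) fun x => ?_
    rw [mul_apply_eq_comp]
    refine (hκκ.norm_sub_apply_le hκ k hB₁ hB₀ hδ' _).trans ?_
    have h1 := hμ.norm_apply_cfc_add_le hκ j hB₁ x
    have h2 := norm_cfc_apply_le (hμ.smooth j).continuous ha (hμ.abs_le' hκ j) hB₁ x
    have h3 : (2 ^ k : ℝ)⁻¹ * 2 ^ j = (1 / 2) ^ ((j - k) + (k - j)) := by
      obtain ⟨d, rfl⟩ := Nat.exists_eq_add_of_le (show j ≤ k by omega)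
      rw [show (j - (j + d)) + (j + d - j) = d by omega, pow_add, mul_inv, mul_right_comm,
          inv_mul_cancel₀ (by positivity), one_mul, one_div, inv_pow]
    calc 64 * aκ * ((2 ^ k)⁻¹ * (δ * (‖B₁ (cfc (μ j) B₁ x)‖ + ‖cfc (μ j) B₁ x‖)))
        ≤ 64 * aκ * ((2 ^ k)⁻¹ * (δ * (5 * 2 ^ j * (a * ‖x‖)))) := by
          gcongr
          exact h1.trans (mul_le_mul_of_nonneg_left h2 (by positivity))
      _ = 320 * aκ * a * δ * ((2 ^ k)⁻¹ * 2 ^ j) * ‖x‖ := by ring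
      _ ≤ 5120 * aκ * a * δ * ((2 ^ k)⁻¹ * 2 ^ j) * ‖x‖ := by gcongr; norm_num
      _ = _ := by rw [h3]

/-- The square function Lipschitz estimate for the functional calculus. -/
theorem sum_norm_cfc_sub_sq_le (hκ : IsDyadicPartition κ) {aκ : ℝ} (haκ : 1 ≤ aκ)
    (hκκ : IsDyadicFamily κ κ aκ) (hμ : IsDyadicFamily κ μ a)
    {B₀ B₁ : X →L[ℂ] X} (hB₀ : IsSelfAdjoint B₀) (hB₁ : IsSelfAdjoint B₁) {δ : ℝ} (hδ0 : 0 ≤ δ)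
    (hδ : ∀ x, ‖(B₁ - B₀) x‖ ≤ δ * (‖B₀ x‖ + ‖x‖))
    (hδ' : ∀ x, ‖(B₀ - B₁) x‖ ≤ δ * (‖B₁ x‖ + ‖x‖)) (J : ℕ) (x : X) :
    ∑ j ∈ Finset.range J, ‖(cfc (μ j) B₁ - cfc (μ j) B₀) x‖ ^ 2 ≤
      (20480 * aκ * a * δ) ^ 2 * ‖x‖ ^ 2 := by
  -- Beyond this index all `κ_k` vanish on the spectrum of `B₀`, so a finite sum resolves the
  -- identity. The range is `N + 1` because `sum_range_sq_eq_one` needs a nonzero length.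
  obtain ⟨N, hN⟩ := pow_unbounded_of_one_lt ‖B₀‖ (by norm_num : (1 : ℝ) < 2)
  have hN' : ‖B₀‖ < 2 ^ (N + 1) :=
    hN.trans (pow_lt_pow_right₀ (by norm_num) N.lt_succ_self)
  set y : ℕ → X := fun k => cfc (κ k) B₀ x with hy
  set D := 5120 * aκ * a * δ with hD
  have hD0 : 0 ≤ D := by have := hμ.nonneg; positivity
  set wt : ℕ → ℕ → ℝ := fun j k => (1 / 2 : ℝ) ^ ((j - k) + (k - j)) with hwt
  have hwt0 : ∀ j k, 0 ≤ wt j k := fun j k => by positivity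
  have hwtsymm : ∀ j k, wt j k = wt k j := fun j k => by simp only [hwt]; rw [add_comm]
  have hwt4 : ∀ M j, ∑ k ∈ Finset.range M, wt j k ≤ 4 := fun M j =>
    (sum_half_pow_dist_le M j).trans (by linarith [show (0 : ℝ) ≤ (1 / 2) ^ j by positivity])
  have hrec : x = ∑ k ∈ Finset.range (N + 1), cfc (κ k) B₀ (y k) := by
    have h1 : ∑ k ∈ Finset.range (N + 1), cfc (κ k) B₀ * cfc (κ k) B₀ = 1 := by
      rw [← cfc_one ℝ B₀]
      have : ∀ k, cfc (κ k) B₀ * cfc (κ k) B₀ = cfc (fun ξ => κ k ξ ^ 2) B₀ := fun k => by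
        simp only [sq]
        rw [← cfc_mul _ _ B₀ (hκ.smooth k).continuous.continuousOn
          (hκ.smooth k).continuous.continuousOn]
      simp only [this]
      rw [← cfc_sum (fun k ξ => κ k ξ ^ 2) B₀ _ fun k _ =>
        ((hκ.smooth k).continuous.pow 2).continuousOn]
      refine cfc_congr fun ξ hξ => ?_
      simp only [Finset.sum_apply, Pi.one_apply]
      exact hκ.sum_range_sq_eq_one ((abs_le_norm_of_mem_spectrum hξ).trans_lt hN') (by omega)
    have h2 := DFunLike.congr_fun h1 x
    simpa [sum_apply, hy] using h2.symm
  -- Schur's test with weight `2^{-|j-k|}`: the row sums here and the column sums below are at most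
  -- 4, which turns `D` into `4D`, hence `20480 = 4 · 5120`.
  have hj : ∀ j, ‖(cfc (μ j) B₁ - cfc (μ j) B₀) x‖ ^ 2 ≤
      4 * D ^ 2 * ∑ k ∈ Finset.range (N + 1), wt j k * ‖y k‖ ^ 2 := fun j => by
    have h1 : ‖(cfc (μ j) B₁ - cfc (μ j) B₀) x‖ ≤
        ∑ k ∈ Finset.range (N + 1), √(wt j k) * (D * √(wt j k) * ‖y k‖) := by
      conv_lhs => rw [hrec, map_sum]
      refine (norm_sum_le _ _).trans (Finset.sum_le_sum fun k _ => ?_)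
      rw [← mul_apply_eq_comp]
      refine (ContinuousLinearMap.le_opNorm _ _).trans ?_
      have := norm_cfc_sub_mul_cfc_le hκ haκ hκκ hμ hB₀ hB₁ hδ0 hδ hδ' j k
      calc _ ≤ D * wt j k * ‖y k‖ := mul_le_mul_of_nonneg_right this (norm_nonneg _)
        _ = D * (√(wt j k) * √(wt j k)) * ‖y k‖ := by rw [Real.mul_self_sqrt (hwt0 j k)]
        _ = _ := by ring
    refine (pow_le_pow_left₀ (norm_nonneg _) h1 2).trans
      ((Finset.sum_mul_sq_le_sq_mul_sq _ _ _).trans ?_)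
    simp only [mul_pow, Real.sq_sqrt (hwt0 _ _), mul_assoc, ← Finset.mul_sum]
    rw [← mul_assoc, ← mul_assoc]
    gcongr
    exact hwt4 _ j
  calc _ ≤ ∑ j ∈ Finset.range J, 4 * D ^ 2 * ∑ k ∈ Finset.range (N + 1), wt j k * ‖y k‖ ^ 2 :=
        Finset.sum_le_sum fun j _ => hj j
    _ = 4 * D ^ 2 * ∑ k ∈ Finset.range (N + 1), (∑ j ∈ Finset.range J, wt k j) * ‖y k‖ ^ 2 := by
        rw [← Finset.mul_sum, Finset.sum_comm]
        simp only [Finset.sum_mul, hwtsymm]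
    _ ≤ 4 * D ^ 2 * ∑ k ∈ Finset.range (N + 1), 4 * ‖y k‖ ^ 2 := by
        gcongr with k _
        exact hwt4 J k
    _ = (4 * D) ^ 2 * ∑ k ∈ Finset.range (N + 1), ‖y k‖ ^ 2 := by
        rw [← Finset.mul_sum]; ring
    _ ≤ (4 * D) ^ 2 * ‖x‖ ^ 2 := by
        gcongr
        have := sum_norm_cfc_sq_le (Finset.range (N + 1)) (f := κ) (g := fun _ => 1)
          (fun j _ => (hκ.smooth j).continuous) continuous_const
          (fun ξ => by simpa using hκ.sum_sq_le_one _ ξ) B₀ x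
        rwa [cfc_const_one ℝ B₀, one_apply_eq_self] at this
    _ = _ := by rw [hD]; ring

end SquareFunction

/-! ### Half-line cut-offs and the densities of the layer cake representation. -/

section HalfCutoff

/-- The part of a dyadic partition of unity on a half line: `ε = 1` for the negative half line,
`ε = -1` for the positive one. -/
structure IsHalfCutoff (κ c : ℕ → ℝ → ℝ) (ε : ℝ) : Prop where
  sign : ε = 1 ∨ ε = -1
  smooth : ∀ j, ContDiff ℝ ∞ (c j)
  abs_le : ∀ j ξ, |c j ξ| ≤ |κ j ξ|
  iteratedDeriv_eq : ∀ j m ξ, iteratedDeriv m (c j) ξ = iteratedDeriv m (κ j) ξ ∨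
    iteratedDeriv m (c j) ξ = 0
  half : ∀ j ξ, j ≠ 0 → c j ξ ≠ 0 → ε * ξ ≤ -2 ^ j

variable {κ c : ℕ → ℝ → ℝ} {ε : ℝ}

/-- For `j ≠ 0` the two open half lines in the hypotheses overlap and cover the line, so near every
point `c_j` coincides with `κ_j` or with zero. Cutting at the origin creates no singularity, since
`κ_j` vanishes around it. -/
theorem IsHalfCutoff.of_eqOn (hκ : IsDyadicPartition κ) (hε : ε = 1 ∨ ε = -1)
    (h0 : c 0 = κ 0 ∨ c 0 = 0) (h1 : ∀ j ξ, j ≠ 0 → ε * ξ < 1 → c j ξ = κ j ξ)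
    (h2 : ∀ j ξ, j ≠ 0 → -1 < ε * ξ → c j ξ = 0) : IsHalfCutoff κ c ε := by
  have hloc : ∀ j ξ, c j =ᶠ[nhds ξ] κ j ∨ c j =ᶠ[nhds ξ] 0 := fun j ξ => by
    by_cases hj : j = 0
    · subst hj
      rcases h0 with h | h
      · exact Or.inl (by rw [h])
      · exact Or.inr (by rw [h])
    have hc : Continuous fun ξ : ℝ => ε * ξ := by fun_prop
    rcases lt_or_ge (ε * ξ) 1 with h | h
    · exact Or.inl ((hc.continuousAt.eventually_lt continuousAt_const h).mono
        fun η hη => h1 j η hj hη)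
    · exact Or.inr ((continuousAt_const.eventually_lt hc.continuousAt
        (by linarith : -1 < ε * ξ)).mono fun η hη => h2 j η hj hη)
  have hder : ∀ j m ξ, iteratedDeriv m (c j) ξ = iteratedDeriv m (κ j) ξ ∨
      iteratedDeriv m (c j) ξ = 0 := fun j m ξ => by
    rcases hloc j ξ with h | h
    · exact Or.inl (h.iteratedDeriv_eq m)
    · exact Or.inr ((h.iteratedDeriv_eq m).trans (by simp))
  refine ⟨hε, fun j => contDiff_iff_contDiffAt.2 fun ξ => ?_, fun j ξ => ?_, hder,
    fun j ξ hj h => ?_⟩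
  · rcases hloc j ξ with h | h
    · exact (hκ.smooth j).contDiffAt.congr_of_eventuallyEq h
    · exact contDiffAt_const.congr_of_eventuallyEq h
  · rcases hder j 0 ξ with h | h
    · simp only [iteratedDeriv_zero] at h; rw [h]
    · simp only [iteratedDeriv_zero] at h; rw [h, abs_zero]; exact abs_nonneg _
  · by_contra! hlt
    rcases le_or_gt (ε * ξ) (-1) with h' | h'
    · have h3 := h1 j ξ hj (by linarith)
      refine h (h3.trans (hκ.eq_zero_of_lt ?_ hj))
      have : |ξ| = |ε * ξ| := by rcases hε with rfl | rfl <;> simp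
      rw [this, abs_of_nonpos (by linarith)]
      linarith
    · exact h (h2 j ξ hj h')

theorem isHalfCutoff_kappaMinus (hκ : IsDyadicPartition κ) :
    IsHalfCutoff κ (kappaMinus κ) 1 := by
  have hz : ∀ j ξ, j ≠ 0 → |ξ| < 1 → κ j ξ = 0 := fun j ξ hj h =>
    hκ.eq_zero_of_lt (h.trans (one_lt_pow₀ (by norm_num) hj)) hj
  refine .of_eqOn hκ (Or.inl rfl) (Or.inr ?_) (fun j ξ hj h => ?_) fun j ξ hj h => ?_
  · ext ξ; simp [kappaMinus]
  · rw [one_mul] at h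
    simp only [kappaMinus, ne_eq, hj, not_false_eq_true, true_and]
    split_ifs with h'
    · rfl
    · exact (hz j ξ hj (by rw [abs_lt]; constructor <;> linarith)).symm
  · rw [one_mul] at h
    simp only [kappaMinus, ne_eq, hj, not_false_eq_true, true_and]
    split_ifs with h'
    · exact hz j ξ hj (by rw [abs_lt]; constructor <;> linarith)
    · rfl

theorem isHalfCutoff_kappaPlus (hκ : IsDyadicPartition κ) :
    IsHalfCutoff κ (kappaPlus κ) (-1) := by
  have hz : ∀ j ξ, j ≠ 0 → |ξ| < 1 → κ j ξ = 0 := fun j ξ hj h =>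
    hκ.eq_zero_of_lt (h.trans (one_lt_pow₀ (by norm_num) hj)) hj
  refine .of_eqOn hκ (Or.inr rfl) (Or.inl ?_) (fun j ξ hj h => ?_) fun j ξ hj h => ?_
  · ext ξ; simp [kappaPlus]
  · simp only [kappaPlus, hj, false_or]
    split_ifs with h'
    · rfl
    · exact (hz j ξ hj (by rw [abs_lt]; constructor <;> linarith)).symm
  · simp only [kappaPlus, hj, false_or]
    split_ifs with h'
    · exact hz j ξ hj (by rw [abs_lt]; constructor <;> linarith)
    · rfl

theorem kappaMinus_sq_add_kappaPlus_sq (hκ : IsDyadicPartition κ) (j : ℕ) (ξ : ℝ) :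
    kappaMinus κ j ξ ^ 2 + kappaPlus κ j ξ ^ 2 = κ j ξ ^ 2 := by
  unfold kappaMinus kappaPlus
  by_cases hj : j = 0
  · simp [hj]
  · rcases lt_trichotomy ξ 0 with h | h | h
    · simp [hj, h.le, h.not_ge]
    · have := hκ.eq_zero_of_lt (ξ := ξ) (j := j) (by simp [h]) hj
      simp [this]
    · simp [hj, h.le, h.not_ge]

/-- Affine multiples of an exponential are stable under differentiation, so the induction runs over
all `p` and `q`. The truncation of `n - 1` at `n = 0` is harmless because of the factor `n`. -/
theorem iteratedDeriv_affine_mul_exp (p q r : ℝ) (n : ℕ) :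
    iteratedDeriv n (fun η : ℝ => (p + q * η) * Real.exp (r * η)) =
      fun η => (p * r ^ n + n * q * r ^ (n - 1) + q * r ^ n * η) * Real.exp (r * η) := by
  induction n generalizing p q with
  | zero => ext η; simp
  | succ n ih =>
    have hd : deriv (fun η : ℝ => (p + q * η) * Real.exp (r * η)) =
        fun η => ((q + r * p) + (r * q) * η) * Real.exp (r * η) := by
      ext η
      have h1 : HasDerivAt (fun η : ℝ => p + q * η) q η := by
        simpa using ((hasDerivAt_id η).const_mul q).const_add p
      have h2 : HasDerivAt (fun η : ℝ => Real.exp (r * η)) (Real.exp (r * η) * r) η := by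
        simpa using ((hasDerivAt_id η).const_mul r).exp
      refine (h1.mul h2).deriv.trans ?_
      ring
    rw [iteratedDeriv_succ', hd, ih]
    ext η
    congr 1
    cases n with
    | zero => simp; ring
    | succ n => simp; ring

/-- Products of a function on scale `l` with a rescaled smooth function. -/
theorem abs_iteratedDeriv_mul_le {c h : ℝ → ℝ} (hc : ContDiff ℝ ∞ c) (hh : ContDiff ℝ ∞ h)
    {l : ℝ} (hl : 0 < l) {S : Set ℝ} (hS : IsClosed S) (hcS : ∀ ξ, c ξ ≠ 0 → ξ / l ∈ S) {A H : ℝ}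
    {m : ℕ} (hA : ∀ i ≤ m, ∀ ξ, l ^ i * |iteratedDeriv i c ξ| ≤ A)
    (hH : ∀ i ≤ m, ∀ η ∈ S, |iteratedDeriv i h η| ≤ H) (hA0 : 0 ≤ A) (hH0 : 0 ≤ H) (ξ : ℝ) :
    l ^ m * |iteratedDeriv m (fun ξ => c ξ * h (l⁻¹ * ξ)) ξ| ≤ 2 ^ m * (A * H) := by
  have hh' : ContDiff ℝ ∞ fun ξ => h (l⁻¹ * ξ) := hh.comp (by fun_prop)
  have e : iteratedDeriv m (fun ξ => c ξ * h (l⁻¹ * ξ)) ξ = ∑ i ∈ Finset.range (m + 1),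
      m.choose i * iteratedDeriv i c ξ * ((l⁻¹) ^ (m - i) * iteratedDeriv (m - i) h (l⁻¹ * ξ)) := by
    have := iteratedDeriv_mul (n := m) (x := ξ)
      (hc.contDiffAt.of_le (by exact_mod_cast le_top)) (hh'.contDiffAt.of_le (by exact_mod_cast le_top))
    refine Eq.trans this (Finset.sum_congr rfl fun i _ => ?_)
    rw [iteratedDeriv_comp_const_mul (hh.of_le (WithTop.coe_le_coe.2 le_top))]
  rw [e]
  calc _ ≤ l ^ m * ∑ i ∈ Finset.range (m + 1), (l⁻¹) ^ m * (m.choose i * (A * H)) := by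
        gcongr
        refine (Finset.abs_sum_le_sum_abs _ _).trans (Finset.sum_le_sum fun i hi => ?_)
        have him : i ≤ m := by simpa [Nat.lt_succ_iff] using hi
        rw [abs_mul, abs_mul, abs_mul, abs_of_nonneg (by positivity : (0:ℝ) ≤ (l⁻¹) ^ (m - i)),
          Nat.abs_cast]
        have key : l ^ i * |iteratedDeriv i c ξ| * |iteratedDeriv (m - i) h (l⁻¹ * ξ)| ≤ A * H := by
          by_cases h0 : iteratedDeriv i c ξ = 0
          · simp only [h0, abs_zero, mul_zero, zero_mul]; positivity
          · refine mul_le_mul (hA i him ξ) (hH _ (Nat.sub_le _ _) _ ?_) (abs_nonneg _) hA0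
            have hcl : IsClosed {ξ | ξ / l ∈ S} := hS.preimage (by fun_prop)
            have : ξ / l ∈ S := closure_minimal hcS hcl (support_iteratedDeriv_subset c i h0)
            rwa [inv_mul_eq_div]
        -- The powers of `l` produced by differentiating `h (l⁻¹ ξ)` are exactly those that the
        -- bound for `c` requires.
        have hpow : (l⁻¹) ^ (m - i) = (l⁻¹) ^ m * l ^ i := by
          rw [inv_pow, inv_pow, inv_mul_eq_div, eq_div_iff (by positivity), ← div_eq_inv_mul,
            div_eq_iff (by positivity), ← pow_add]
          congr 1; omega
        rw [hpow]
        calc _ = (l⁻¹) ^ m * (m.choose i *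
              (l ^ i * |iteratedDeriv i c ξ| * |iteratedDeriv (m - i) h (l⁻¹ * ξ)|)) := by ring
          _ ≤ _ := by gcongr
    _ = _ := by
        rw [← Finset.mul_sum, ← Finset.sum_mul, ← mul_assoc, ← mul_pow, mul_inv_cancel₀ hl.ne',
          one_pow, one_mul]
        congr 1
        exact_mod_cast Nat.sum_range_choose m

/-- The densities in the representation of `c_j(ξ) e^{ετξ}`, `0 < τ ≤ 1`, as an integral of
cut-offs, `∫ 1_{2^j τ < σ} μ_{j,σ}(ξ) dσ`. -/
noncomputable def layer (c : ℕ → ℝ → ℝ) (ε σ : ℝ) (j : ℕ) (ξ : ℝ) : ℝ :=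
  if j ≠ 0 ∨ σ ≤ 1 then
    c j ξ * ((0 + -ε * ((2 ^ j)⁻¹ * ξ)) * Real.exp (ε * σ * ((2 ^ j)⁻¹ * ξ)))
  else if σ ≤ 2 then c j ξ * ((1 + 0 * ((2 ^ j)⁻¹ * ξ)) * Real.exp (ε * 1 * ((2 ^ j)⁻¹ * ξ)))
  else 0

/-- Half of the exponential absorbs the cubic: `x³/3! ≤ e^x` at `x = (1 + σ)/2`, and `e^{1/2} ≤ 2`.
-/
theorem exp_decay_aux {σ : ℝ} (hσ : 0 ≤ σ) : (1 + σ) ^ 3 * Real.exp (-σ) ≤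
    96 * Real.exp (-σ / 2) := by
  have h1 := Real.pow_div_factorial_le_exp ((1 + σ) / 2) (by positivity) 3
  have h2 : Real.exp ((1 + σ) / 2) * Real.exp (-σ) = Real.exp (1 / 2) * Real.exp (-σ / 2) := by
    rw [← Real.exp_add, ← Real.exp_add]; congr 1; ring
  have h3 : Real.exp (1 / 2) ≤ 2 := by
    have := Real.exp_bound_div_one_sub_of_interval (x := 1 / 2) (by norm_num) (by norm_num)
    linarith
  have h4 : (1 + σ) ^ 3 ≤ 48 * Real.exp ((1 + σ) / 2) := by
    rw [div_pow] at h1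
    norm_num [Nat.factorial] at h1
    linarith
  calc _ ≤ 48 * Real.exp ((1 + σ) / 2) * Real.exp (-σ) := by gcongr
    _ = 48 * Real.exp (1 / 2) * Real.exp (-σ / 2) := by rw [mul_assoc, h2, mul_assoc]
    _ ≤ 48 * 2 * Real.exp (-σ / 2) := by gcongr
    _ = _ := by ring

/-- The three coefficients in `iteratedDeriv_affine_mul_exp` contribute 1, 3 and 4 times `(1 +
σ)^3`. -/
theorem abs_iteratedDeriv_affine_mul_exp_le {p q r σ η D : ℝ} (hp : |p| ≤ 1) (hq : |q| ≤ 1)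
    (hr : |r| ≤ σ) (hη : |η| ≤ 4) (hD : Real.exp (r * η) ≤ D) {n : ℕ} (hn : n ≤ 3) :
    |iteratedDeriv n (fun η : ℝ => (p + q * η) * Real.exp (r * η)) η| ≤ 8 * (1 + σ) ^ 3 * D := by
  have hσ : 0 ≤ σ := (abs_nonneg _).trans hr
  rw [iteratedDeriv_affine_mul_exp, abs_mul, abs_of_pos (Real.exp_pos _)]
  refine mul_le_mul ?_ hD (Real.exp_pos _).le (by positivity)
  have h1 : ∀ k ≤ 3, |r| ^ k ≤ (1 + σ) ^ 3 := fun k hk =>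
    (pow_le_pow_left₀ (abs_nonneg _) (by linarith) k).trans
      (pow_le_pow_right₀ (by linarith) hk)
  have h2 : |p * r ^ n| ≤ (1 + σ) ^ 3 := by
    rw [abs_mul, abs_pow]
    exact (mul_le_of_le_one_left (by positivity) hp).trans (h1 n hn)
  have h3 : |n * q * r ^ (n - 1)| ≤ 3 * (1 + σ) ^ 3 := by
    rw [abs_mul, abs_mul, abs_pow, Nat.abs_cast]
    have : (n : ℝ) ≤ 3 := by exact_mod_cast hn
    have := h1 (n - 1) (by omega)
    calc _ ≤ 3 * 1 * (1 + σ) ^ 3 := by gcongr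
      _ = _ := by ring
  have h4 : |q * r ^ n * η| ≤ 4 * (1 + σ) ^ 3 := by
    rw [abs_mul, abs_mul, abs_pow]
    calc _ ≤ 1 * (1 + σ) ^ 3 * 4 := by
          gcongr
          exact h1 n hn
      _ = _ := by ring
  linarith [abs_add_three (p * r ^ n) (n * q * r ^ (n - 1)) (q * r ^ n * η)]

/-- After rescaling by `2^j` a layer is `c_j` times an affine function times an exponential. On the
support of `c_j` with `j ≠ 0` one has `|η| ≤ 4` and `εη ≤ -1`, so the exponential is at most
`e^{-σ}`; up to three derivatives cost at most `8(1 + σ)^3`. The outer 8 is the binomial factor `2³`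
from Leibniz' rule. -/
theorem isDyadicFamily_layer (hκ : IsDyadicPartition κ) {A : ℝ} (hA : 1 ≤ A)
    (hc : IsHalfCutoff κ c ε)
    (hcA : ∀ i ≤ 3, ∀ j ξ, (2 ^ j) ^ i * |iteratedDeriv i (c j) ξ| ≤ A) {σ : ℝ} (hσ : 0 ≤ σ) :
    IsDyadicFamily κ (layer c ε σ) (8 * (A * (768 * Real.exp 6 * Real.exp (-σ / 2)))) := by
  set H := 768 * Real.exp 6 * Real.exp (-σ / 2) with hH
  have hH0 : 0 ≤ H := by positivity
  have hε : |ε| = 1 := by rcases hc.sign with h | h <;> simp [h]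
  have hHσ : 8 * (1 + σ) ^ 3 * (Real.exp 6 * Real.exp (-σ)) ≤ H := by
    have := mul_le_mul_of_nonneg_left (exp_decay_aux hσ) (Real.exp_pos 6).le
    rw [hH]; linarith
  have hsupp : ∀ j ξ, c j ξ ≠ 0 → |ξ / 2 ^ j| ≤ 4 := fun j ξ h => by
    have h0 : κ j ξ ≠ 0 := by
      intro h0
      have := hc.abs_le j ξ
      rw [h0, abs_zero] at this
      exact h (abs_nonpos_iff.1 this)
    rw [abs_div, abs_of_pos (by positivity : (0 : ℝ) < 2 ^ j), div_le_iff₀ (by positivity)]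
    exact hκ.abs_le_of_ne_zero h0
  have key : ∀ j, ∃ h : ℝ → ℝ, ContDiff ℝ ∞ h ∧ layer c ε σ j =
      (fun ξ => c j ξ * h ((2 ^ j)⁻¹ * ξ)) ∧ ∃ S : Set ℝ, IsClosed S ∧
      (∀ ξ, c j ξ ≠ 0 → ξ / 2 ^ j ∈ S) ∧ ∀ i ≤ 3, ∀ η ∈ S, |iteratedDeriv i h η| ≤ H := fun j => by
    by_cases hj : j ≠ 0 ∨ σ ≤ 1
    · refine ⟨fun η => (0 + -ε * η) * Real.exp (ε * σ * η), by fun_prop, ?_, ?_⟩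
      · ext ξ; simp only [layer, if_pos hj]
      -- For `j = 0` the exponent has no sign, but it is at most 4, and the layer vanishes for `σ >
      -- 2`. Hence `e^4 ≤ e^6 e^{-σ}` wherever the layer is nonzero, which is the reason for the
      -- factor `e^6`.
      by_cases hj0 : j = 0
      · subst hj0
        have hσ1 : σ ≤ 1 := by simpa using hj
        refine ⟨{η | |η| ≤ 4}, isClosed_le (by fun_prop) (by fun_prop), hsupp 0,
          fun i hi η hη => ?_⟩
        refine (abs_iteratedDeriv_affine_mul_exp_le (by simp) (by simp [hε]) (σ := σ)
          (by simp [abs_mul, hε, abs_of_nonneg hσ]) hη ?_ hi).trans hHσ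
        rw [← Real.exp_add, Real.exp_le_exp]
        have h1 : |ε * σ * η| ≤ 1 * 1 * 4 := by
          rw [abs_mul, abs_mul, hε, abs_of_nonneg hσ]
          have : |η| ≤ 4 := hη
          gcongr
        linarith [le_abs_self (ε * σ * η)]
      · have hcl : IsClosed {η : ℝ | |η| ≤ 4 ∧ ε * η ≤ -1} :=
          (isClosed_le continuous_abs continuous_const).and
            (isClosed_le (continuous_const_mul ε) continuous_const)
        refine ⟨{η | |η| ≤ 4 ∧ ε * η ≤ -1}, hcl, fun ξ h => ⟨hsupp j ξ h, ?_⟩,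
          fun i hi η hη => ?_⟩
        · have := hc.half j ξ hj0 h
          rw [← mul_div_assoc, div_le_iff₀ (by positivity)]; linarith
        · refine (abs_iteratedDeriv_affine_mul_exp_le (by simp) (by simp [hε]) (σ := σ)
            (by simp [abs_mul, hε, abs_of_nonneg hσ]) hη.1 ?_ hi).trans hHσ
          rw [← Real.exp_add, Real.exp_le_exp]
          nlinarith [hη.2]
    · obtain ⟨hj0, hσ1⟩ : j = 0 ∧ 1 < σ := by simpa using hj
      subst hj0
      by_cases hσ2 : σ ≤ 2
      · refine ⟨fun η => (1 + 0 * η) * Real.exp (ε * 1 * η), by fun_prop, ?_, {η | |η| ≤ 4},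
          isClosed_le (by fun_prop) (by fun_prop), hsupp 0, fun i hi η hη => ?_⟩
        · ext ξ; simp only [layer, if_neg hj, if_pos hσ2]
        · refine (abs_iteratedDeriv_affine_mul_exp_le (by simp) (by simp) (σ := σ)
            (by simpa [hε] using hσ1.le) hη ?_ hi).trans hHσ
          rw [← Real.exp_add, Real.exp_le_exp]
          have h1 : |ε * 1 * η| ≤ 4 := by
            rw [mul_one, abs_mul, hε, one_mul]; exact hη
          linarith [le_abs_self (ε * 1 * η)]
      · refine ⟨fun _ => 0, contDiff_const, ?_, univ, isClosed_univ, fun _ _ => trivial,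
          fun i _ η _ => by simpa using hH0⟩
        ext ξ; simp only [layer, if_neg hj, if_neg hσ2, mul_zero]
  have hAH : 0 ≤ A * H := by positivity
  refine ⟨fun j => ?_, fun j ξ => ?_, fun j ξ => ?_, fun j ξ => ?_⟩
  all_goals obtain ⟨h, hh, he, S, hS, hcS, hb⟩ := key j
  · rw [he]
    exact (hc.smooth j).mul (hh.comp (by fun_prop))
  · simp only [he, abs_mul]
    by_cases h0 : c j ξ = 0
    · rw [h0, abs_zero, zero_mul]; positivity
    · have h1 := hb 0 (by omega) _ (hcS ξ h0)
      rw [iteratedDeriv_zero, div_eq_inv_mul] at h1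
      calc |c j ξ| * |h ((2 ^ j)⁻¹ * ξ)| ≤ |κ j ξ| * H :=
            mul_le_mul (hc.abs_le j ξ) h1 (abs_nonneg _) (abs_nonneg _)
        _ = (1 * (1 * H)) * |κ j ξ| := by ring
        _ ≤ 8 * (A * H) * |κ j ξ| := by gcongr; norm_num
  · rw [he]
    have := abs_iteratedDeriv_mul_le (hc.smooth j) hh (by positivity : (0 : ℝ) < 2 ^ j) hS hcS
      (m := 1) (fun i hi => hcA i (by omega) j) (fun i hi => hb i (by omega)) (by linarith) hH0 ξ
    rw [pow_one] at this
    linarith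
  · rw [he]
    have := abs_iteratedDeriv_mul_le (hc.smooth j) hh (by positivity : (0 : ℝ) < 2 ^ j) hS hcS
      (m := 3) (fun i hi => hcA i (by omega) j) (fun i hi => hb i (by omega)) (by linarith) hH0 ξ
    linarith

theorem IsHalfCutoff.isDyadicFamily {A : ℝ} (hA : 1 ≤ A)
    (hc : IsHalfCutoff κ c ε)
    (hcA : ∀ i ≤ 3, ∀ j ξ, (2 ^ j) ^ i * |iteratedDeriv i (c j) ξ| ≤ A) :
    IsDyadicFamily κ c A :=
  ⟨hc.smooth, fun j ξ => (hc.abs_le j ξ).trans (le_mul_of_one_le_left (abs_nonneg _) hA),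
    fun j ξ => by simpa using hcA 1 (by norm_num) j ξ, fun j ξ => hcA 3 le_rfl j ξ⟩

/-- A dyadic partition and its restriction to a half line, with a common constant. -/
structure HalfPartition (κ c : ℕ → ℝ → ℝ) (ε A : ℝ) : Prop where
  part : IsDyadicPartition κ
  cutoff : IsHalfCutoff κ c ε
  one_le : 1 ≤ A
  family : IsDyadicFamily κ κ A
  scale : ∀ i ≤ 3, ∀ j ξ, (2 ^ j) ^ i * |iteratedDeriv i (c j) ξ| ≤ A

theorem IsDyadicPartition.exists_halfPartition (hκ : IsDyadicPartition κ) :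
    ∃ A : ℝ, ∀ (c : ℕ → ℝ → ℝ) (ε : ℝ), IsHalfCutoff κ c ε → HalfPartition κ c ε A := by
  choose C hC using hκ.scale
  have h0 : 1 ≤ 1 + ∑ i ∈ Finset.range 4, |C i| := by
    linarith [Finset.sum_nonneg fun i (_ : i ∈ Finset.range 4) => abs_nonneg (C i)]
  have h1 : ∀ i ≤ 3, |C i| ≤ ∑ i ∈ Finset.range 4, |C i| := fun i hi =>
    Finset.single_le_sum (f := fun i => |C i|) (fun i _ => abs_nonneg _)
      (Finset.mem_range.2 (by omega))
  have h2 : ∀ i ≤ 3, ∀ j ξ, (2 ^ j) ^ i * |iteratedDeriv i (κ j) ξ| ≤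
      1 + ∑ i ∈ Finset.range 4, |C i| := fun i hi j ξ => by
    linarith [hC i j ξ, le_abs_self (C i), h1 i hi]
  refine ⟨_, fun c ε hc => ⟨hκ, hc, h0, ⟨hκ.smooth, fun j ξ =>
    le_mul_of_one_le_left (abs_nonneg _) h0, fun j ξ => ?_, h2 3 le_rfl⟩, fun i hi j ξ => ?_⟩⟩
  · simpa using h2 1 (by norm_num) j ξ
  · rcases hc.iteratedDeriv_eq j i ξ with h | h
    · rw [h]; exact h2 i hi j ξ
    · rw [h, abs_zero, mul_zero]; linarith

end HalfCutoff

/-! ### Time windows and their variation. -/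

section Window

/-- The indicator function of `{s | 0 < ε (t - s) < a}` for `ε = ±1`. -/
noncomputable def window (ε a t s : ℝ) : ℝ :=
  (if s < t + (1 - ε) / 2 * a then 1 else 0) - (if s ≤ t - (1 + ε) / 2 * a then 1 else 0)

/-- The definition writes the window as a difference of two steps that decrease in `s` and, for
fixed `s`, increase with `t`, as `V2Le.step` and `V2Le.smul_cutoff` need. The strict and the weak
inequality there are chosen so that both ends of the window are open. -/
theorem window_eq {ε a : ℝ} (hε : ε = 1 ∨ ε = -1) (ha : 0 < a) (t s : ℝ) :
    window ε a t s = if 0 < ε * (t - s) ∧ ε * (t - s) < a then 1 else 0 := by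
  unfold window
  rcases hε with rfl | rfl
  · norm_num
    split_ifs <;> grind
  · norm_num
    split_ifs <;> grind

theorem antitone_ite_lt (x : ℝ) : Antitone fun s : ℝ => if s < x then (1 : ℝ) else 0 := by
  intro s s' h
  dsimp only
  split_ifs <;> linarith

theorem antitone_ite_le (x : ℝ) : Antitone fun s : ℝ => if s ≤ x then (1 : ℝ) else 0 := by
  intro s s' h
  dsimp only
  split_ifs <;> linarith

theorem ite_mem_Icc (p : Prop) [Decidable p] : (if p then (1 : ℝ) else 0) ∈ Icc (0 : ℝ) 1 := by
  split_ifs <;> simp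

variable {X : Type*} [NormedAddCommGroup X] [InnerProductSpace ℂ X] [CompleteSpace X]

theorem V2Le.window_smul (ε a t : ℝ) {r : ℝ → X} {R : ℝ} (hr : V2Le r R) :
    V2Le (fun s => window ε a t s • r s) (6 * R) :=
  hr.smul_cutoff (antitone_ite_le _) (antitone_ite_lt _) (fun _ => ite_mem_Icc _)
    fun _ => ite_mem_Icc _

/-- As `t` moves along a partition both edges of the window move monotonically. `V2Le.step` handles
each edge with constant 3. -/
theorem V2Le.sum_window_sub_smul (ε a : ℝ) {t : ℕ → ℝ} (ht : Monotone t) (m : ℕ) (y : ℕ → X)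
    {R : ℝ} (hR : 0 ≤ R) (hy : ∑ k ∈ Finset.range m, ‖y k‖ ^ 2 ≤ R ^ 2) :
    V2Le (fun s => ∑ k ∈ Finset.range m, (window ε a (t (k + 1)) s - window ε a (t k) s) • y k)
      (6 * R) := by
  have h1 := V2Le.step (χ := fun k s => if s < t k + (1 - ε) / 2 * a then (1 : ℝ) else 0)
    (fun k => antitone_ite_lt _) (fun s k k' h => by
      have := ht h
      dsimp only
      split_ifs <;> linarith) (fun _ _ => ite_mem_Icc _) m y hR hy
  have h2 := V2Le.step (χ := fun k s => if s ≤ t k - (1 + ε) / 2 * a then (1 : ℝ) else 0)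
    (fun k => antitone_ite_le _) (fun s k k' h => by
      have := ht h
      dsimp only
      split_ifs <;> linarith) (fun _ _ => ite_mem_Icc _) m y hR hy
  refine ((h1.sub h2).mono (by linarith)).congr fun s _ => ?_
  dsimp only
  rw [← Finset.sum_sub_distrib]
  refine Finset.sum_congr rfl fun k _ => ?_
  rw [← sub_smul]
  congr 1
  unfold window
  ring

end Window

/-! ### Layer cake representation of the cut-off semigroup and the basic kernel estimate. -/

section Layers

variable {X : Type*} [NormedAddCommGroup X] [InnerProductSpace ℂ X] [CompleteSpace X]
variable {κ c : ℕ → ℝ → ℝ} {ε : ℝ}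

/-- The norm of the density at `σ`. -/
noncomputable def layerBound (A σ : ℝ) : ℝ := 8 * (A * (768 * Real.exp 6 * Real.exp (-σ / 2)))

theorem cfc_exp_mul {B : X →L[ℂ] X} (hB : IsSelfAdjoint B) (r : ℝ) :
    cfc (fun ξ => Real.exp (r * ξ)) B = NormedSpace.exp (r • B) := by
  have h := cfc_comp_smul r Real.exp B Real.continuous_exp.continuousOn hB
  simp only [smul_eq_mul] at h
  rw [h, CFC.real_exp_eq_normedSpace_exp (IsSelfAdjoint.smul (IsSelfAdjoint.all r) hB)]

/-- `c_j(B) e^{ε σ 2^{-j} B}`. -/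
noncomputable def cutoffSemigroup (c : ℕ → ℝ → ℝ) (ε : ℝ) (B : X →L[ℂ] X) (j : ℕ) (σ : ℝ) :
    X →L[ℂ] X :=
  cfc (c j) B * NormedSpace.exp (σ • ((ε * (2 ^ j)⁻¹) • B))

theorem hasDerivAt_cutoffSemigroup (c : ℕ → ℝ → ℝ) (ε : ℝ) (B : X →L[ℂ] X) (j : ℕ) (σ : ℝ) :
    HasDerivAt (cutoffSemigroup c ε B j)
      (cutoffSemigroup c ε B j σ * ((ε * (2 ^ j)⁻¹) • B)) σ := by
  have := (hasDerivAt_exp_smul_const (𝕂 := ℝ) ((ε * (2 ^ j)⁻¹) • B) σ).const_mul (cfc (c j) B)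
  rw [← mul_assoc] at this
  exact this

theorem cutoffSemigroup_eq_cfc (hc : IsHalfCutoff κ c ε) {B : X →L[ℂ] X} (hB : IsSelfAdjoint B)
    (j : ℕ) (σ : ℝ) : cutoffSemigroup c ε B j σ =
      cfc (fun ξ => c j ξ * Real.exp (ε * σ * ((2 ^ j)⁻¹ * ξ))) B := by
  have h : ∀ ξ, ε * σ * ((2 ^ j)⁻¹ * ξ) = (σ * (ε * (2 ^ j)⁻¹)) * ξ := fun ξ => by ring
  simp only [h]
  rw [cfc_mul _ _ B (hc.smooth j).continuous.continuousOn (by fun_prop), cfc_exp_mul hB, mul_smul]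
  rfl

/-- The right side is minus the `σ`-derivative of `cutoffSemigroup`; the layer is designed for this.
-/
theorem cfc_layer_of_le (hc : IsHalfCutoff κ c ε) {B : X →L[ℂ] X} (hB : IsSelfAdjoint B) {j : ℕ}
    {σ : ℝ} (h : j ≠ 0 ∨ σ ≤ 1) : cfc (layer c ε σ j) B =
      -(cutoffSemigroup c ε B j σ * ((ε * (2 ^ j)⁻¹) • B)) := by
  have hcont := (hc.smooth j).continuous
  have e : layer c ε σ j = fun ξ =>
      -((c j ξ * Real.exp (ε * σ * ((2 ^ j)⁻¹ * ξ))) * ((ε * (2 ^ j)⁻¹) * ξ)) := by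
    ext ξ; rw [layer, if_pos h]; ring
  rw [e, cfc_neg, cfc_mul _ _ B (by fun_prop) (by fun_prop), ← cutoffSemigroup_eq_cfc hc hB,
    cfc_const_mul_id _ B hB]

theorem cfc_layer_of_gt (hc : IsHalfCutoff κ c ε) {B : X →L[ℂ] X} (hB : IsSelfAdjoint B)
    {σ : ℝ} (h1 : 1 < σ) (h2 : σ ≤ 2) :
    cfc (layer c ε σ 0) B = cutoffSemigroup c ε B 0 1 := by
  rw [cutoffSemigroup_eq_cfc hc hB]
  congr 1
  ext ξ
  rw [layer, if_neg (by simpa using h1), if_pos h2]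
  simp

theorem cfc_layer_of_gt_two {B : X →L[ℂ] X} {σ : ℝ} (h : 2 < σ) :
    cfc (layer c ε σ 0) B = 0 := by
  have : layer c ε σ 0 = fun _ => 0 := by
    ext ξ
    rw [layer, if_neg (by simp; linarith), if_neg (by linarith)]
  rw [this, cfc_const_zero]

theorem continuous_cutoffSemigroup (c : ℕ → ℝ → ℝ) (ε : ℝ) (B : X →L[ℂ] X) (j : ℕ) :
    Continuous (cutoffSemigroup c ε B j) :=
  continuous_iff_continuousAt.2 fun σ => (hasDerivAt_cutoffSemigroup c ε B j σ).continuousAt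

theorem stronglyMeasurable_cfc_layer (hc : IsHalfCutoff κ c ε) {B : X →L[ℂ] X}
    (hB : IsSelfAdjoint B) (j : ℕ) :
    StronglyMeasurable fun σ => cfc (layer c ε σ j) B := by
  have h1 : StronglyMeasurable fun σ => -(cutoffSemigroup c ε B j σ * ((ε * (2 ^ j)⁻¹) • B)) :=
    ((continuous_cutoffSemigroup c ε B j).mul continuous_const).neg.stronglyMeasurable
  by_cases hj : j = 0
  · subst hj
    have : (fun σ => cfc (layer c ε σ 0) B) = fun σ =>
        if σ ∈ Iic (1 : ℝ) then -(cutoffSemigroup c ε B 0 σ * ((ε * (2 ^ 0)⁻¹) • B))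
        else if σ ∈ Iic (2 : ℝ) then cutoffSemigroup c ε B 0 1 else 0 := by
      ext1 σ
      simp only [mem_Iic]
      split_ifs with h h'
      · exact cfc_layer_of_le hc hB (Or.inr h)
      · exact cfc_layer_of_gt hc hB (not_le.1 h) h'
      · exact cfc_layer_of_gt_two (not_le.1 h')
    rw [this]
    exact h1.ite measurableSet_Iic (stronglyMeasurable_const.ite measurableSet_Iic
      stronglyMeasurable_const)
  · simpa only [cfc_layer_of_le hc hB (Or.inl hj)] using h1

theorem integrableOn_one_add_mul_exp :
    IntegrableOn (fun σ : ℝ => (1 + σ) * Real.exp (-σ / 2)) (Ioi 0) := by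
  have h := (integrableOn_exp_mul_Ioi (a := -(1 / 4)) (by norm_num) 0).const_mul 4
  refine Integrable.mono' h (by fun_prop) ((ae_restrict_iff' measurableSet_Ioi).2
    (.of_forall fun σ hσ => ?_))
  have hσ' : 0 < σ := hσ
  rw [Real.norm_of_nonneg (by positivity)]
  have h1 : 1 + σ ≤ 4 * Real.exp (σ / 4) := by
    have := Real.add_one_le_exp (σ / 4); linarith
  calc (1 + σ) * Real.exp (-σ / 2) ≤ 4 * Real.exp (σ / 4) * Real.exp (-σ / 2) := by gcongr
    _ = _ := by rw [mul_assoc, ← Real.exp_add]; congr 2; ring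

theorem integrableOn_one_add_mul_layerBound (A : ℝ) :
    IntegrableOn (fun σ : ℝ => layerBound A σ * (1 + σ)) (Ioi 0) := by
  refine (integrableOn_one_add_mul_exp.const_mul (8 * (A * (768 * Real.exp 6)))).congr
    (.of_forall fun σ => ?_)
  simp only [layerBound]; ring

theorem integrableOn_layerBound (A : ℝ) : IntegrableOn (layerBound A) (Ioi 0) := by
  have h : IntegrableOn (fun σ : ℝ => Real.exp (-(1 / 2) * σ)) (Ioi 0) :=
    integrableOn_exp_mul_Ioi (a := -(1 / 2)) (by norm_num) 0
  refine (h.const_mul (8 * (A * (768 * Real.exp 6)))).congr (.of_forall fun σ => ?_)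
  simp only [layerBound]
  rw [show -(1 / 2) * σ = -σ / 2 by ring]; ring

theorem layerBound_nonneg {A : ℝ} (hA : 0 ≤ A) (σ : ℝ) : 0 ≤ layerBound A σ := by
  unfold layerBound; positivity

/-- `b` is self-adjoint and Lipschitz relative to itself. -/
structure IsRelLipschitz (b : ℝ → X →L[ℂ] X) (C : ℝ) : Prop where
  nonneg : 0 ≤ C
  selfAdjoint : ∀ t, IsSelfAdjoint (b t)
  lip : ∀ t s x, ‖(b t - b s) x‖ ≤ C * |t - s| * (‖b s x‖ + ‖x‖)

namespace HalfPartition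

variable {A : ℝ}

theorem nonneg (hp : HalfPartition κ c ε A) : 0 ≤ A := zero_le_one.trans hp.one_le

theorem isDyadicFamily_layer (hp : HalfPartition κ c ε A) {σ : ℝ} (hσ : 0 ≤ σ) :
    IsDyadicFamily κ (layer c ε σ) (layerBound A σ) :=
  _root_.isDyadicFamily_layer hp.part hp.one_le hp.cutoff hp.scale hσ

theorem isDyadicFamily (hp : HalfPartition κ c ε A) : IsDyadicFamily κ c A :=
  hp.cutoff.isDyadicFamily hp.one_le hp.scale

theorem norm_cfc_layer_le (hp : HalfPartition κ c ε A) {σ : ℝ} (hσ : 0 ≤ σ) (j : ℕ)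
    {B : X →L[ℂ] X} (hB : IsSelfAdjoint B) : ‖cfc (layer c ε σ j) B‖ ≤ layerBound A σ :=
  ContinuousLinearMap.opNorm_le_bound _ (layerBound_nonneg hp.nonneg σ) fun x =>
    norm_cfc_apply_le ((hp.isDyadicFamily_layer hσ).smooth j).continuous
      (layerBound_nonneg hp.nonneg σ) ((hp.isDyadicFamily_layer hσ).abs_le' hp.part j) hB x

theorem integrableOn_cfc_layer (hp : HalfPartition κ c ε A) (j : ℕ)
    {B : X →L[ℂ] X} (hB : IsSelfAdjoint B) :
    IntegrableOn (fun σ => cfc (layer c ε σ j) B) (Ioi 0) :=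
  (integrableOn_layerBound A).mono' (stronglyMeasurable_cfc_layer hp.cutoff hB j).aestronglyMeasurable
    ((ae_restrict_iff' measurableSet_Ioi).2
      (.of_forall fun _ hσ => hp.norm_cfc_layer_le (le_of_lt hσ) j hB))

theorem norm_cutoffSemigroup_le (hp : HalfPartition κ c ε A) {j : ℕ} (hj : j ≠ 0) {σ : ℝ}
    (hσ : 0 ≤ σ) {B : X →L[ℂ] X} (hB : IsSelfAdjoint B) :
    ‖cutoffSemigroup c ε B j σ‖ ≤ Real.exp (-σ) := by
  refine ContinuousLinearMap.opNorm_le_bound _ (Real.exp_pos _).le fun x => ?_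
  rw [cutoffSemigroup_eq_cfc hp.cutoff hB]
  refine norm_cfc_apply_le ((hp.cutoff.smooth j).continuous.mul (by fun_prop)) (Real.exp_pos _).le
    (fun ξ => ?_) hB x
  rw [Pi.mul_apply]
  by_cases h : c j ξ = 0
  · rw [h, zero_mul, abs_zero]; exact (Real.exp_pos _).le
  · rw [abs_mul, abs_of_pos (Real.exp_pos _)]
    have h1 := (hp.cutoff.abs_le j ξ).trans (hp.part.abs_le_one j ξ)
    have h2 := hp.cutoff.half j ξ hj h
    have h3 : ε * σ * ((2 ^ j)⁻¹ * ξ) ≤ -σ := by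
      have : ε * σ * ((2 ^ j)⁻¹ * ξ) = σ * ((2 ^ j)⁻¹ * (ε * ξ)) := by ring
      rw [this]
      have h4 : (2 ^ j : ℝ)⁻¹ * (ε * ξ) ≤ (2 ^ j)⁻¹ * -2 ^ j := by gcongr
      rw [mul_neg, inv_mul_cancel₀ (by positivity)] at h4
      nlinarith
    calc _ ≤ 1 * Real.exp (-σ) := mul_le_mul h1 (Real.exp_le_exp.2 h3) (Real.exp_pos _).le one_pos.le
      _ = _ := one_mul _

/-- The fundamental theorem of calculus in `σ`. For `j ≠ 0` the semigroup decays and there is no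
term at infinity. For `j = 0` it may grow, so the derivative is used only up to `σ = 1`, and the
constant layer on `1 < σ ≤ 2` supplies the missing end value. This is where `τ ≤ 1` enters. -/
theorem integral_cfc_layer (hp : HalfPartition κ c ε A) (j : ℕ) {B : X →L[ℂ] X}
    (hB : IsSelfAdjoint B) {τ : ℝ} (h0 : 0 < τ) (h1 : τ ≤ 1) :
    ∫ σ in Ioi (2 ^ j * τ), cfc (layer c ε σ j) B = cutoffSemigroup c ε B j (2 ^ j * τ) := by
  have hint := hp.integrableOn_cfc_layer j hB
  by_cases hj : j = 0
  · subst hj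
    rw [pow_zero, one_mul]
    have hint1 : IntegrableOn (fun σ => cfc (layer c ε σ 0) B) (Ioi τ) :=
      hint.mono_set (Ioi_subset_Ioi h0.le)
    have hint2 : IntegrableOn (fun σ => cfc (layer c ε σ 0) B) (Ioi 1) :=
      hint.mono_set (Ioi_subset_Ioi zero_le_one)
    have e1 := intervalIntegral.integral_interval_add_Ioi hint1 hint2
    have e2 := intervalIntegral.integral_interval_add_Ioi hint2
      (hint2.mono_set (Ioi_subset_Ioi one_le_two))
    have e3 : ∫ σ in Ioi (2 : ℝ), cfc (layer c ε σ 0) B = 0 := by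
      rw [setIntegral_congr_fun (g := fun _ => (0 : X →L[ℂ] X)) measurableSet_Ioi
        fun σ hσ => cfc_layer_of_gt_two hσ, integral_zero]
    have e4 : ∫ σ in (1 : ℝ)..2, cfc (layer c ε σ 0) B = cutoffSemigroup c ε B 0 1 := by
      rw [intervalIntegral.integral_of_le one_le_two,
        setIntegral_congr_fun (g := fun _ => cutoffSemigroup c ε B 0 1) measurableSet_Ioc
        fun σ hσ => cfc_layer_of_gt hp.cutoff hB hσ.1 hσ.2]
      norm_num
    have e5 : ∫ σ in τ..1, cfc (layer c ε σ 0) B =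
        cutoffSemigroup c ε B 0 τ - cutoffSemigroup c ε B 0 1 := by
      have hcongr : ∀ σ ∈ uIcc τ 1, cfc (layer c ε σ 0) B =
          -(cutoffSemigroup c ε B 0 σ * ((ε * (2 ^ 0)⁻¹) • B)) := fun σ hσ => by
        rw [uIcc_of_le h1] at hσ
        exact cfc_layer_of_le hp.cutoff hB (Or.inr hσ.2)
      rw [intervalIntegral.integral_congr hcongr, intervalIntegral.integral_neg,
        intervalIntegral.integral_eq_sub_of_hasDerivAt
          (fun σ _ => hasDerivAt_cutoffSemigroup c ε B 0 σ)
          (((continuous_cutoffSemigroup c ε B 0).mul continuous_const).intervalIntegrable _ _),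
        neg_sub]
    rw [← e1, ← e2, e3, e4, e5]
    abel
  · have hτ : 0 < 2 ^ j * τ := by positivity
    have hint1 : IntegrableOn (fun σ => -cfc (layer c ε σ j) B) (Ioi (2 ^ j * τ)) :=
      (hint.mono_set (Ioi_subset_Ioi hτ.le)).neg
    have hd : ∀ σ, HasDerivAt (cutoffSemigroup c ε B j) (-cfc (layer c ε σ j) B) σ := fun σ => by
      rw [cfc_layer_of_le hp.cutoff hB (Or.inl hj), neg_neg]
      exact hasDerivAt_cutoffSemigroup c ε B j σ
    have ht : Filter.Tendsto (cutoffSemigroup c ε B j) Filter.atTop (nhds 0) := by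
      refine squeeze_zero_norm' (a := fun σ => Real.exp (-σ)) ?_
        (Real.tendsto_exp_atBot.comp Filter.tendsto_neg_atTop_atBot)
      filter_upwards [Filter.eventually_ge_atTop 0] with σ hσ
      exact hp.norm_cutoffSemigroup_le hj hσ hB
    have := integral_Ioi_of_hasDerivAt_of_tendsto' (fun σ _ => hd σ) hint1 ht
    rw [integral_neg, zero_sub, neg_inj] at this
    exact this

/-- The operators `e^{(t-s)B(s)} c_j(B(s))` for `0 < ε (t - s)`, and zero otherwise. -/
noncomputable def _root_.halfSemigroup (c : ℕ → ℝ → ℝ) (ε : ℝ) (b : ℝ → X →L[ℂ] X) (j : ℕ)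
    (t s : ℝ) : X →L[ℂ] X :=
  if 0 < ε * (t - s) then cfc (fun ξ : ℝ => Real.exp ((t - s) * ξ)) (b s) * cfc (c j) (b s) else 0

/-- The condition `σ > 2^j ε(t - s)` is read as a condition on `s`, namely that it lie in a window
of length `2^{-j}σ` next to `t`. The variable `t` then occurs only in the window, and the operator
depends only on `b(s)`. -/
theorem halfSemigroup_apply_eq_integral (hp : HalfPartition κ c ε A) {b : ℝ → X →L[ℂ] X} {s t : ℝ}
    (hB : IsSelfAdjoint (b s)) (hs : s ∈ Icc (0 : ℝ) 1) (ht : t ∈ Icc (0 : ℝ) 1) (j : ℕ) (y : X) :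
    IntegrableOn (fun σ => cfc (layer c ε σ j) (b s) (window ε ((2 ^ j)⁻¹ * σ) t s • y)) (Ioi 0) ∧
    halfSemigroup c ε b j t s y =
      ∫ σ in Ioi 0, cfc (layer c ε σ j) (b s) (window ε ((2 ^ j)⁻¹ * σ) t s • y) := by
  have hint := hp.integrableOn_cfc_layer j hB
  have hwin : ∀ σ ∈ Ioi (0 : ℝ), window ε ((2 ^ j)⁻¹ * σ) t s =
      if 0 < ε * (t - s) ∧ 2 ^ j * (ε * (t - s)) < σ then 1 else 0 := fun σ hσ => by
    have hσ' : 0 < σ := hσ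
    rw [window_eq hp.cutoff.sign (by positivity)]
    congr 2
    rw [inv_mul_eq_div, lt_div_iff₀ (by positivity), mul_comm]
  unfold halfSemigroup
  split_ifs with h
  · have hε2 : ε * ε = 1 := by rcases hp.cutoff.sign with h | h <;> simp [h]
    have hτ1 : ε * (t - s) ≤ 1 := by
      rcases hp.cutoff.sign with h | h <;> rw [h] <;> linarith [hs.1, hs.2, ht.1, ht.2]
    have hpos : 0 < 2 ^ j * (ε * (t - s)) := by positivity
    have hEq : EqOn (fun σ => cfc (layer c ε σ j) (b s) (window ε ((2 ^ j)⁻¹ * σ) t s • y))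
        ((Ioi (2 ^ j * (ε * (t - s)))).indicator fun σ => cfc (layer c ε σ j) (b s) y) (Ioi 0) := by
      intro σ hσ
      dsimp only
      rw [hwin σ hσ, indicator_apply]
      by_cases h' : 2 ^ j * (ε * (t - s)) < σ
      · simp [h, h']
      · simp [h']
    have hint2 : IntegrableOn (fun σ => cfc (layer c ε σ j) (b s) y) (Ioi 0) :=
      hint.apply_continuousLinearMap y
    constructor
    · exact (hint2.indicator measurableSet_Ioi).congr_fun hEq.symm measurableSet_Ioi
    · rw [setIntegral_congr_fun measurableSet_Ioi hEq, setIntegral_indicator measurableSet_Ioi,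
        Ioi_inter_Ioi, max_eq_right hpos.le,
        ← ContinuousLinearMap.integral_apply (hint.mono_set (Ioi_subset_Ioi hpos.le)),
        hp.integral_cfc_layer j hB h hτ1, cfc_exp_mul hB]
      unfold cutoffSemigroup
      have e : (2 ^ j * (ε * (t - s))) • ((ε * (2 ^ j)⁻¹) • b s) = (t - s) • b s := by
        rw [smul_smul]
        congr 1
        calc _ = (2 ^ j * (2 ^ j)⁻¹) * (ε * ε) * (t - s) := by ring
          _ = _ := by rw [hε2, mul_inv_cancel₀ (by positivity)]; ring
      rw [e, ← cfc_exp_mul hB, (cfc_commute_cfc (c j) _ (b s)).eq]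
  · have hEq : EqOn (fun σ => cfc (layer c ε σ j) (b s) (window ε ((2 ^ j)⁻¹ * σ) t s • y))
        (fun _ => 0) (Ioi 0) := by
      intro σ hσ
      dsimp only
      rw [hwin σ hσ]
      simp [h]
    constructor
    · exact (integrableOn_zero).congr_fun hEq.symm measurableSet_Ioi
    · rw [setIntegral_congr_fun measurableSet_Ioi hEq, integral_zero]
      rfl

theorem norm_sum_cfc_layer_sq_le (hp : HalfPartition κ c ε A) {B : X →L[ℂ] X}
    (hB : IsSelfAdjoint B) {σ : ℝ} (hσ : 0 ≤ σ) (J : ℕ) (w : ℕ → X) :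
    ‖∑ j ∈ Finset.range J, cfc (layer c ε σ j) B (w j)‖ ^ 2 ≤
      layerBound A σ ^ 2 * ∑ j ∈ Finset.range J, ‖w j‖ ^ 2 :=
  norm_sum_apply_sq_le _ (fun _ _ => isSelfAdjoint_cfc _ _)
    (fun x => (hp.isDyadicFamily_layer hσ).sum_norm_sq_le hp.part _ hB x) w

theorem sum_norm_cfc_sub_sq_le (hp : HalfPartition κ c ε A) {b : ℝ → X →L[ℂ] X} {C : ℝ}
    (hb : IsRelLipschitz b C) {μ : ℕ → ℝ → ℝ} {a : ℝ} (hμ : IsDyadicFamily κ μ a) (J : ℕ)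
    (t s : ℝ) (x : X) :
    ∑ j ∈ Finset.range J, ‖(cfc (μ j) (b t) - cfc (μ j) (b s)) x‖ ^ 2 ≤
      (20480 * A * a * (C * |t - s|)) ^ 2 * ‖x‖ ^ 2 :=
  _root_.sum_norm_cfc_sub_sq_le hp.part hp.one_le hp.family hμ (hb.selfAdjoint s)
    (hb.selfAdjoint t) (mul_nonneg hb.nonneg (abs_nonneg _)) (hb.lip t s)
    (by rw [abs_sub_comm]; exact hb.lip s t) J x

theorem norm_sum_cfc_layer_sub_sq_le (hp : HalfPartition κ c ε A) {b : ℝ → X →L[ℂ] X} {C : ℝ}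
    (hb : IsRelLipschitz b C) {σ : ℝ} (hσ : 0 ≤ σ) (J : ℕ) (t s : ℝ) (w : ℕ → X) :
    ‖∑ j ∈ Finset.range J, (cfc (layer c ε σ j) (b t) - cfc (layer c ε σ j) (b s)) (w j)‖ ^ 2 ≤
      (20480 * A * layerBound A σ * (C * |t - s|)) ^ 2 * ∑ j ∈ Finset.range J, ‖w j‖ ^ 2 :=
  norm_sum_apply_sq_le _ (fun _ _ => (isSelfAdjoint_cfc _ _).sub (isSelfAdjoint_cfc _ _))
    (fun x => hp.sum_norm_cfc_sub_sq_le hb (hp.isDyadicFamily_layer hσ) J t s x) w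

/-- The constant in the `V²` bounds for the kernel. -/
noncomputable def _root_.kernelConst (A C : ℝ) : ℝ :=
  ∫ σ in Ioi 0, 4 * (1 + 20480 * A * C) * (layerBound A σ * (1 + σ))

theorem _root_.kernelConst_nonneg {A C : ℝ} (hA : 0 ≤ A) (hC : 0 ≤ C) : 0 ≤ kernelConst A C :=
  setIntegral_nonneg measurableSet_Ioi fun σ hσ => by
    have : 0 < σ := hσ
    have := layerBound_nonneg hA σ
    positivity

/-- The basic `V²` estimate for superpositions of the kernel. -/
theorem v2Le_sum_halfSemigroup (hp : HalfPartition κ c ε A) {b : ℝ → X →L[ℂ] X} {C : ℝ}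
    (hb : IsRelLipschitz b C) (J : ℕ) {ι : Type*} (I : Finset ι) {T : ι → ℝ}
    (hT : ∀ i ∈ I, T i ∈ Icc (0 : ℝ) 1) {y : ι → ℕ → ℝ → X} {R : ℝ} (hR : 0 ≤ R) {k : ℕ → ℝ}
    (hk : ∑ j ∈ Finset.range J, k j ^ 2 ≤ R ^ 2)
    (hy : ∀ σ, 0 < σ → ∀ j < J, V2Le (fun s => ∑ i ∈ I, window ε ((2 ^ j)⁻¹ * σ) (T i) s • y i j s)
      (k j * (1 + σ))) :
    V2Le (fun s => ∑ i ∈ I, ∑ j ∈ Finset.range J, halfSemigroup c ε b j (T i) s (y i j s))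
      (kernelConst A C * R) := by
  have hA := hp.nonneg
  have hC := hb.nonneg
  have hrep := fun i (hi : i ∈ I) s (hs : s ∈ Icc (0 : ℝ) 1) j =>
    hp.halfSemigroup_apply_eq_integral (hb.selfAdjoint s) hs (hT i hi) j (y i j s)
  have hsum : ∀ s σ, (∑ j ∈ Finset.range J, cfc (layer c ε σ j) (b s)
      (∑ i ∈ I, window ε ((2 ^ j)⁻¹ * σ) (T i) s • y i j s)) = ∑ i ∈ I, ∑ j ∈ Finset.range J,
      cfc (layer c ε σ j) (b s) (window ε ((2 ^ j)⁻¹ * σ) (T i) s • y i j s) := fun s σ => by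
    rw [Finset.sum_comm]
    simp only [map_sum]
  have hV : V2Le (fun s => ∫ σ in Ioi 0, ∑ j ∈ Finset.range J, cfc (layer c ε σ j) (b s)
      (∑ i ∈ I, window ε ((2 ^ j)⁻¹ * σ) (T i) s • y i j s))
      (∫ σ in Ioi 0, 4 * (1 + 20480 * A * C) * (layerBound A σ * (1 + σ)) * R) := by
    refine V2Le.integral (fun s hs => ?_) ((ae_restrict_iff' measurableSet_Ioi).2
      (.of_forall fun σ hσ => ?_))
      (((integrableOn_one_add_mul_layerBound A).const_mul _).mul_const R)
    · simp only [hsum]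
      exact integrable_finsetSum _ fun i hi => integrable_finsetSum _ fun j _ =>
        (hrep i hi s hs j).1
    · have hσ' : 0 < σ := hσ
      have hL := layerBound_nonneg hA σ
      -- At a fixed `σ` both the `ℓ²` synthesis bound and its Lipschitz constant in `s` are at most
      -- `a`. The inputs may grow like `1 + σ`, which the error kernel needs and the exponential
      -- decay of `layerBound` tolerates.
      have key := V2Le.synthesis (Finset.range J)
        (M := fun j s => cfc (layer c ε σ j) (b s)) (a := layerBound A σ * (1 + 20480 * A * C))
        (by positivity) (fun s _ w => ?_) (fun s _ s' _ w => ?_) (k := fun j => k j * (1 + σ))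
        (R := R * (1 + σ)) (fun j hj => hy σ hσ j (Finset.mem_range.1 hj)) (by positivity) ?_
      · exact key.mono (le_of_eq (by ring))
      · refine (hp.norm_sum_cfc_layer_sq_le (hb.selfAdjoint s) hσ'.le J w).trans ?_
        gcongr
        exact le_mul_of_one_le_right hL (by linarith [(by positivity : 0 ≤ 20480 * A * C)])
      · refine (hp.norm_sum_cfc_layer_sub_sq_le hb hσ'.le J s' s w).trans ?_
        have : 20480 * A * layerBound A σ * (C * |s' - s|) ≤
            layerBound A σ * (1 + 20480 * A * C) * |s' - s| := by
          have : 0 ≤ layerBound A σ * |s' - s| := by positivity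
          linarith
        gcongr
      · simp only [mul_pow, ← Finset.sum_mul]
        gcongr
  rw [integral_mul_const] at hV
  refine hV.congr fun s hs => ?_
  simp only [hsum]
  rw [integral_finsetSum _ fun i hi => integrable_finsetSum _ fun j _ => (hrep i hi s hs j).1]
  refine Finset.sum_congr rfl fun i hi => ?_
  rw [integral_finsetSum _ fun j _ => (hrep i hi s hs j).1]
  exact Finset.sum_congr rfl fun j _ => (hrep i hi s hs j).2.symm

end HalfPartition

end Layers

/-! ### Variation bounds for one half of the adjoint kernel and for the commutator term. -/

section HalfKernel

variable {X : Type*} [NormedAddCommGroup X] [InnerProductSpace ℂ X] [CompleteSpace X]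
variable {κ c : ℕ → ℝ → ℝ} {ε : ℝ}

/-- One half of the adjoint kernel of the parametrix along the flow. -/
noncomputable def halfKernel (c : ℕ → ℝ → ℝ) (ε : ℝ) (b : ℝ → X →L[ℂ] X) (J : ℕ) (t s : ℝ) :
    X →L[ℂ] X :=
  ∑ j ∈ Finset.range J, halfSemigroup c ε b j t s * cfc (c j) (b t)

theorem halfKernel_apply (c : ℕ → ℝ → ℝ) (ε : ℝ) (b : ℝ → X →L[ℂ] X) (J : ℕ) (t s : ℝ) (x : X) :
    halfKernel c ε b J t s x =
      ∑ j ∈ Finset.range J, halfSemigroup c ε b j t s (cfc (c j) (b t) x) := by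
  simp [halfKernel, sum_apply, mul_apply_eq_comp]

namespace HalfPartition

variable {A : ℝ} {b : ℝ → X →L[ℂ] X} {C : ℝ}

theorem v2Le_sum_halfSemigroup_const (hp : HalfPartition κ c ε A) (hb : IsRelLipschitz b C)
    (J : ℕ) {t : ℝ} (ht : t ∈ Icc (0 : ℝ) 1) {y : ℕ → X} {R : ℝ} (hR : 0 ≤ R)
    (hy : ∑ j ∈ Finset.range J, ‖y j‖ ^ 2 ≤ R ^ 2) :
    V2Le (fun s => ∑ j ∈ Finset.range J, halfSemigroup c ε b j t s (y j))
      (6 * kernelConst A C * R) := by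
  have := hp.v2Le_sum_halfSemigroup hb J {()} (T := fun _ => t) (fun _ _ => ht)
    (y := fun _ j _ => y j) (R := 6 * R) (by positivity) (k := fun j => 6 * ‖y j‖)
    (by simp only [mul_pow, ← Finset.mul_sum]; gcongr)
    (fun σ hσ j _ => by
      simp only [Finset.sum_singleton]
      refine (V2Le.window_smul _ _ _ (V2Le.const (y j))).mono ?_
      nlinarith [norm_nonneg (y j)])
  simp only [Finset.sum_singleton] at this
  exact this.mono (le_of_eq (by ring))

theorem v2Le_halfKernel (hp : HalfPartition κ c ε A) (hb : IsRelLipschitz b C)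
    (J : ℕ) {t : ℝ} (ht : t ∈ Icc (0 : ℝ) 1) (x : X) :
    V2Le (fun s => halfKernel c ε b J t s x) (6 * kernelConst A C * A * ‖x‖) := by
  simp only [halfKernel_apply]
  refine (hp.v2Le_sum_halfSemigroup_const hb J ht (R := A * ‖x‖)
    (mul_nonneg hp.nonneg (norm_nonneg _)) ?_).mono (le_of_eq (by ring))
  rw [mul_pow]
  exact hp.isDyadicFamily.sum_norm_sq_le hp.part _ (hb.selfAdjoint t) x

/-- Product rule in `t`. With `c_j(b(t_k))` frozen only the windows move, and
`V2Le.sum_window_sub_smul` applies for each `j`. The change of `c_j(b(t))` is Lipschitz in `t`, so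
those terms may be summed in `k` by the triangle inequality. -/
theorem v2Le_sum_halfKernel_sub (hp : HalfPartition κ c ε A) (hb : IsRelLipschitz b C)
    (J : ℕ) {t : ℕ → ℝ} (ht : Monotone t) (ht' : ∀ k, t k ∈ Icc (0 : ℝ) 1) (m : ℕ) (w : ℕ → X)
    {R : ℝ} (hR : 0 ≤ R) (hw : ∑ k ∈ Finset.range m, ‖w k‖ ^ 2 ≤ R ^ 2) :
    V2Le (fun s => ∑ k ∈ Finset.range m,
      (halfKernel c ε b J (t (k + 1)) s (w k) - halfKernel c ε b J (t k) s (w k)))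
      (6 * kernelConst A C * A * (1 + 20480 * A * C) * R) := by
  have hA := hp.nonneg
  have hC := hb.nonneg
  have hK := kernelConst_nonneg hA hC
  set z : ℕ → ℕ → X := fun k j => cfc (c j) (b (t k)) (w k) with hz
  have hz2 : ∑ j ∈ Finset.range J, ∑ k ∈ Finset.range m, ‖z k j‖ ^ 2 ≤ (A * R) ^ 2 := by
    rw [Finset.sum_comm, mul_pow]
    calc _ ≤ ∑ k ∈ Finset.range m, A ^ 2 * ‖w k‖ ^ 2 := Finset.sum_le_sum fun k _ =>
          hp.isDyadicFamily.sum_norm_sq_le hp.part _ (hb.selfAdjoint _) _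
      _ ≤ A ^ 2 * R ^ 2 := by rw [← Finset.mul_sum]; gcongr
  have h1 : V2Le (fun s => ∑ k ∈ Finset.range m, ∑ j ∈ Finset.range J,
      (halfSemigroup c ε b j (t (k + 1)) s (z k j) - halfSemigroup c ε b j (t k) s (z k j)))
      (kernelConst A C * (6 * (A * R))) := by
    -- The Boolean distinguishes the two ends of a partition interval: `true` carries `z k j` at `t
    -- (k + 1)`, `false` carries `-z k j` at `t k`.
    have := hp.v2Le_sum_halfSemigroup hb J (Finset.range m ×ˢ (Finset.univ : Finset Bool))
      (T := fun i => if i.2 then t (i.1 + 1) else t i.1)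
      (fun i _ => by split_ifs <;> exact ht' _)
      (y := fun i j _ => if i.2 then z i.1 j else -z i.1 j) (R := 6 * (A * R)) (by positivity)
      (k := fun j => 6 * √(∑ k ∈ Finset.range m, ‖z k j‖ ^ 2)) ?_ (fun σ hσ j _ => ?_)
    · refine this.congr fun s _ => ?_
      dsimp only
      rw [Finset.sum_product]
      refine Finset.sum_congr rfl fun k _ => ?_
      simp only [Fintype.sum_bool, if_true, Bool.false_eq_true, if_false, map_neg,
        Finset.sum_neg_distrib, Finset.sum_sub_distrib]
      rw [sub_eq_add_neg]
    · have : ∀ j, √(∑ k ∈ Finset.range m, ‖z k j‖ ^ 2) ^ 2 = ∑ k ∈ Finset.range m, ‖z k j‖ ^ 2 :=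
        fun j => Real.sq_sqrt (by positivity)
      simp only [mul_pow, this, ← Finset.mul_sum] at hz2 ⊢
      linarith
    · have key := V2Le.sum_window_sub_smul ε ((2 ^ j)⁻¹ * σ) ht m (fun k => z k j)
        (Real.sqrt_nonneg _) (Real.sq_sqrt (by positivity)).ge
      refine (key.mono ?_).congr fun s _ => ?_
      · nlinarith [Real.sqrt_nonneg (∑ k ∈ Finset.range m, ‖z k j‖ ^ 2)]
      · dsimp only
        rw [Finset.sum_product]
        refine Finset.sum_congr rfl fun k _ => ?_
        simp only [Fintype.sum_bool, if_true, Bool.false_eq_true, if_false, smul_neg, sub_smul]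
        rw [sub_eq_add_neg]
  have h2 : V2Le (fun s => ∑ k ∈ Finset.range m, ∑ j ∈ Finset.range J,
      halfSemigroup c ε b j (t (k + 1)) s ((cfc (c j) (b (t (k + 1))) - cfc (c j) (b (t k))) (w k)))
      (∑ k ∈ Finset.range m, 6 * kernelConst A C *
        (20480 * A * A * (C * |t (k + 1) - t k|) * ‖w k‖)) := by
    refine V2Le.sum _ fun k _ => hp.v2Le_sum_halfSemigroup_const hb J (ht' _) (by positivity) ?_
    rw [mul_pow]
    exact hp.sum_norm_cfc_sub_sq_le hb hp.isDyadicFamily J _ _ _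
  -- Cauchy–Schwarz; the squares of the steps sum to at most 1.
  have h3 : ∑ k ∈ Finset.range m, |t (k + 1) - t k| * ‖w k‖ ≤ R := by
    have hd : ∀ k, 0 ≤ t (k + 1) - t k := fun k => sub_nonneg.2 (ht k.le_succ)
    have hs1 : ∑ k ∈ Finset.range m, |t (k + 1) - t k| ^ 2 ≤ 1 := by
      simp only [fun k => abs_of_nonneg (hd k)]
      refine (Finset.sum_sq_le_sq_sum_of_nonneg fun k _ => hd k).trans ?_
      rw [Finset.sum_range_sub]
      have h4 : t m - t 0 ≤ 1 := by linarith [(ht' m).2, (ht' 0).1]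
      exact pow_le_one₀ (sub_nonneg.2 (ht m.zero_le)) h4
    refine (abs_le_of_sq_le_sq' ?_ hR).2
    refine (Finset.sum_mul_sq_le_sq_mul_sq _ _ _).trans ?_
    calc _ ≤ 1 * R ^ 2 := by gcongr
      _ = _ := one_mul _
  have h4 : ∑ k ∈ Finset.range m, 6 * kernelConst A C *
        (20480 * A * A * (C * |t (k + 1) - t k|) * ‖w k‖) ≤
      6 * kernelConst A C * A * (20480 * A * C) * R := by
    have : ∀ k, 6 * kernelConst A C * (20480 * A * A * (C * |t (k + 1) - t k|) * ‖w k‖) =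
        6 * kernelConst A C * A * (20480 * A * C) * (|t (k + 1) - t k| * ‖w k‖) := fun k => by ring
    simp only [this, ← Finset.mul_sum]
    gcongr
  refine ((h1.add (h2.mono h4)).mono (le_of_eq (by ring))).congr fun s _ => ?_
  simp only [halfKernel_apply, ← Finset.sum_add_distrib, ← Finset.sum_sub_distrib, sub_apply,
    map_sub, hz]
  exact Finset.sum_congr rfl fun k _ => Finset.sum_congr rfl fun j _ => by abel

/-- On the window `|s - t| < 2^{-j}σ`, while `b(s) - b(t)` costs at most a multiple of `2^j|s - t|`
on the range of `c_j(b(t))`. The dyadic factors cancel and leave `σ`, which fits the growth allowed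
in the basic estimate. -/
theorem v2Le_sum_halfSemigroup_sub (hp : HalfPartition κ c ε A) (hb : IsRelLipschitz b C)
    (J : ℕ) {t : ℝ} (ht : t ∈ Icc (0 : ℝ) 1) (x : X) :
    V2Le (fun s => ∑ j ∈ Finset.range J,
      halfSemigroup c ε b j t s ((b s - b t) (cfc (c j) (b t) x)))
      (kernelConst A C * (90 * (C * (1 + C)) * A * ‖x‖)) := by
  have hA := hp.nonneg
  have hC := hb.nonneg
  set z : ℕ → X := fun j => cfc (c j) (b t) x with hz
  have := hp.v2Le_sum_halfSemigroup hb J {()} (T := fun _ => t) (fun _ _ => ht)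
    (y := fun _ j s => (b s - b t) (z j)) (R := 90 * (C * (1 + C)) * A * ‖x‖) (by positivity)
    (k := fun j => 90 * (C * (1 + C)) * ‖z j‖) ?_ (fun σ hσ j _ => ?_)
  · simpa only [Finset.sum_singleton] using this
  · simp only [mul_pow (90 * (C * (1 + C))), ← Finset.mul_sum, mul_assoc (90 * (C * (1 + C)))]
    gcongr
    rw [mul_pow]
    exact hp.isDyadicFamily.sum_norm_sq_le hp.part _ (hb.selfAdjoint _) _
  · simp only [Finset.sum_singleton]
    set a : ℝ := (2 ^ j)⁻¹ * σ with ha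
    have ha0 : 0 < a := by positivity
    -- Outside the window the path does not matter, so `s` is clamped to `[t - a, t + a]`. The
    -- clamped path is Lipschitz in `ρ`, whose total variation is at most `2a`.
    set ρ : ℝ → ℝ := fun s => max (t - a) (min (t + a) s) with hρ
    have hρm : Monotone ρ := fun s s' h => max_le_max le_rfl (min_le_min le_rfl h)
    have hρ1 : ∀ s ∈ Icc (0 : ℝ) 1, |ρ s - t| ≤ 1 := fun s hs => by
      rw [abs_le]
      constructor
      · have : t - 1 ≤ min (t + a) s := le_min (by linarith) (by linarith [hs.1, ht.2])
        linarith [this.trans (le_max_right (t - a) _)]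
      · have h1 : ρ s ≤ t + 1 := max_le (by linarith)
          ((min_le_right _ _).trans (by linarith [hs.2, ht.1]))
        linarith
    have hρa : ∀ s, t - a ≤ ρ s ∧ ρ s ≤ t + a := fun s =>
      ⟨le_max_left _ _, max_le (by linarith) (min_le_left _ _)⟩
    have hz1 : ‖b t (z j)‖ + ‖z j‖ ≤ 5 * 2 ^ j * ‖z j‖ :=
      hp.isDyadicFamily.norm_apply_cfc_add_le hp.part j (hb.selfAdjoint t) x
    have h2j : (2 : ℝ) ^ j * a = σ := by rw [ha, mul_inv_cancel_left₀ (by positivity)]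
    have hr : V2Le (fun s => (b (ρ s) - b t) (z j))
        (C * a * (5 * 2 ^ j * ‖z j‖) + C * (1 + C) * (5 * 2 ^ j * ‖z j‖) * (2 * a)) := by
      refine V2Le.of_lipschitz hρm (by positivity) (fun s s' => ?_) ?_ fun s hs s' hs' => ?_
      · linarith [(hρa s).1, (hρa s').2]
      · refine (hb.lip _ _ _).trans ?_
        have : |ρ 0 - t| ≤ a := abs_le.2 ⟨by linarith [(hρa 0).1], by linarith [(hρa 0).2]⟩
        gcongr
      · have e : (b (ρ s') - b t) (z j) - (b (ρ s) - b t) (z j) = (b (ρ s') - b (ρ s)) (z j) := by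
          simp only [sub_apply]; abel
        rw [e]
        refine (hb.lip _ _ _).trans ?_
        have h1 : ‖b (ρ s) (z j)‖ ≤ ‖b t (z j)‖ + C * (‖b t (z j)‖ + ‖z j‖) := by
          have h2 := hb.lip (ρ s) t (z j)
          have h3 : C * |ρ s - t| * (‖b t (z j)‖ + ‖z j‖) ≤ C * (‖b t (z j)‖ + ‖z j‖) := by
            have := hρ1 s hs
            gcongr
            exact mul_le_of_le_one_right hC this
          have h4 : b (ρ s) (z j) = b t (z j) + (b (ρ s) - b t) (z j) := by
            simp only [sub_apply]; abel
          rw [h4]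
          exact (norm_add_le _ _).trans (by linarith)
        have h5 : ‖b (ρ s) (z j)‖ + ‖z j‖ ≤ (1 + C) * (5 * 2 ^ j * ‖z j‖) := by
          have := norm_nonneg (z j)
          calc _ ≤ (1 + C) * (‖b t (z j)‖ + ‖z j‖) := by linarith
            _ ≤ _ := by gcongr
        calc _ ≤ C * |ρ s' - ρ s| * ((1 + C) * (5 * 2 ^ j * ‖z j‖)) := by gcongr
          _ = _ := by ring
    refine ((hr.window_smul ε a t).mono ?_).congr fun s _ => ?_
    -- The initial value gives `30 C σ` and the variation `60 C(1 + C) σ`; together these are at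
    -- most `90 C(1 + C)(1 + σ)`.
    · have e : 6 * (C * a * (5 * 2 ^ j * ‖z j‖) + C * (1 + C) * (5 * 2 ^ j * ‖z j‖) * (2 * a)) =
          30 * C * (2 ^ j * a) * ‖z j‖ + 60 * (C * (1 + C)) * (2 ^ j * a) * ‖z j‖ := by ring
      rw [e, h2j]
      have h6 : 0 ≤ C * σ * ‖z j‖ := by positivity
      have h7 : 0 ≤ C * (C * σ * ‖z j‖) := by positivity
      have h8 : 0 ≤ 90 * (C * (1 + C)) * ‖z j‖ := by positivity
      nlinarith
    · dsimp only
      rw [window_eq hp.cutoff.sign ha0]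
      split_ifs with h
      · congr 4
        have h9 : |s - t| < a := by
          rw [abs_lt]
          rcases hp.cutoff.sign with hε | hε <;> rw [hε] at h <;> constructor <;> linarith
        rw [abs_lt] at h9
        rw [hρ]
        dsimp only
        rw [min_eq_right (by linarith), max_eq_right (by linarith)]
      · simp

end HalfPartition

end HalfKernel

/-! ### Representation of functionals that are bounded in the `L¹` norm. -/

section Representation

variable {X : Type*} [NormedAddCommGroup X] [InnerProductSpace ℂ X] [CompleteSpace X]
variable {Ω : Type*} [MeasurableSpace Ω] {μ : Measure Ω}

theorem integral_norm_le_mul_eLpNorm_two [IsFiniteMeasure μ] {φ : Ω → X} (hφ : MemLp φ 2 μ) :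
    ∫ t, ‖φ t‖ ∂μ ≤ (μ univ ^ (1 / (1 : ℝ≥0∞).toReal - 1 / (2 : ℝ≥0∞).toReal)).toReal *
      (eLpNorm φ 2 μ).toReal := by
  rw [integral_norm_eq_lintegral_enorm hφ.1, ← eLpNorm_one_eq_lintegral_enorm, mul_comm,
    ← ENNReal.toReal_mul]
  refine ENNReal.toReal_mono (ENNReal.mul_ne_top hφ.2.ne
    (ENNReal.rpow_ne_top_of_nonneg (by norm_num) (measure_ne_top _ _))) ?_
  exact eLpNorm_le_eLpNorm_mul_rpow_measure_univ (by norm_num) hφ.1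

/-- A functional on `L²` that is bounded in the `L¹` norm is given by a bounded function. -/
theorem exists_bounded_representing [IsFiniteMeasure μ] {ℓ : (Ω → X) → ℂ} {M : ℝ} (hM : 0 ≤ M)
    (hadd : ∀ φ ψ, MemLp φ 2 μ → MemLp ψ 2 μ → ℓ (fun t => φ t + ψ t) = ℓ φ + ℓ ψ)
    (hsmul : ∀ (c : ℂ) (φ), MemLp φ 2 μ → ℓ (fun t => c • φ t) = c * ℓ φ)
    (hbound : ∀ φ, MemLp φ 2 μ → ‖ℓ φ‖ ≤ M * ∫ t, ‖φ t‖ ∂μ) :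
    ∃ g : Ω → X, StronglyMeasurable g ∧ (∀ᵐ t ∂μ, ‖g t‖ ≤ M) ∧
      ∀ φ, MemLp φ 2 μ → ℓ φ = ∫ t, inner ℂ (g t) (φ t) ∂μ := by
  -- The `L¹` bound makes `ℓ` well defined on classes modulo null sets.
  have hcongr : ∀ φ ψ, MemLp φ 2 μ → MemLp ψ 2 μ → φ =ᵐ[μ] ψ → ℓ φ = ℓ ψ := by
    intro φ ψ hφ hψ h
    have hd : MemLp (fun t => φ t + (-1 : ℂ) • ψ t) 2 μ := hφ.add (hψ.const_smul _)
    have h0 : ℓ (fun t => φ t + (-1 : ℂ) • ψ t) = 0 := by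
      rw [← norm_le_zero_iff]
      refine (hbound _ hd).trans (le_of_eq ?_)
      rw [integral_eq_zero_of_ae, mul_zero]
      filter_upwards [h] with t ht
      simp [ht]
    rw [hadd φ (fun t => (-1 : ℂ) • ψ t) hφ (hψ.const_smul _), hsmul _ _ hψ] at h0
    linear_combination h0
  set D : ℝ := (μ univ ^ (1 / (1 : ℝ≥0∞).toReal - 1 / (2 : ℝ≥0∞).toReal)).toReal
  -- The measure is finite, so `ℓ` is bounded on the Hilbert space `L²`, and Riesz' theorem replaces
  -- a description of the dual of `L¹(X)`.
  let L : StrongDual ℂ (Lp X 2 μ) := LinearMap.mkContinuous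
    { toFun := fun φ => ℓ φ
      map_add' := fun φ ψ => by
        rw [← hadd _ _ (Lp.memLp φ) (Lp.memLp ψ)]
        exact hcongr _ _ (Lp.memLp _) ((Lp.memLp φ).add (Lp.memLp ψ)) (Lp.coeFn_add φ ψ)
      map_smul' := fun c φ => by
        rw [RingHom.id_apply, smul_eq_mul, ← hsmul _ _ (Lp.memLp φ)]
        exact hcongr _ _ (Lp.memLp _) ((Lp.memLp φ).const_smul c) (Lp.coeFn_smul c φ) }
    (M * D) fun φ => by
      refine (hbound _ (Lp.memLp φ)).trans ?_
      rw [mul_assoc, Lp.norm_def]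
      exact mul_le_mul_of_nonneg_left (integral_norm_le_mul_eLpNorm_two (Lp.memLp φ)) hM
  set g : Lp X 2 μ := (InnerProductSpace.toDual ℂ (Lp X 2 μ)).symm L with hg
  have hrep : ∀ φ, MemLp φ 2 μ → ℓ φ = ∫ t, inner ℂ (g t) (φ t) ∂μ := by
    intro φ hφ
    have h1 : inner ℂ g (hφ.toLp φ) = L (hφ.toLp φ) := InnerProductSpace.toDual_symm_apply
    rw [L2.inner_def] at h1
    have h2 : L (hφ.toLp φ) = ℓ φ := hcongr _ _ (Lp.memLp _) hφ hφ.coeFn_toLp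
    rw [← h2, ← h1]
    refine integral_congr_ae ?_
    filter_upwards [hφ.coeFn_toLp] with t ht
    rw [ht]
  refine ⟨g, Lp.stronglyMeasurable g, ?_, hrep⟩
  have hgm := Lp.stronglyMeasurable g
  -- Testing with `g 1_E` gives `∫_E (‖g‖² - M‖g‖) ≤ 0`, although the integrand is positive on `E`;
  -- hence `E` is null.
  set E : Set Ω := {t | M < ‖g t‖} with hE
  have hEm : MeasurableSet E := measurableSet_lt measurable_const hgm.norm.measurable
  have hφ : MemLp (E.indicator g) 2 μ := (Lp.memLp g).indicator hEm
  have hg2 : Integrable (fun t => ‖g t‖ ^ 2) μ := (Lp.memLp g).integrable_norm_pow (by norm_num)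
  have hg1 : Integrable (fun t => ‖g t‖) μ := ((Lp.memLp g).integrable one_le_two).norm
  have h1 := hbound _ hφ
  rw [hrep _ hφ] at h1
  have e1 : ∫ t, inner ℂ (g t) (E.indicator g t) ∂μ = ((∫ t in E, ‖g t‖ ^ 2 ∂μ : ℝ) : ℂ) := by
    rw [← integral_indicator hEm, ← integral_complex_ofReal]
    refine integral_congr_ae (.of_forall fun t => ?_)
    dsimp only
    by_cases ht : t ∈ E
    · simp only [indicator_of_mem ht]
      rw [inner_self_eq_norm_sq_to_K]
      norm_cast
    · simp [indicator_of_notMem ht]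
  have e2 : ∫ t, ‖E.indicator g t‖ ∂μ = ∫ t in E, ‖g t‖ ∂μ := by
    rw [← integral_indicator hEm]
    exact integral_congr_ae (.of_forall fun t => norm_indicator_eq_indicator_norm _ _)
  rw [e1, e2, Complex.norm_real] at h1
  have h2 : ∫ t in E, (‖g t‖ ^ 2 - M * ‖g t‖) ∂μ ≤ 0 := by
    rw [integral_sub hg2.integrableOn (hg1.integrableOn.const_mul M), integral_const_mul]
    linarith [le_abs_self (∫ t in E, ‖g t‖ ^ 2 ∂μ), Real.norm_eq_abs (∫ t in E, ‖g t‖ ^ 2 ∂μ)]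
  have hpos : ∀ t ∈ E, 0 < ‖g t‖ ^ 2 - M * ‖g t‖ := fun t ht => by
    have : M < ‖g t‖ := ht
    nlinarith [hM.trans_lt this]
  have h3 : μ E = 0 := by
    have hnn : 0 ≤ᵐ[μ.restrict E] fun t => ‖g t‖ ^ 2 - M * ‖g t‖ :=
      (ae_restrict_iff' hEm).2 (.of_forall fun t ht => (hpos t ht).le)
    have h4 := (setIntegral_eq_zero_iff_of_nonneg_ae hnn
      (hg2.integrableOn.sub (hg1.integrableOn.const_mul M))).1
      (le_antisymm h2 (setIntegral_nonneg hEm fun t ht => (hpos t ht).le))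
    have h5 : ∀ᵐ t ∂μ, t ∈ E → False := by
      filter_upwards [(ae_restrict_iff' hEm).1 h4] with t ht htE
      exact (hpos t htE).ne' (ht htE)
    rw [measure_eq_zero_iff_ae_notMem]
    exact h5
  filter_upwards [measure_eq_zero_iff_ae_notMem.1 h3] with t ht
  exact not_lt.1 ht

end Representation

/-! ### Right continuous representatives of functions of bounded 2-variation. -/

section RightContinuous

variable {X : Type*} [NormedAddCommGroup X] [InnerProductSpace ℂ X] [CompleteSpace X]

/-- A function of bounded 2-variation on a set of full measure has a right continuous
representative with the same bound on the variation. -/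
theorem exists_rightContinuous_representative {v : ℝ → X} {G : Set ℝ}
    (hG' : ∀ᵐ t, t ∈ Ioo (0 : ℝ) 1 → t ∈ G) {M R : ℝ} (hR : ∀ t ∈ G, ‖v t‖ ≤ R)
    (hv : ∀ (n : ℕ) (t : ℕ → ℝ), Monotone t → (∀ j, t j ∈ G) →
      ∑ j ∈ Finset.range n, ‖v (t (j + 1)) - v (t j)‖ ^ 2 ≤ M ^ 2) :
    ∃ u : ℝ → X, (∀ᵐ t, t ∈ Ioo (0 : ℝ) 1 → u t = v t) ∧
      (∀ t ∈ Ico (0 : ℝ) 1, ContinuousWithinAt u (Ici t) t) ∧ (∀ t ∈ Ico (0 : ℝ) 1, ‖u t‖ ≤ R) ∧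
      ∀ (n : ℕ) (t : ℕ → ℝ), Monotone t → (∀ j, t j ∈ Ico (0 : ℝ) 1) →
        ∑ j ∈ Finset.range n, ‖u (t (j + 1)) - u (t j)‖ ^ 2 ≤ M ^ 2 := by
  -- `Φ p` is the 2-variation from `p` onwards along points of `G`. It is bounded and decreasing,
  -- and it dominates the increments of `v`, so one-sided limits of `v` follow from those of a
  -- monotone function.
  set S : ℝ → Set ℝ := fun p => {x | ∃ (n : ℕ) (t : ℕ → ℝ), Monotone t ∧ (∀ j, t j ∈ G) ∧
    p ≤ t 0 ∧ x = ∑ j ∈ Finset.range n, ‖v (t (j + 1)) - v (t j)‖ ^ 2} with hS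
  set Φ : ℝ → ℝ := fun p => sSup (S p) with hΦ
  have hbdd : ∀ p, BddAbove (S p) := fun p => ⟨M ^ 2, by
    rintro x ⟨n, t, ht, ht', -, rfl⟩
    exact hv n t ht ht'⟩
  have hS0 : ∀ p, ∀ x ∈ S p, 0 ≤ x := by
    rintro p x ⟨n, t, ht, ht', -, rfl⟩
    positivity
  have hΦ0 : ∀ p, 0 ≤ Φ p := fun p => Real.sSup_nonneg (hS0 p)
  have hΦM : ∀ p, Φ p ≤ M ^ 2 := fun p => Real.sSup_le (by
    rintro x ⟨n, t, ht, ht', -, rfl⟩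
    exact hv n t ht ht') (sq_nonneg M)
  have hanti : Antitone Φ := by
    intro p q hpq
    refine Real.sSup_le (fun x hx => ?_) (hΦ0 p)
    obtain ⟨n, t, ht, ht', h0, rfl⟩ := hx
    exact le_csSup (hbdd p) ⟨n, t, ht, ht', hpq.trans h0, rfl⟩
  -- Prepend `p, q` to a partition starting at or after `q`; the step from `q` to its first point is
  -- dropped.
  have hinc : ∀ p ∈ G, ∀ q ∈ G, p ≤ q → ‖v q - v p‖ ^ 2 ≤ Φ p - Φ q := by
    intro p hp q hq hpq
    rw [le_sub_iff_add_le', ← le_sub_iff_add_le]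
    refine Real.sSup_le (fun x hx => ?_) ?_
    · obtain ⟨n, t, ht, ht', h0, rfl⟩ := hx
      rw [le_sub_iff_add_le, add_comm]
      set t' : ℕ → ℝ := fun j => Nat.casesOn j p fun i => Nat.casesOn i q t with ht'def
      have hmono : Monotone t' := monotone_nat_of_le_succ fun j => by
        rcases j with _ | _ | j
        · exact hpq
        · exact h0
        · exact ht j.le_succ
      have hmem : ∀ j, t' j ∈ G := fun j => by
        rcases j with _ | _ | j
        · exact hp
        · exact hq
        · exact ht' j
      refine le_trans ?_ (le_csSup (hbdd p) ⟨n + 2, t', hmono, hmem, le_rfl, rfl⟩)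
      rw [Finset.sum_range_succ', Finset.sum_range_succ']
      have : 0 ≤ ‖v (t' (0 + 1 + 1)) - v (t' (0 + 1))‖ ^ 2 := by positivity
      have e : ∑ j ∈ Finset.range n, ‖v (t' (j + 1 + 1 + 1)) - v (t' (j + 1 + 1))‖ ^ 2 =
        ∑ j ∈ Finset.range n, ‖v (t (j + 1)) - v (t j)‖ ^ 2 := rfl
      have e2 : ‖v (t' (0 + 1)) - v (t' 0)‖ ^ 2 = ‖v q - v p‖ ^ 2 := rfl
      linarith
    -- `Real.sSup_le` also asks for a nonnegative bound; the partition `p, q, q, …` provides it.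
    · rw [sub_nonneg]
      set t' : ℕ → ℝ := fun j => Nat.casesOn j p fun _ => q with ht'def
      refine le_csSup (hbdd p) ⟨1, t', monotone_nat_of_le_succ fun j => ?_, fun j => ?_, le_rfl, ?_⟩
      · rcases j with _ | j
        · exact hpq
        · exact le_rfl
      · rcases j with _ | j
        · exact hp
        · exact hq
      · rw [Finset.sum_range_one]
        rfl
  have hneBot : ∀ t ∈ Ico (0 : ℝ) 1, (nhdsWithin t (Ioi t ∩ G)).NeBot := by
    intro t ht
    have hd : Dense {s | s ∈ Ioo (0 : ℝ) 1 → s ∈ G} := Measure.dense_of_ae hG'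
    rw [← mem_closure_iff_nhdsWithin_neBot]
    have h1 : t ∈ closure (Ioo t 1) := by
      rw [closure_Ioo ht.2.ne]; exact left_mem_Icc.2 ht.2.le
    have h2 := hd.open_subset_closure_inter (isOpen_Ioo (a := t) (b := 1))
    have h3 : closure (Ioo t 1) ⊆ closure (Ioo t 1 ∩ {s | s ∈ Ioo (0 : ℝ) 1 → s ∈ G}) :=
      closure_minimal h2 isClosed_closure
    have h4 : Ioo t 1 ∩ {s | s ∈ Ioo (0 : ℝ) 1 → s ∈ G} ⊆ Ioi t ∩ G := fun s hs =>
      ⟨hs.1.1, hs.2 ⟨ht.1.trans_lt hs.1.1, hs.1.2⟩⟩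
    exact closure_mono h4 (h3 h1)
  have hΦlim : ∀ t, ∃ l, Filter.Tendsto Φ (nhdsWithin t (Ioi t)) (nhds l) := fun t =>
    ⟨_, hanti.tendsto_nhdsGT t⟩
  choose Λ hΛ using hΦlim
  have hlim : ∀ t ∈ Ico (0 : ℝ) 1,
      ∃ l, Filter.Tendsto v (nhdsWithin t (Ioi t ∩ G)) (nhds l) := by
    intro t ht
    have := hneBot t ht
    rw [← cauchy_map_iff_exists_tendsto, cauchy_map_iff']
    have hc := ((hΛ t).mono_left (nhdsWithin_mono t inter_subset_left :
      nhdsWithin t (Ioi t ∩ G) ≤ nhdsWithin t (Ioi t))).cauchy_map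
    rw [cauchy_map_iff'] at hc
    rw [Metric.uniformity_basis_dist.tendsto_right_iff] at hc ⊢
    intro δ hδ
    have hGev : ∀ᶠ x in nhdsWithin t (Ioi t ∩ G), x ∈ G :=
      (eventually_nhdsWithin_of_forall fun x hx => hx.2)
    filter_upwards [hc (δ ^ 2) (by positivity), hGev.prod_mk hGev] with x hx hxG
    have hx' : |Φ x.1 - Φ x.2| < δ ^ 2 := hx
    change dist (v x.1) (v x.2) < δ
    refine (abs_lt_of_sq_lt_sq' ?_ hδ.le).2
    refine lt_of_le_of_lt ?_ hx'
    rcases le_total x.1 x.2 with h | h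
    · rw [dist_comm, dist_eq_norm]
      exact (hinc _ hxG.1 _ hxG.2 h).trans (le_abs_self _)
    · rw [dist_eq_norm, abs_sub_comm]
      exact (hinc _ hxG.2 _ hxG.1 h).trans (le_abs_self _)
  choose! u hu using hlim
  -- The increment bound passes to right limits, first at `p` and then at `q`. Its right side
  -- telescopes, which gives the variation bound for `u` with the same `M`.
  have hinc2 : ∀ p ∈ Ico (0 : ℝ) 1, ∀ q ∈ Ico (0 : ℝ) 1, p ≤ q →
      ‖u q - u p‖ ^ 2 ≤ Λ p - Λ q := by
    intro p hp q hq hpq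
    rcases hpq.eq_or_lt with rfl | hlt
    · simp
    have := hneBot p hp
    have := hneBot q hq
    have hle : ∀ t, nhdsWithin t (Ioi t ∩ G) ≤ nhdsWithin t (Ioi t) := fun t =>
      nhdsWithin_mono t inter_subset_left
    have h1 : ∀ x ∈ Ioi q ∩ G, ‖v x - u p‖ ^ 2 ≤ Λ p - Φ x := by
      intro x hx
      refine le_of_tendsto_of_tendsto ((tendsto_const_nhds.sub (hu p hp)).norm.pow 2)
        (((hΛ p).mono_left (hle p)).sub tendsto_const_nhds) ?_
      have hpx : ∀ᶠ y in nhdsWithin p (Ioi p ∩ G), y < x :=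
        nhdsWithin_le_nhds (eventually_lt_nhds (hlt.trans hx.1))
      filter_upwards [hpx, self_mem_nhdsWithin] with y hy hyG
      exact hinc y hyG.2 x hx.2 hy.le
    refine le_of_tendsto_of_tendsto (((hu q hq).sub tendsto_const_nhds).norm.pow 2)
      (tendsto_const_nhds.sub ((hΛ q).mono_left (hle q))) ?_
    filter_upwards [self_mem_nhdsWithin] with x hx using h1 x hx
  have hΛ' : ∀ p q, p < q → Φ q ≤ Λ p := fun p q hpq => ge_of_tendsto (hΛ p) (by
    filter_upwards [nhdsWithin_le_nhds (eventually_lt_nhds hpq)] with x hx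
    exact hanti hx.le)
  have hΛle : ∀ p, Λ p ≤ Φ p := fun p => le_of_tendsto (hΛ p) (by
    filter_upwards [self_mem_nhdsWithin] with x hx
    exact hanti (le_of_lt hx))
  refine ⟨u, ?_, fun t ht => ?_, fun t ht => ?_, fun n t ht ht' => ?_⟩
  -- At a point of `G` where `Φ` is continuous, `v` is continuous from the right along `G`. Only
  -- countably many points are lost, `Φ` being monotone.
  · filter_upwards [hG', hanti.countable_not_continuousAt.ae_notMem volume] with t htG htc ht
    have ht0 : t ∈ Ico (0 : ℝ) 1 := ⟨ht.1.le, ht.2⟩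
    have htc' : ContinuousAt Φ t := not_not.1 htc
    have := hneBot t ht0
    have h1 : Filter.Tendsto v (nhdsWithin t (Ioi t ∩ G)) (nhds (v t)) := by
      rw [tendsto_iff_norm_sub_tendsto_zero]
      have h2 : Filter.Tendsto (fun x => √(Φ t - Φ x)) (nhdsWithin t (Ioi t ∩ G)) (nhds 0) := by
        have : Filter.Tendsto (fun x => √(Φ t - Φ x)) (nhds t) (nhds √(Φ t - Φ t)) :=
          (tendsto_const_nhds.sub htc').sqrt
        rw [sub_self, Real.sqrt_zero] at this
        exact this.mono_left nhdsWithin_le_nhds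
      refine squeeze_zero' (.of_forall fun _ => norm_nonneg _) ?_ h2
      filter_upwards [self_mem_nhdsWithin] with x hx
      exact Real.le_sqrt_of_sq_le (hinc t (htG ht) x hx.2 (le_of_lt hx.1))
    exact tendsto_nhds_unique (hu t ht0) h1
  · have h1 : Filter.Tendsto u (nhdsWithin t (Ioi t)) (nhds (u t)) := by
      rw [tendsto_iff_norm_sub_tendsto_zero]
      -- `Λ x` is bounded below by `Φ` only at points strictly to the right of `x`. The point `t +
      -- 2(x - t)` is such a point and still tends to `t`.
      have h2 : Filter.Tendsto (fun x => √(Λ t - Φ (t + 2 * (x - t)))) (nhdsWithin t (Ioi t))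
          (nhds 0) := by
        have h3 : Filter.Tendsto (fun x => t + 2 * (x - t)) (nhdsWithin t (Ioi t))
            (nhdsWithin t (Ioi t)) := by
          refine tendsto_nhdsWithin_iff.2 ⟨?_, ?_⟩
          · have : Continuous fun x => t + 2 * (x - t) := by fun_prop
            have h4 := this.tendsto t
            rw [sub_self, mul_zero, add_zero] at h4
            exact h4.mono_left nhdsWithin_le_nhds
          · filter_upwards [self_mem_nhdsWithin] with x hx
            have : t < x := hx
            simp only [mem_Ioi]; linarith
        have := ((tendsto_const_nhds (x := Λ t)).sub ((hΛ t).comp h3)).sqrt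
        rwa [sub_self, Real.sqrt_zero] at this
      refine squeeze_zero' (.of_forall fun _ => norm_nonneg _) ?_ h2
      filter_upwards [self_mem_nhdsWithin, nhdsWithin_le_nhds (eventually_lt_nhds ht.2)] with x hx hx1
      have hx' : t < x := hx
      refine Real.le_sqrt_of_sq_le ((hinc2 t ht x ⟨ht.1.trans hx'.le, hx1⟩ hx'.le).trans ?_)
      have := hΛ' x (t + 2 * (x - t)) (by linarith)
      linarith
    rw [← Ioi_insert, continuousWithinAt_insert_self]
    exact h1
  · have := hneBot t ht
    refine le_of_tendsto (hu t ht).norm ?_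
    filter_upwards [self_mem_nhdsWithin] with x hx using hR x hx.2
  · calc _ ≤ ∑ j ∈ Finset.range n, (Λ (t j) - Λ (t (j + 1))) := Finset.sum_le_sum fun j _ =>
          hinc2 _ (ht' _) _ (ht' _) (ht j.le_succ)
      _ = Λ (t 0) - Λ (t n) := by rw [Finset.sum_range_sub']
      _ ≤ M ^ 2 := by
        have h1 : 0 ≤ Λ (t n) := ge_of_tendsto (hΛ _) (.of_forall fun x => hΦ0 x)
        linarith [(hΛle (t 0)).trans (hΦM _)]

end RightContinuous

/-! ### Duality for kernels of bounded 2-variation. -/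

section KernelOperator

variable {X : Type*} [NormedAddCommGroup X] [InnerProductSpace ℂ X] [CompleteSpace X]

/-- A functional on continuous functions of bounded 2-variation, of norm at most `N`. -/
structure IsVariationFunctional (F : (ℝ → X) → ℂ) (N : ℝ) : Prop where
  nonneg : 0 ≤ N
  add : ∀ u v k l, ContinuousOn u (Icc 0 1) → ContinuousOn v (Icc 0 1) → V2Le u k → V2Le v l →
    F (fun s => u s + v s) = F u + F v
  smul : ∀ (c : ℂ) u k, ContinuousOn u (Icc 0 1) → V2Le u k → F (fun s => c • u s) = c * F u
  bound : ∀ u k, ContinuousOn u (Icc 0 1) → V2Le u k → ‖F u‖ ≤ N * k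

/-- A function vanishing on `[0,1]` has 2-variation norm zero, so the bound for `F` annihilates the
difference. -/
theorem IsVariationFunctional.congr {F : (ℝ → X) → ℂ} {N : ℝ} (hF : IsVariationFunctional F N)
    {u v : ℝ → X} {k : ℝ} (hu : ContinuousOn u (Icc 0 1)) (hk : V2Le u k)
    (h : EqOn u v (Icc 0 1)) : F u = F v := by
  have hv := hu.congr h.symm
  have hkv := hk.congr h
  have h0 : F (fun s => u s + (-1 : ℂ) • v s) = 0 := by
    rw [← norm_le_zero_iff]
    refine (hF.bound _ 0 (hu.add (hv.const_smul _)) (V2Le.zero.congr fun s hs => ?_)).trans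
      (mul_zero N).le
    simp [h hs]
  rw [hF.add u (fun s => (-1 : ℂ) • v s) k _ hu (hv.const_smul _) hk (hkv.const_smul _),
    hF.smul _ v k hv hkv] at h0
  linear_combination h0

/-- An operator kernel of bounded 2-variation in the second variable. -/
structure IsVariationKernel (k : ℝ → ℝ → X →L[ℂ] X) (K : ℝ) : Prop where
  nonneg : 0 ≤ K
  v2Le : ∀ t ∈ Ioo (0 : ℝ) 1, ∀ x, V2Le (fun s => k t s x) (K * ‖x‖)
  measurable : ∀ s ∈ Icc (0 : ℝ) 1,
    AEStronglyMeasurable (fun t => k t s) (volume.restrict (Ioo 0 1))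
  continuousOn : ∀ t ∈ Ioo (0 : ℝ) 1, ContinuousOn (k t) (Icc 0 1 \ {t})

/-- The integral operator `φ ↦ ∫_0^1 k(t,·) φ(t) dt`. -/
noncomputable def kernelOp (k : ℝ → ℝ → X →L[ℂ] X) (φ : ℝ → X) (s : ℝ) : X :=
  ∫ t in Ioo (0 : ℝ) 1, k t s (φ t)

namespace IsVariationKernel

variable {k : ℝ → ℝ → X →L[ℂ] X} {K : ℝ}

theorem sub {k' : ℝ → ℝ → X →L[ℂ] X} {K' : ℝ} (hk : IsVariationKernel k K)
    (hk' : IsVariationKernel k' K') :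
    IsVariationKernel (fun t s => k t s - k' t s) (K + K') where
  nonneg := add_nonneg hk.nonneg hk'.nonneg
  v2Le t ht x := by
    simp only [sub_apply, add_mul]
    exact (hk.v2Le t ht x).sub (hk'.v2Le t ht x)
  measurable s hs := (hk.measurable s hs).sub (hk'.measurable s hs)
  continuousOn t ht := (hk.continuousOn t ht).sub (hk'.continuousOn t ht)

theorem norm_apply_le (hk : IsVariationKernel k K) {t s : ℝ} (ht : t ∈ Ioo (0 : ℝ) 1)
    (hs : s ∈ Icc (0 : ℝ) 1) (x : X) : ‖k t s x‖ ≤ 2 * K * ‖x‖ :=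
  ((hk.v2Le t ht x).norm_le hs).trans (mul_assoc 2 K ‖x‖).ge

theorem aestronglyMeasurable_apply (hk : IsVariationKernel k K) {s : ℝ} (hs : s ∈ Icc (0 : ℝ) 1)
    {φ : ℝ → X} (hφ : AEStronglyMeasurable φ (volume.restrict (Ioo 0 1))) :
    AEStronglyMeasurable (fun t => k t s (φ t)) (volume.restrict (Ioo 0 1)) :=
  (ContinuousLinearMap.apply ℂ X).flip.aestronglyMeasurable_comp₂ (hk.measurable s hs) hφ

theorem integrable_apply (hk : IsVariationKernel k K) {s : ℝ} (hs : s ∈ Icc (0 : ℝ) 1)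
    {φ : ℝ → X} (hφ : IntegrableOn φ (Ioo 0 1)) :
    IntegrableOn (fun t => k t s (φ t)) (Ioo 0 1) := by
  refine (hφ.norm.const_mul (2 * K)).mono' (hk.aestronglyMeasurable_apply hs hφ.1) ?_
  filter_upwards [ae_restrict_mem measurableSet_Ioo] with t ht
  exact hk.norm_apply_le ht hs _

theorem v2Le_kernelOp (hk : IsVariationKernel k K) {φ : ℝ → X} (hφ : IntegrableOn φ (Ioo 0 1)) :
    V2Le (kernelOp k φ) (K * ∫ t in Ioo (0 : ℝ) 1, ‖φ t‖) := by
  rw [← integral_const_mul]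
  refine V2Le.integral (fun s hs => hk.integrable_apply hs hφ) ?_ (hφ.norm.const_mul K)
  filter_upwards [ae_restrict_mem measurableSet_Ioo] with t ht
  exact hk.v2Le t ht _

/-- Dominated convergence: for fixed `s` the kernel is discontinuous in its second variable there
only when `t = s`, a null set of `t`. -/
theorem continuousOn_kernelOp (hk : IsVariationKernel k K) {φ : ℝ → X}
    (hφ : IntegrableOn φ (Ioo 0 1)) : ContinuousOn (kernelOp k φ) (Icc 0 1) := by
  intro s hs
  refine continuousWithinAt_of_dominated (bound := fun t => 2 * K * ‖φ t‖) ?_ ?_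
    (hφ.norm.const_mul (2 * K)) ?_
  · filter_upwards [self_mem_nhdsWithin] with s' hs'
    exact hk.aestronglyMeasurable_apply hs' hφ.1
  · filter_upwards [self_mem_nhdsWithin] with s' hs'
    filter_upwards [ae_restrict_mem measurableSet_Ioo] with t ht
    exact hk.norm_apply_le ht hs' _
  · have h0 : ∀ᵐ t : ℝ, t ≠ s := by simp [ae_iff]
    filter_upwards [ae_restrict_mem measurableSet_Ioo, ae_restrict_of_ae h0] with t ht hne
    have h1 : ContinuousWithinAt (k t) (Icc 0 1) s := by
      have := hk.continuousOn t ht s ⟨hs, fun h => hne h.symm⟩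
      refine this.mono_of_mem_nhdsWithin ?_
      exact inter_mem_nhdsWithin _ (isOpen_ne.mem_nhds hne.symm)
    exact h1.clm_apply continuousWithinAt_const

theorem kernelOp_add (hk : IsVariationKernel k K) {φ ψ : ℝ → X} (hφ : IntegrableOn φ (Ioo 0 1))
    (hψ : IntegrableOn ψ (Ioo 0 1)) {s : ℝ} (hs : s ∈ Icc (0 : ℝ) 1) :
    kernelOp k (fun t => φ t + ψ t) s = kernelOp k φ s + kernelOp k ψ s := by
  unfold kernelOp
  rw [← integral_add (hk.integrable_apply hs hφ) (hk.integrable_apply hs hψ)]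
  simp only [map_add]

theorem _root_.kernelOp_smul (k : ℝ → ℝ → X →L[ℂ] X) (c : ℂ) (φ : ℝ → X) (s : ℝ) :
    kernelOp k (fun t => c • φ t) s = c • kernelOp k φ s := by
  unfold kernelOp
  rw [← integral_smul]
  simp only [map_smul]

/-- By Minkowski's inequality `kernelOp` maps `L¹` to `V²`, so its composition with `F` satisfies
the `L¹` bound of `exists_bounded_representing`. -/
theorem exists_representing (hk : IsVariationKernel k K) {F : (ℝ → X) → ℂ} {N : ℝ}
    (hF : IsVariationFunctional F N) :
    ∃ g : ℝ → X, StronglyMeasurable g ∧ (∀ᵐ t ∂volume.restrict (Ioo 0 1), ‖g t‖ ≤ N * K) ∧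
      ∀ φ, MemLp φ 2 (volume.restrict (Ioo 0 1)) →
        F (kernelOp k φ) = ∫ t in Ioo (0 : ℝ) 1, inner ℂ (g t) (φ t) := by
  have hint : ∀ {φ : ℝ → X}, MemLp φ 2 (volume.restrict (Ioo 0 1)) → IntegrableOn φ (Ioo 0 1) :=
    fun h => h.integrable one_le_two
  refine exists_bounded_representing (ℓ := fun φ => F (kernelOp k φ))
    (mul_nonneg hF.nonneg hk.nonneg) (fun φ ψ hφ hψ => ?_) (fun c φ hφ => ?_) fun φ hφ => ?_
  · rw [← hF.add _ _ _ _ (hk.continuousOn_kernelOp (hint hφ)) (hk.continuousOn_kernelOp (hint hψ))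
      (hk.v2Le_kernelOp (hint hφ)) (hk.v2Le_kernelOp (hint hψ))]
    exact hF.congr (hk.continuousOn_kernelOp ((hint hφ).add (hint hψ)))
      (hk.v2Le_kernelOp ((hint hφ).add (hint hψ))) fun s hs => hk.kernelOp_add (hint hφ) (hint hψ) hs
  · rw [← hF.smul c _ _ (hk.continuousOn_kernelOp (hint hφ)) (hk.v2Le_kernelOp (hint hφ))]
    congr 1
    ext1 s
    exact kernelOp_smul k c φ s
  · refine (hF.bound _ _ (hk.continuousOn_kernelOp (hint hφ)) (hk.v2Le_kernelOp (hint hφ))).trans ?_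
    rw [mul_assoc]

end IsVariationKernel

/-- The step function `∑_k (1_{(t_{k+1}, t_{k+1}+h]} - 1_{(t_k, t_k+h]}) w_k`. -/
noncomputable def stepFun (n : ℕ) (t : ℕ → ℝ) (h : ℝ) (w : ℕ → X) (r : ℝ) : X :=
  ∑ k ∈ Finset.range n, ((Ioc (t (k + 1)) (t (k + 1) + h)).indicator (fun _ => w k) r -
    (Ioc (t k) (t k + h)).indicator (fun _ => w k) r)

theorem memLp_stepFun (n : ℕ) (t : ℕ → ℝ) (h : ℝ) (w : ℕ → X) :
    MemLp (stepFun n t h w) 2 (volume.restrict (Ioo 0 1)) := by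
  have hm : ∀ (a : ℝ) (x : X), MemLp ((Ioc a (a + h)).indicator fun _ => x) 2
      (volume.restrict (Ioo (0 : ℝ) 1)) := fun a x => (memLp_const x).indicator measurableSet_Ioc
  exact memLp_finsetSum _ fun k _ => (hm (t (k + 1)) (w k)).sub (hm (t k) (w k))

/-- Step functions stand in for differences of point masses at partition points. The lemma serves
both sides of the duality: `Λ r` is the pairing with `g r`, and also `k r s`. -/
theorem integral_apply_stepFun {Y : Type*} [NormedAddCommGroup Y] [NormedSpace ℝ Y]
    [NormedSpace ℂ Y] {Λ : ℝ → X →L[ℂ] Y}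
    (hΛ : ∀ x, IntegrableOn (fun r => Λ r x) (Ioo 0 1)) {n : ℕ} {t : ℕ → ℝ} {h : ℝ} (hh : 0 < h)
    (ht : ∀ k, 0 < t k ∧ t k + h < 1) (w : ℕ → X) :
    ∫ r in Ioo (0 : ℝ) 1, Λ r (stepFun n t h w r) = ∑ k ∈ Finset.range n,
      ((∫ θ in (0 : ℝ)..h, Λ (t (k + 1) + θ) (w k)) - ∫ θ in (0 : ℝ)..h, Λ (t k + θ) (w k)) := by
  have e : ∀ k r x, Λ r ((Ioc (t k) (t k + h)).indicator (fun _ => x) r) =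
      (Ioc (t k) (t k + h)).indicator (fun r => Λ r x) r := fun k r x => by
    by_cases hr : r ∈ Ioc (t k) (t k + h) <;> simp [hr]
  have hi : ∀ k x, IntegrableOn (fun r => (Ioc (t k) (t k + h)).indicator (fun r => Λ r x) r)
      (Ioo 0 1) := fun k x => (hΛ x).indicator measurableSet_Ioc
  have hI : ∀ k x, ∫ r in Ioo (0 : ℝ) 1, (Ioc (t k) (t k + h)).indicator (fun r => Λ r x) r =
      ∫ θ in (0 : ℝ)..h, Λ (t k + θ) x := fun k x => by
    have hsub : Ioc (t k) (t k + h) ⊆ Ioo 0 1 := fun r hr =>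
      ⟨(ht k).1.trans hr.1, hr.2.trans_lt (ht k).2⟩
    rw [setIntegral_indicator measurableSet_Ioc, inter_eq_right.2 hsub,
      intervalIntegral.integral_comp_add_left (fun r => Λ r x) (t k), add_zero,
      intervalIntegral.integral_of_le (by linarith)]
  simp only [stepFun, map_sum, map_sub, e]
  rw [integral_finsetSum _ fun k _ => (hi (k + 1) (w k)).sub' (hi k (w k))]
  refine Finset.sum_congr rfl fun k _ => ?_
  rw [integral_sub (hi _ _) (hi _ _), hI, hI]

theorem intervalIntegral_inner_right {g : ℝ → X} {a b : ℝ} (hg : IntervalIntegrable g volume a b)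
    (x : X) : ∫ θ in a..b, inner ℂ (g θ) x = inner ℂ (∫ θ in a..b, g θ) x := by
  rw [← inner_conj_symm (∫ θ in a..b, g θ) x]
  have h1 : inner ℂ x (∫ θ in a..b, g θ) = ∫ θ in a..b, inner ℂ x (g θ) :=
    ((innerSL ℂ x).intervalIntegral_comp_comm hg).symm
  have h2 : IntervalIntegrable (fun θ => inner ℂ x (g θ)) volume a b :=
    ⟨hg.1.const_inner x, hg.2.const_inner x⟩
  rw [h1]
  refine Eq.trans ?_ ((Complex.conjCLE : ℂ →L[ℝ] ℂ).intervalIntegral_comp_comm h2)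
  refine intervalIntegral.integral_congr fun θ _ => ?_
  exact (inner_conj_symm _ _).symm

theorem IntegrableOn.intervalIntegrable_comp_add {Y : Type*} [NormedAddCommGroup Y]
    {f : ℝ → Y} (hf : IntegrableOn f (Ioo 0 1)) {a h : ℝ} (ha : 0 < a) (hh : 0 < h)
    (hah : a + h < 1) : IntervalIntegrable (fun θ => f (a + θ)) volume 0 h := by
  have h01 : IntervalIntegrable f volume 0 1 := by
    rw [intervalIntegrable_iff_integrableOn_Ioo_of_le zero_le_one]
    exact hf
  have : IntervalIntegrable f volume a (a + h) := by
    refine h01.mono_set ?_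
    rw [uIcc_of_le zero_le_one, uIcc_of_le (by linarith)]
    exact Icc_subset_Icc ha.le hah.le
  simpa using this.comp_add_left a

/-- The 2-variation of the representing function `g` is dual to the `ℓ²` bound on superpositions of
kernel differences. Point masses are replaced by averages over `(t_j, t_j + h]`, and `h → 0`
recovers `g` at points where its primitive has derivative `g`. These have full measure, and there
the preceding section applies. -/
theorem IsVariationKernel.exists_rightContinuous_representing {k : ℝ → ℝ → X →L[ℂ] X} {K L : ℝ}
    (hk : IsVariationKernel k K) (hL : 0 ≤ L)
    (hkL : ∀ (n : ℕ) (t : ℕ → ℝ), Monotone t → (∀ j, t j ∈ Icc (0 : ℝ) 1) → ∀ (w : ℕ → X) (R : ℝ),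
      0 ≤ R → ∑ j ∈ Finset.range n, ‖w j‖ ^ 2 ≤ R ^ 2 →
      V2Le (fun s => ∑ j ∈ Finset.range n, (k (t (j + 1)) s (w j) - k (t j) s (w j))) (L * R))
    {F : (ℝ → X) → ℂ} {N : ℝ} (hF : IsVariationFunctional F N) :
    ∃ u : ℝ → X, (∀ t ∈ Ico (0 : ℝ) 1, ContinuousWithinAt u (Ici t) t) ∧
      (∀ t ∈ Ico (0 : ℝ) 1, ‖u t‖ ≤ N * K) ∧
      (∀ (n : ℕ) (t : ℕ → ℝ), Monotone t → (∀ j, t j ∈ Ico (0 : ℝ) 1) →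
        ∑ j ∈ Finset.range n, ‖u (t (j + 1)) - u (t j)‖ ^ 2 ≤ (N * L) ^ 2) ∧
      ∀ φ, MemLp φ 2 (volume.restrict (Ioo 0 1)) →
        F (kernelOp k φ) = ∫ t in Ioo (0 : ℝ) 1, inner ℂ (u t) (φ t) := by
  obtain ⟨g, hgm, hgK, hg⟩ := hk.exists_representing hF
  have hgi : IntegrableOn g (Ioo 0 1) :=
    (integrable_const (N * K)).mono' hgm.aestronglyMeasurable hgK
  have hg01 : IntervalIntegrable g volume 0 1 := by
    rw [intervalIntegrable_iff_integrableOn_Ioo_of_le zero_le_one]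
    exact hgi
  set G : Set ℝ := {t | t ∈ Ioo (0 : ℝ) 1 ∧ ‖g t‖ ≤ N * K ∧
    HasDerivAt (fun x => ∫ r in (0 : ℝ)..x, g r) (g t) t} with hG
  have hGae : ∀ᵐ t, t ∈ Ioo (0 : ℝ) 1 → t ∈ G := by
    filter_upwards [(ae_restrict_iff' measurableSet_Ioo).1 hgK, hg01.ae_hasDerivAt_integral]
      with t h1 h2 ht
    refine ⟨ht, h1 ht, h2 ?_ 0 (by simp)⟩
    rw [uIcc_of_le zero_le_one]; exact Ioo_subset_Icc_self ht
  have hvar : ∀ (n : ℕ) (t : ℕ → ℝ), Monotone t → (∀ j, t j ∈ G) →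
      ∑ j ∈ Finset.range n, ‖g (t (j + 1)) - g (t j)‖ ^ 2 ≤ (N * L) ^ 2 := by
    intro n t₀ ht₀ hG₀
    -- Freezing the partition after index `n` bounds all its points by `t₀ n < 1`, so a single small
    -- `h` keeps every shifted point below 1.
    set t : ℕ → ℝ := fun j => t₀ (min j n) with ht
    have htm : Monotone t := fun i j hij => ht₀ (min_le_min hij le_rfl)
    have htG : ∀ j, t j ∈ G := fun j => hG₀ _
    have htn : ∀ j, t j ≤ t₀ n := fun j => ht₀ (min_le_right _ _)
    have e0 : ∑ j ∈ Finset.range n, ‖g (t₀ (j + 1)) - g (t₀ j)‖ ^ 2 =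
        ∑ j ∈ Finset.range n, ‖g (t (j + 1)) - g (t j)‖ ^ 2 := by
      refine Finset.sum_congr rfl fun j hj => ?_
      have := Finset.mem_range.1 hj
      simp only [ht]
      rw [min_eq_left (by omega), min_eq_left (by omega)]
    rw [e0]
    set H : ℝ → ℝ → X := fun h r => ∫ θ in (0 : ℝ)..h, g (r + θ) with hH
    have hHlim : ∀ j, Filter.Tendsto (fun h => h⁻¹ • H h (t j)) (nhdsWithin 0 (Ioi 0))
        (nhds (g (t j))) := by
      intro j
      have h1 := (htG j).2.2.tendsto_slope_zero_right
      refine h1.congr' ?_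
      have hev : ∀ᶠ h in nhdsWithin (0 : ℝ) (Ioi 0), h < 1 - t j :=
        nhdsWithin_le_nhds (eventually_lt_nhds (by linarith [(htG j).1.2]))
      filter_upwards [self_mem_nhdsWithin, hev] with h hh hh1
      have hh0 : 0 < h := hh
      congr 1
      simp only [hH]
      rw [intervalIntegral.integral_comp_add_left g (t j), add_zero]
      have hsub : ∀ {a b : ℝ}, a ∈ Icc (0 : ℝ) 1 → b ∈ Icc (0 : ℝ) 1 →
          IntervalIntegrable g volume a b := fun ha hb => by
        refine hg01.mono_set ?_
        rw [uIcc_of_le zero_le_one]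
        exact (convex_Icc (0 : ℝ) 1).ordConnected.uIcc_subset ha hb
      have h0 : (0 : ℝ) ∈ Icc (0 : ℝ) 1 := by simp
      have h2 : t j ∈ Icc (0 : ℝ) 1 := Ioo_subset_Icc_self (htG j).1
      have h3 : t j + h ∈ Icc (0 : ℝ) 1 := ⟨by linarith [h2.1], by linarith⟩
      exact intervalIntegral.integral_interval_sub_left (hsub h0 h3) (hsub h0 h2)
    have hfin : ∀ᶠ h in nhdsWithin (0 : ℝ) (Ioi 0),
        ∑ j ∈ Finset.range n, ‖h⁻¹ • H h (t (j + 1)) - h⁻¹ • H h (t j)‖ ^ 2 ≤ (N * L) ^ 2 := by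
      have hev : ∀ᶠ h in nhdsWithin (0 : ℝ) (Ioi 0), h < 1 - t₀ n :=
        nhdsWithin_le_nhds (eventually_lt_nhds (by linarith [(hG₀ n).1.2]))
      filter_upwards [self_mem_nhdsWithin, hev] with h hh hh1
      have hh0 : 0 < h := hh
      have ht01 : ∀ j, 0 < t j ∧ t j + h < 1 := fun j =>
        ⟨(htG j).1.1, by linarith [htn j]⟩
      -- The weights are the differences to be estimated, so that pairing `g` with the step function
      -- gives `Q = ∑ ‖w_j‖²`.
      set w : ℕ → X := fun j => H h (t (j + 1)) - H h (t j) with hw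
      set Q : ℝ := ∑ j ∈ Finset.range n, ‖w j‖ ^ 2 with hQ
      have hQ0 : 0 ≤ Q := by positivity
      have hmem := memLp_stepFun n t h w
      have hgsh : ∀ j, IntervalIntegrable (fun θ => g (t j + θ)) volume 0 h := fun j =>
        IntegrableOn.intervalIntegrable_comp_add hgi (ht01 j).1 hh0 (ht01 j).2
      have hki : ∀ s ∈ Icc (0 : ℝ) 1, ∀ x, IntegrableOn (fun r => k r s x) (Ioo 0 1) :=
        fun s hs x => hk.integrable_apply hs (integrable_const x)
      have hksh : ∀ s ∈ Icc (0 : ℝ) 1, ∀ j x,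
          IntervalIntegrable (fun θ => k (t j + θ) s x) volume 0 h := fun s hs j x =>
        IntegrableOn.intervalIntegrable_comp_add (hki s hs x) (ht01 j).1 hh0 (ht01 j).2
      have hFQ : F (kernelOp k (stepFun n t h w)) = (Q : ℂ) := by
        rw [hg _ hmem]
        have e1 := integral_apply_stepFun (Λ := fun r => innerSL ℂ (g r)) (fun x => ?_) hh0 ht01 w
          (n := n)
        · simp only [innerSL_apply_apply] at e1
          rw [e1, hQ]
          push_cast
          refine Finset.sum_congr rfl fun j _ => ?_
          rw [intervalIntegral_inner_right (hgsh _), intervalIntegral_inner_right (hgsh _),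
            ← inner_sub_left]
          change inner ℂ (w j) (w j) = _
          rw [inner_self_eq_norm_sq_to_K]
          norm_cast
        · simp only [innerSL_apply_apply]
          exact hgi.inner_const x
      -- The step function averages over shifts `θ ∈ (0,h]` of the partition. The hypothesis holds
      -- for every shift, and Minkowski's inequality contributes the factor `h`, cancelled at the
      -- end by `h⁻¹`.
      have hV : V2Le (kernelOp k (stepFun n t h w)) (h * (L * √Q)) := by
        have h1 := V2Le.integral (ν := volume.restrict (Ioc 0 h))
          (q := fun θ s => ∑ j ∈ Finset.range n, (k (t (j + 1) + θ) s (w j) - k (t j + θ) s (w j)))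
          (ρ := fun _ => L * √Q) (fun s hs => ?_) ?_ (integrable_const _)
        · have h2 : ∫ _ in Ioc (0 : ℝ) h, L * √Q = h * (L * √Q) := by simp [hh0.le]
          rw [h2] at h1
          refine h1.congr fun s hs => ?_
          dsimp only
          rw [kernelOp, integral_apply_stepFun (hki s hs) hh0 ht01 w,
            ← intervalIntegral.integral_of_le hh0.le, intervalIntegral.integral_finsetSum
              fun j _ => (hksh s hs (j + 1) (w j)).sub (hksh s hs j (w j))]
          exact Finset.sum_congr rfl fun j _ =>
            intervalIntegral.integral_sub (hksh s hs (j + 1) (w j)) (hksh s hs j (w j))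
        · exact integrable_finsetSum _ fun j _ =>
            ((hksh s hs (j + 1) (w j)).sub (hksh s hs j (w j))).1
        · filter_upwards [ae_restrict_mem measurableSet_Ioc] with θ hθ
          exact hkL n (fun j => t j + θ) (fun i j hij => add_le_add_left (htm hij) θ)
            (fun j => ⟨by linarith [(ht01 j).1, hθ.1], by linarith [(ht01 j).2, hθ.2]⟩) w _
            (Real.sqrt_nonneg _) (Real.sq_sqrt hQ0).ge
      have hle := hF.bound _ _ (hk.continuousOn_kernelOp (hmem.integrable one_le_two)) hV
      rw [hFQ, Complex.norm_real, Real.norm_of_nonneg hQ0] at hle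
      have e2 : ∀ j, ‖h⁻¹ • H h (t (j + 1)) - h⁻¹ • H h (t j)‖ ^ 2 = h⁻¹ ^ 2 * ‖w j‖ ^ 2 :=
        fun j => by
          rw [← smul_sub, norm_smul, mul_pow, Real.norm_eq_abs, sq_abs]
      simp only [e2, ← Finset.mul_sum]
      have hs : √Q ≤ N * (h * L) := by
        rcases (Real.sqrt_nonneg Q).eq_or_lt with h0 | h0
        · rw [← h0]
          exact mul_nonneg hF.nonneg (mul_nonneg hh0.le hL)
        · refine le_of_mul_le_mul_right ?_ h0
          rw [Real.mul_self_sqrt hQ0]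
          exact hle.trans (le_of_eq (by ring))
      have hQ2 : Q ≤ (N * (h * L)) ^ 2 := by
        rw [← Real.sq_sqrt hQ0]
        exact pow_le_pow_left₀ (Real.sqrt_nonneg _) hs 2
      calc h⁻¹ ^ 2 * Q ≤ h⁻¹ ^ 2 * (N * (h * L)) ^ 2 := by gcongr
        _ = _ := by field_simp
    refine le_of_tendsto (tendsto_finsetSum _ fun j _ => ?_) hfin
    exact ((hHlim (j + 1)).sub (hHlim j)).norm.pow 2
  obtain ⟨u, hu, hur, huR, huv⟩ := exists_rightContinuous_representative hGae
    (fun t ht => ht.2.1) hvar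
  refine ⟨u, hur, huR, huv, fun φ hφ => ?_⟩
  rw [hg φ hφ]
  refine integral_congr_ae ((ae_restrict_iff' measurableSet_Ioo).2 ?_)
  filter_upwards [hu] with t ht ht01
  rw [ht ht01]

end KernelOperator

/-! ### The transport equation for one half of the kernel and its error kernel. -/

section FlatKernel

variable {X : Type*} [NormedAddCommGroup X] [InnerProductSpace ℂ X] [CompleteSpace X]
variable {κ c : ℕ → ℝ → ℝ} {ε : ℝ}

theorem commute_cfc_self (f : ℝ → ℝ) {B : X →L[ℂ] X} (hB : IsSelfAdjoint B) :
    Commute (cfc f B) B := by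
  simpa only [cfc_id' ℝ B hB] using cfc_commute_cfc f (fun ξ => ξ) B

theorem HasDerivAt.clm_apply_of_real {L : ℝ → X →L[ℂ] X} {L' : X →L[ℂ] X} {v : ℝ → X} {v' : X}
    {t : ℝ} (hL : HasDerivAt L L' t) (hv : HasDerivAt v v' t) :
    HasDerivAt (fun t => L t (v t)) (L' (v t) + L t v') t :=
  ((ContinuousLinearMap.restrictScalarsL ℂ X X ℝ ℝ).hasFDerivAt.comp_hasDerivAt t hL).clm_apply hv

theorem IsRelLipschitz.continuous {b : ℝ → X →L[ℂ] X} {C : ℝ} (hb : IsRelLipschitz b C) :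
    Continuous b := by
  refine continuous_iff_continuousAt.2 fun s => ?_
  rw [ContinuousAt, tendsto_iff_norm_sub_tendsto_zero]
  have hC := hb.nonneg
  have h : ∀ t, ‖b t - b s‖ ≤ C * |t - s| * (‖b s‖ + 1) := fun t =>
    ContinuousLinearMap.opNorm_le_bound _ (by positivity) fun x => by
      refine (hb.lip t s x).trans ?_
      have := (b s).le_opNorm x
      calc _ ≤ C * |t - s| * (‖b s‖ * ‖x‖ + ‖x‖) := by gcongr
        _ = _ := by ring
  refine squeeze_zero (fun _ => norm_nonneg _) h ?_
  have : Continuous fun t => C * |t - s| * (‖b s‖ + 1) := by fun_prop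
  simpa using this.tendsto s

theorem IsRelLipschitz.exists_lipschitz_ball {b : ℝ → X →L[ℂ] X} {C : ℝ}
    (hb : IsRelLipschitz b C) (t₀ : ℝ) : ∃ L, 0 ≤ L ∧ ∀ t ∈ Metric.ball t₀ 1,
      ∀ t' ∈ Metric.ball t₀ 1, ‖b t - b t'‖ ≤ L * |t - t'| := by
  obtain ⟨M, hM⟩ := (isCompact_closedBall t₀ 1).exists_bound_of_continuousOn
    hb.continuous.continuousOn
  have hC := hb.nonneg
  have hM0 : 0 ≤ M := (norm_nonneg _).trans (hM t₀ (by simp))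
  refine ⟨C * (M + 1), by positivity, fun t _ t' ht' => ?_⟩
  refine ContinuousLinearMap.opNorm_le_bound _ (by positivity) fun x => ?_
  refine (hb.lip t t' x).trans ?_
  have h1 := (b t').le_of_opNorm_le (hM t' (Metric.ball_subset_closedBall ht')) x
  calc _ ≤ C * |t - t'| * (M * ‖x‖ + ‖x‖) := by gcongr
    _ = _ := by ring

theorem measurable_halfSemigroup (c : ℕ → ℝ → ℝ) (ε : ℝ) {b : ℝ → X →L[ℂ] X}
    (hb : ∀ t, IsSelfAdjoint (b t)) (j : ℕ) (s : ℝ) :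
    StronglyMeasurable fun t => halfSemigroup c ε b j t s := by
  simp only [halfSemigroup, cfc_exp_mul (hb s)]
  let +nondep : NormedAlgebra ℚ (X →L[ℂ] X) := .restrictScalars ℚ ℂ _
  have h1 : Continuous fun t => NormedSpace.exp ((t - s) • b s) * cfc (c j) (b s) :=
    (NormedSpace.exp_continuous.comp (by fun_prop)).mul continuous_const
  exact h1.stronglyMeasurable.ite (measurableSet_lt (by fun_prop) (by fun_prop))
    stronglyMeasurable_const

namespace HalfPartition

variable {A : ℝ} {b : ℝ → X →L[ℂ] X} {C : ℝ}

theorem continuous_cfc (hp : HalfPartition κ c ε A) (hb : IsRelLipschitz b C) (j : ℕ) :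
    Continuous fun t => cfc (c j) (b t) := by
  have hA := hp.nonneg
  have hC := hb.nonneg
  refine continuous_iff_continuousAt.2 fun s => ?_
  rw [ContinuousAt, tendsto_iff_norm_sub_tendsto_zero]
  have h : ∀ t, ‖cfc (c j) (b t) - cfc (c j) (b s)‖ ≤ 20480 * A * A * (C * |t - s|) := fun t =>
    ContinuousLinearMap.opNorm_le_bound _ (by positivity) fun x => by
      refine (abs_le_of_sq_le_sq' ?_ (by positivity)).2
      have h2 := hp.sum_norm_cfc_sub_sq_le hb hp.isDyadicFamily (j + 1) t s x
      rw [mul_pow]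
      refine le_trans ?_ h2
      exact Finset.single_le_sum (f := fun j => ‖(cfc (c j) (b t) - cfc (c j) (b s)) x‖ ^ 2)
        (fun _ _ => by positivity) (Finset.self_mem_range_succ j)
  refine squeeze_zero (fun _ => norm_nonneg _) h ?_
  have : Continuous fun t => 20480 * A * A * (C * |t - s|) := by fun_prop
  simpa using this.tendsto s

theorem continuousOn_halfSemigroup (hp : HalfPartition κ c ε A) (hb : IsRelLipschitz b C) (j : ℕ)
    (t : ℝ) : ContinuousOn (halfSemigroup c ε b j t) {t}ᶜ := by
  let +nondep : NormedAlgebra ℚ (X →L[ℂ] X) := .restrictScalars ℚ ℂ _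
  have hc : Continuous fun s =>
      cfc (fun ξ : ℝ => Real.exp ((t - s) * ξ)) (b s) * cfc (c j) (b s) := by
    simp only [fun s => cfc_exp_mul (hb.selfAdjoint s) (t - s)]
    have := hb.continuous
    exact (NormedSpace.exp_continuous.comp (by fun_prop)).mul (hp.continuous_cfc hb j)
  intro s hs
  have hne : s ≠ t := hs
  have hε : ε ≠ 0 := by rcases hp.cutoff.sign with h | h <;> simp [h]
  have hcs : Continuous fun s : ℝ => ε * (t - s) := by fun_prop
  refine ContinuousAt.continuousWithinAt ?_
  rcases lt_or_gt_of_ne (mul_ne_zero hε (sub_ne_zero.2 hne.symm)) with h | h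
  · refine continuousAt_const.congr (f := fun _ => (0 : X →L[ℂ] X)) ?_
    filter_upwards [hcs.continuousAt.eventually_lt continuousAt_const h] with s' hs'
    rw [halfSemigroup, if_neg (not_lt.2 (le_of_lt hs'))]
  · refine hc.continuousAt.congr ?_
    filter_upwards [continuousAt_const.eventually_lt hcs.continuousAt h] with s' hs'
    rw [halfSemigroup, if_pos hs']

theorem isVariationKernel_halfKernel (hp : HalfPartition κ c ε A) (hb : IsRelLipschitz b C)
    (J : ℕ) : IsVariationKernel (halfKernel c ε b J) (6 * kernelConst A C * A) where
  nonneg := mul_nonneg (mul_nonneg (by norm_num) (kernelConst_nonneg hp.nonneg hb.nonneg)) hp.nonneg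
  v2Le t ht x := hp.v2Le_halfKernel hb J (Ioo_subset_Icc_self ht) x
  measurable s _ := by
    refine StronglyMeasurable.aestronglyMeasurable ?_
    refine Finset.stronglyMeasurable_fun_sum _ fun j _ => ?_
    exact (measurable_halfSemigroup c ε hb.selfAdjoint j s).mul
      (hp.continuous_cfc hb j).stronglyMeasurable
  continuousOn t _ := by
    refine continuousOn_finsetSum _ fun j _ => ?_
    exact ((hp.continuousOn_halfSemigroup hb j t).mono fun s hs => hs.2).mul continuousOn_const

theorem differentiableAt_cfc_comp (hp : HalfPartition κ c ε A) (hb : IsRelLipschitz b C) (j : ℕ)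
    {t : ℝ} (hd : DifferentiableAt ℝ b t) : DifferentiableAt ℝ (fun t => cfc (c j) (b t)) t := by
  obtain ⟨L, hL0, hL⟩ := hb.exists_lipschitz_ball t
  exact differentiableAt_cfc (hp.cutoff.smooth j) (hasCompactSupport_of_ne_zero
    (fun _ h => hp.part.abs_le_of_ne_zero (hp.isDyadicFamily.ne_zero h))) hb.selfAdjoint hL0 hd hL

/-- The square function Lipschitz estimate for difference quotients passes to the limit. -/
theorem sum_norm_deriv_cfc_sq_le (hp : HalfPartition κ c ε A) (hb : IsRelLipschitz b C) (J : ℕ)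
    {t : ℝ} (hd : DifferentiableAt ℝ b t) (x : X) :
    ∑ j ∈ Finset.range J, ‖deriv (fun t => cfc (c j) (b t)) t x‖ ^ 2 ≤
      (20480 * A * A * C * ‖x‖) ^ 2 := by
  have hlim : ∀ j, Filter.Tendsto (fun h : ℝ => (h⁻¹ • (cfc (c j) (b (t + h)) - cfc (c j) (b t))) x)
      (nhdsWithin 0 {0}ᶜ) (nhds (deriv (fun t => cfc (c j) (b t)) t x)) := fun j =>
    ((ContinuousLinearMap.apply ℂ X x).continuous.tendsto _).comp
      (hp.differentiableAt_cfc_comp hb j hd).hasDerivAt.tendsto_slope_zero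
  refine le_of_tendsto (tendsto_finsetSum _ fun j _ => (hlim j).norm.pow 2) ?_
  filter_upwards [self_mem_nhdsWithin] with h hh
  have hne : h ≠ 0 := hh
  have h2 := hp.sum_norm_cfc_sub_sq_le hb hp.isDyadicFamily J (t + h) t x
  simp only [smul_apply, norm_smul, mul_pow, ← Finset.mul_sum, norm_inv, Real.norm_eq_abs] at h2 ⊢
  rw [add_sub_cancel_left] at h2
  refine (mul_le_mul_of_nonneg_left h2 (by positivity)).trans (le_of_eq ?_)
  have : |h| ≠ 0 := abs_ne_zero.2 hne
  field_simp

theorem aestronglyMeasurable_deriv_cfc (hp : HalfPartition κ c ε A) (hb : IsRelLipschitz b C)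
    (hd : ∀ t ∈ Ioo (0 : ℝ) 1, DifferentiableAt ℝ b t) (j : ℕ) :
    AEStronglyMeasurable (fun t => deriv (fun t => cfc (c j) (b t)) t)
      (volume.restrict (Ioo 0 1)) := by
  have hc := hp.continuous_cfc hb j
  have hseq : Filter.Tendsto (fun n : ℕ => (1 : ℝ) / (n + 1)) Filter.atTop
      (nhdsWithin 0 {0}ᶜ) := tendsto_nhdsWithin_iff.2
    ⟨tendsto_one_div_add_atTop_nhds_zero_nat, .of_forall fun n => by
      simp only [mem_compl_iff, mem_singleton_iff]; positivity⟩
  refine aestronglyMeasurable_of_tendsto_ae Filter.atTop (f := fun (n : ℕ) t =>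
    ((1 : ℝ) / (n + 1))⁻¹ • (cfc (c j) (b (t + 1 / (n + 1))) - cfc (c j) (b t))) (fun n => ?_) ?_
  · have h1 : Continuous fun t => cfc (c j) (b (t + 1 / ((n : ℝ) + 1))) :=
      hc.comp (continuous_id.add continuous_const)
    exact ((h1.sub hc).const_smul ((1 : ℝ) / (n + 1))⁻¹).aestronglyMeasurable
  · filter_upwards [ae_restrict_mem measurableSet_Ioo] with t ht
    exact (hp.differentiableAt_cfc_comp hb j (hd t ht)).hasDerivAt.tendsto_slope_zero.comp hseq

/-- The error kernel of one half of the parametrix. -/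
noncomputable def _root_.errorKernel (c : ℕ → ℝ → ℝ) (ε : ℝ) (b : ℝ → X →L[ℂ] X) (J : ℕ)
    (t s : ℝ) : X →L[ℂ] X :=
  ∑ j ∈ Finset.range J, halfSemigroup c ε b j t s *
    (deriv (fun t => cfc (c j) (b t)) t + (b s - b t) * cfc (c j) (b t))

/-- The constant in the bound for the error kernel. -/
noncomputable def _root_.errorConst (A C : ℝ) : ℝ :=
  6 * kernelConst A C * (20480 * A * A * C) + kernelConst A C * (90 * (C * (1 + C)) * A)

theorem isVariationKernel_errorKernel (hp : HalfPartition κ c ε A) (hb : IsRelLipschitz b C)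
    (hd : ∀ t ∈ Ioo (0 : ℝ) 1, DifferentiableAt ℝ b t) (J : ℕ) :
    IsVariationKernel (errorKernel c ε b J) (errorConst A C) where
  nonneg := by
    have := kernelConst_nonneg hp.nonneg hb.nonneg
    have := hp.nonneg
    have := hb.nonneg
    unfold errorConst
    positivity
  v2Le t ht x := by
    have hA := hp.nonneg
    have hC := hb.nonneg
    have h1 := hp.v2Le_sum_halfSemigroup_const hb J (Ioo_subset_Icc_self ht)
      (by positivity) (hp.sum_norm_deriv_cfc_sq_le hb J (hd t ht) x)
    have h2 := hp.v2Le_sum_halfSemigroup_sub hb J (Ioo_subset_Icc_self ht) x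
    refine ((h1.add h2).mono (le_of_eq (by unfold errorConst; ring))).congr fun s _ => ?_
    simp [errorKernel, sum_apply, mul_apply_eq_comp, Finset.sum_add_distrib]
  measurable s _ := by
    refine Finset.aestronglyMeasurable_fun_sum _ fun j _ => ?_
    refine (measurable_halfSemigroup c ε hb.selfAdjoint j s).aestronglyMeasurable.mul ?_
    refine (hp.aestronglyMeasurable_deriv_cfc hb hd j).add ?_
    exact ((continuous_const.sub hb.continuous).mul (hp.continuous_cfc hb j)).aestronglyMeasurable
  continuousOn t _ := by
    refine continuousOn_finsetSum _ fun j _ => ?_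
    refine ((hp.continuousOn_halfSemigroup hb j t).mono fun s hs => hs.2).mul ?_
    exact (continuousOn_const.add
      ((hb.continuous.sub continuous_const).mul continuous_const).continuousOn)

/-- The value of a half of the parametrix on `ψ' + b ψ`. -/
theorem kernelOp_halfKernel_add (hp : HalfPartition κ c ε A) (hb : IsRelLipschitz b C)
    (hd : ∀ t ∈ Ioo (0 : ℝ) 1, DifferentiableAt ℝ b t) (J : ℕ) {ψ ψ' : ℝ → X}
    (hψ : Continuous ψ) (hψ' : ∀ t ∈ Ioo (0 : ℝ) 1, HasDerivAt ψ (ψ' t) t)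
    (hi : IntegrableOn ψ' (Ioo 0 1)) (h0 : ψ 0 = 0) (h1 : ψ 1 = 0) {s : ℝ}
    (hs : s ∈ Icc (0 : ℝ) 1) :
    kernelOp (halfKernel c ε b J) (fun t => ψ' t + b t (ψ t)) s +
      kernelOp (errorKernel c ε b J) ψ s =
      -ε • ∑ j ∈ Finset.range J, cfc (c j) (b s) (cfc (c j) (b s) (ψ s)) := by
  let +nondep : NormedAlgebra ℚ (X →L[ℂ] X) := .restrictScalars ℚ ℂ _
  have hψi : IntegrableOn ψ (Ioo 0 1) :=
    (hψ.integrableOn_Icc (a := 0) (b := 1)).mono_set Ioo_subset_Icc_self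
  have hbψ : Continuous fun t => b t (ψ t) := hb.continuous.clm_apply hψ
  have hbψi : IntegrableOn (fun t => b t (ψ t)) (Ioo 0 1) :=
    (hbψ.integrableOn_Icc (a := 0) (b := 1)).mono_set Ioo_subset_Icc_self
  set Q : ℝ → X := fun t => ∑ j ∈ Finset.range J, cfc (c j) (b s) (cfc (c j) (b t) (ψ t)) with hQ
  set Q' : ℝ → X := fun t => ∑ j ∈ Finset.range J, cfc (c j) (b s)
    (deriv (fun t => cfc (c j) (b t)) t (ψ t) + cfc (c j) (b t) (ψ' t)) with hQ'
  set E : ℝ → X →L[ℂ] X := fun t => NormedSpace.exp ((t - s) • b s) with hE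
  set G' : ℝ → X := fun t => (E t * b s) (Q t) + E t (Q' t) with hG'
  have hEd : ∀ t, HasDerivAt E (E t * b s) t := fun t =>
    (hasDerivAt_exp_smul_const (𝕂 := ℝ) (b s) (t - s)).comp_sub_const t s
  have hQd : ∀ t ∈ Ioo (0 : ℝ) 1, HasDerivAt Q (Q' t) t := fun t ht =>
    HasDerivAt.fun_sum fun j _ =>
      ((cfc (c j) (b s)).restrictScalars ℝ).hasFDerivAt.comp_hasDerivAt t
        ((hp.differentiableAt_cfc_comp hb j (hd t ht)).hasDerivAt.clm_apply_of_real (hψ' t ht))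
  have hGd : ∀ t ∈ Ioo (0 : ℝ) 1, HasDerivAt (fun t => E t (Q t)) (G' t) t := fun t ht =>
    (hEd t).clm_apply_of_real (hQd t ht)
  have hQc : Continuous Q := continuous_finsetSum _ fun j _ =>
    (cfc (c j) (b s)).continuous.comp ((hp.continuous_cfc hb j).clm_apply hψ)
  have hGc : Continuous fun t => E t (Q t) :=
    (NormedSpace.exp_continuous.comp (by fun_prop)).clm_apply hQc
  -- The `t`-derivative of the exponential produces `b s`, whereas the halfKernel term contains `b
  -- t`. The term `b s - b t` in the error kernel makes up the difference, once the cut-offs are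
  -- commuted past `b t` and `b s`.
  have hkey : ∀ t, halfKernel c ε b J t s (ψ' t + b t (ψ t)) + errorKernel c ε b J t s (ψ t) =
      {t | 0 < ε * (t - s)}.indicator G' t := by
    intro t
    by_cases ht : 0 < ε * (t - s)
    · rw [indicator_of_mem (by exact ht)]
      simp only [halfKernel, errorKernel, halfSemigroup, if_pos ht, cfc_exp_mul (hb.selfAdjoint s),
        sum_apply, mul_apply_eq_comp, hG', hQ, hQ', map_sum, ← Finset.sum_add_distrib, add_apply,
        sub_apply]
      refine Finset.sum_congr rfl fun j _ => ?_
      have e1 : cfc (c j) (b t) (b t (ψ t)) = b t (cfc (c j) (b t) (ψ t)) :=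
        DFunLike.congr_fun (commute_cfc_self (c j) (hb.selfAdjoint t)).eq (ψ t)
      have e2 : ∀ y, cfc (c j) (b s) (b s y) = b s (cfc (c j) (b s) y) := fun y =>
        DFunLike.congr_fun (commute_cfc_self (c j) (hb.selfAdjoint s)).eq y
      simp only [map_add, map_sub, e1, e2]
      abel
    · rw [indicator_of_notMem (by exact ht)]
      simp [halfKernel, errorKernel, halfSemigroup, if_neg ht]
  have hk := hp.isVariationKernel_halfKernel hb J
  have he := hp.isVariationKernel_errorKernel hb hd J
  have hmeas : MeasurableSet {t : ℝ | 0 < ε * (t - s)} :=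
    measurableSet_lt (by fun_prop) (by fun_prop)
  have hφi : IntegrableOn (fun t => ψ' t + b t (ψ t)) (Ioo 0 1) := hi.add hbψi
  have hint := (hk.integrable_apply hs hφi).add (he.integrable_apply hs hψi)
  have hint' : IntegrableOn ({t | 0 < ε * (t - s)}.indicator G') (Ioo 0 1) :=
    hint.congr (.of_forall hkey)
  unfold kernelOp
  rw [← integral_add (hk.integrable_apply hs hφi) (he.integrable_apply hs hψi)]
  have e3 : ∫ t in Ioo (0 : ℝ) 1, (halfKernel c ε b J t s (ψ' t + b t (ψ t)) +
      errorKernel c ε b J t s (ψ t)) = ∫ t in Ioo 0 1 ∩ {t | 0 < ε * (t - s)}, G' t := by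
    rw [← setIntegral_indicator hmeas]
    exact integral_congr_ae (.of_forall hkey)
  -- Continuity of `G'` is not available; its integrability is inherited from the two kernels.
  have hint2 : IntegrableOn G' (Ioo 0 1 ∩ {t | 0 < ε * (t - s)}) := by
    rw [inter_comm]
    exact (integrableOn_indicator_iff hmeas).1 hint'
  have hGs : E s (Q s) = ∑ j ∈ Finset.range J, cfc (c j) (b s) (cfc (c j) (b s) (ψ s)) := by
    simp [hE, hQ]
  refine e3.trans ?_
  rw [← hGs]
  -- The integration runs over `(s,1)` or `(0,s)`. At the outer end `ψ` vanishes, and the end `t =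
  -- s` contributes with sign `-ε`.
  rcases hp.cutoff.sign with rfl | rfl
  · have hset : Ioo 0 1 ∩ {t : ℝ | 0 < 1 * (t - s)} = Ioo s 1 := by
      ext t
      simp only [mem_inter_iff, mem_Ioo, mem_ofPred_eq]
      constructor
      · rintro ⟨h, h'⟩; exact ⟨by linarith, h.2⟩
      · rintro ⟨h, h'⟩; exact ⟨⟨hs.1.trans_lt h, h'⟩, by linarith⟩
    rw [hset] at hint2 ⊢
    rw [← integral_Ioc_eq_integral_Ioo, ← intervalIntegral.integral_of_le hs.2,
      intervalIntegral.integral_eq_sub_of_hasDerivAt_of_le hs.2 hGc.continuousOn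
        (fun t ht => hGd t ⟨hs.1.trans_lt ht.1, ht.2⟩)
        ((intervalIntegrable_iff_integrableOn_Ioo_of_le hs.2).2 hint2)]
    simp [hQ, h1]
  · have hset : Ioo 0 1 ∩ {t : ℝ | 0 < -1 * (t - s)} = Ioo 0 s := by
      ext t
      simp only [mem_inter_iff, mem_Ioo, mem_ofPred_eq]
      constructor
      · rintro ⟨h, h'⟩; exact ⟨h.1, by linarith⟩
      · rintro ⟨h, h'⟩; exact ⟨⟨h, h'.trans_le hs.2⟩, by linarith⟩
    rw [hset] at hint2 ⊢
    rw [← integral_Ioc_eq_integral_Ioo, ← intervalIntegral.integral_of_le hs.1,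
      intervalIntegral.integral_eq_sub_of_hasDerivAt_of_le hs.1 hGc.continuousOn
        (fun t ht => hGd t ⟨ht.1, ht.2.trans_le hs.2⟩)
        ((intervalIntegrable_iff_integrableOn_Ioo_of_le hs.1).2 hint2)]
    simp [hQ, h0]

end HalfPartition

end FlatKernel

/-! ### The full parametrix in moving coordinates. -/

section FlatParametrix

variable {X : Type*} [NormedAddCommGroup X] [InnerProductSpace ℂ X] [CompleteSpace X]
variable {κ : ℕ → ℝ → ℝ}

/-- The adjoint kernel of the parametrix along the flow. -/
noncomputable def flatKernel (κ : ℕ → ℝ → ℝ) (b : ℝ → X →L[ℂ] X) (J : ℕ) (t s : ℝ) : X →L[ℂ] X :=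
  halfKernel (kappaMinus κ) 1 b J t s - halfKernel (kappaPlus κ) (-1) b J t s

/-- A dyadic partition with a constant that serves both of its halves. -/
structure IsPartitionConst (κ : ℕ → ℝ → ℝ) (A : ℝ) : Prop where
  minus : HalfPartition κ (kappaMinus κ) 1 A
  plus : HalfPartition κ (kappaPlus κ) (-1) A

theorem IsDyadicPartition.exists_isPartitionConst (hκ : IsDyadicPartition κ) :
    ∃ A, IsPartitionConst κ A := by
  obtain ⟨A, hA⟩ := hκ.exists_halfPartition
  exact ⟨A, hA _ _ (isHalfCutoff_kappaMinus hκ), hA _ _ (isHalfCutoff_kappaPlus hκ)⟩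

variable {A C : ℝ} {b : ℝ → X →L[ℂ] X}

/-- The constant in the bounds for the parametrix. -/
noncomputable def parametrixConst (A C : ℝ) : ℝ :=
  12 * kernelConst A C * A * (1 + 20480 * A * C)

namespace IsPartitionConst

theorem isVariationKernel_flatKernel (hp : IsPartitionConst κ A) (hb : IsRelLipschitz b C)
    (J : ℕ) : IsVariationKernel (flatKernel κ b J) (12 * kernelConst A C * A) := by
  have := (hp.minus.isVariationKernel_halfKernel hb J).sub (hp.plus.isVariationKernel_halfKernel hb J)
  rwa [show 6 * kernelConst A C * A + 6 * kernelConst A C * A = 12 * kernelConst A C * A by ring]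
    at this

theorem v2Le_sum_flatKernel_sub (hp : IsPartitionConst κ A) (hb : IsRelLipschitz b C)
    (J n : ℕ) (t : ℕ → ℝ) (ht : Monotone t) (ht' : ∀ k, t k ∈ Icc (0 : ℝ) 1) (w : ℕ → X)
    (R : ℝ) (hR : 0 ≤ R) (hw : ∑ k ∈ Finset.range n, ‖w k‖ ^ 2 ≤ R ^ 2) :
    V2Le (fun s => ∑ k ∈ Finset.range n,
      (flatKernel κ b J (t (k + 1)) s (w k) - flatKernel κ b J (t k) s (w k)))
      (parametrixConst A C * R) := by
  refine (((hp.minus.v2Le_sum_halfKernel_sub hb J ht ht' n w hR hw).sub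
    (hp.plus.v2Le_sum_halfKernel_sub hb J ht ht' n w hR hw)).mono (le_of_eq ?_)).congr fun s _ => ?_
  · unfold parametrixConst; ring
  · dsimp only
    rw [← Finset.sum_sub_distrib]
    refine Finset.sum_congr rfl fun k _ => ?_
    simp only [flatKernel, sub_apply]
    abel

theorem isVariationKernel_errorKernel (hp : IsPartitionConst κ A) (hb : IsRelLipschitz b C)
    (hd : ∀ t ∈ Ioo (0 : ℝ) 1, DifferentiableAt ℝ b t) (J : ℕ) :
    IsVariationKernel (fun t s => errorKernel (kappaMinus κ) 1 b J t s -
      errorKernel (kappaPlus κ) (-1) b J t s) (errorConst A C + errorConst A C) :=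
  (hp.minus.isVariationKernel_errorKernel hb hd J).sub (hp.plus.isVariationKernel_errorKernel hb hd J)

theorem sum_cfc_kappa_sq_apply (hp : IsPartitionConst κ A) {B : X →L[ℂ] X} (hB : IsSelfAdjoint B)
    {J : ℕ} (hJ : J ≠ 0) (hBJ : ‖B‖ < 2 ^ J) (x : X) :
    ∑ j ∈ Finset.range J, cfc (kappaMinus κ j) B (cfc (kappaMinus κ j) B x) +
      ∑ j ∈ Finset.range J, cfc (kappaPlus κ j) B (cfc (kappaPlus κ j) B x) = x := by
  have hm : ∀ j, ContinuousOn (kappaMinus κ j) (spectrum ℝ B) := fun j =>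
    (hp.minus.cutoff.smooth j).continuous.continuousOn
  have hpl : ∀ j, ContinuousOn (kappaPlus κ j) (spectrum ℝ B) := fun j =>
    (hp.plus.cutoff.smooth j).continuous.continuousOn
  have h1 : ∑ j ∈ Finset.range J, (cfc (kappaMinus κ j) B * cfc (kappaMinus κ j) B +
      cfc (kappaPlus κ j) B * cfc (kappaPlus κ j) B) = 1 := by
    have e : ∀ j, cfc (kappaMinus κ j) B * cfc (kappaMinus κ j) B +
        cfc (kappaPlus κ j) B * cfc (kappaPlus κ j) B =
        cfc (fun ξ => kappaMinus κ j ξ * kappaMinus κ j ξ + kappaPlus κ j ξ * kappaPlus κ j ξ) B :=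
      fun j => by
        rw [cfc_add (a := B) (fun ξ => kappaMinus κ j ξ * kappaMinus κ j ξ)
          (fun ξ => kappaPlus κ j ξ * kappaPlus κ j ξ) ((hm j).mul (hm j)) ((hpl j).mul (hpl j)),
          cfc_mul _ _ B (hm j) (hm j), cfc_mul _ _ B (hpl j) (hpl j)]
    simp only [e]
    rw [← cfc_one ℝ B, ← cfc_sum (fun j ξ => kappaMinus κ j ξ * kappaMinus κ j ξ +
      kappaPlus κ j ξ * kappaPlus κ j ξ) B _ fun j _ =>
        ((hm j).mul (hm j)).add ((hpl j).mul (hpl j))]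
    refine cfc_congr fun ξ hξ => ?_
    simp only [Finset.sum_apply, Pi.one_apply]
    rw [← hp.minus.part.sum_range_sq_eq_one
      ((abs_le_norm_of_mem_spectrum hξ).trans_lt hBJ) hJ]
    refine Finset.sum_congr rfl fun j _ => ?_
    rw [← kappaMinus_sq_add_kappaPlus_sq hp.minus.part]
    ring
  have h2 := DFunLike.congr_fun h1 x
  simp only [sum_apply, add_apply, mul_apply_eq_comp, Finset.sum_add_distrib] at h2
  exact h2

/-- The kernel is the difference of its halves and their boundary terms have opposite signs, so the
squares of both families of cut-offs add up, to the identity once `2^J > ‖b s‖`. -/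
theorem kernelOp_flatKernel_add (hp : IsPartitionConst κ A) (hb : IsRelLipschitz b C)
    (hd : ∀ t ∈ Ioo (0 : ℝ) 1, DifferentiableAt ℝ b t) {J : ℕ} (hJ : J ≠ 0)
    (hbJ : ∀ t ∈ Icc (0 : ℝ) 1, ‖b t‖ < 2 ^ J) {ψ ψ' : ℝ → X}
    (hψ : Continuous ψ) (hψ' : ∀ t ∈ Ioo (0 : ℝ) 1, HasDerivAt ψ (ψ' t) t)
    (hi : IntegrableOn ψ' (Ioo 0 1)) (h0 : ψ 0 = 0) (h1 : ψ 1 = 0) {s : ℝ}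
    (hs : s ∈ Icc (0 : ℝ) 1) :
    kernelOp (flatKernel κ b J) (fun t => ψ' t + b t (ψ t)) s +
      kernelOp (fun t s => errorKernel (kappaMinus κ) 1 b J t s -
        errorKernel (kappaPlus κ) (-1) b J t s) ψ s = -ψ s := by
  have hψi : IntegrableOn ψ (Ioo 0 1) :=
    (hψ.integrableOn_Icc (a := 0) (b := 1)).mono_set Ioo_subset_Icc_self
  have hbψ : Continuous fun t => b t (ψ t) := hb.continuous.clm_apply hψ
  have hφi : IntegrableOn (fun t => ψ' t + b t (ψ t)) (Ioo 0 1) :=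
    hi.add ((hbψ.integrableOn_Icc (a := 0) (b := 1)).mono_set Ioo_subset_Icc_self)
  have e1 := hp.minus.kernelOp_halfKernel_add hb hd J hψ hψ' hi h0 h1 hs
  have e2 := hp.plus.kernelOp_halfKernel_add hb hd J hψ hψ' hi h0 h1 hs
  have e3 := hp.sum_cfc_kappa_sq_apply (hb.selfAdjoint s) hJ (hbJ s hs) (ψ s)
  have e4 : kernelOp (flatKernel κ b J) (fun t => ψ' t + b t (ψ t)) s =
      kernelOp (halfKernel (kappaMinus κ) 1 b J) (fun t => ψ' t + b t (ψ t)) s -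
      kernelOp (halfKernel (kappaPlus κ) (-1) b J) (fun t => ψ' t + b t (ψ t)) s :=
    integral_sub ((hp.minus.isVariationKernel_halfKernel hb J).integrable_apply hs hφi)
      ((hp.plus.isVariationKernel_halfKernel hb J).integrable_apply hs hφi)
  have e5 : kernelOp (fun t s => errorKernel (kappaMinus κ) 1 b J t s -
        errorKernel (kappaPlus κ) (-1) b J t s) ψ s =
      kernelOp (errorKernel (kappaMinus κ) 1 b J) ψ s -
      kernelOp (errorKernel (kappaPlus κ) (-1) b J) ψ s :=
    integral_sub ((hp.minus.isVariationKernel_errorKernel hb hd J).integrable_apply hs hψi)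
      ((hp.plus.isVariationKernel_errorKernel hb hd J).integrable_apply hs hψi)
  rw [neg_neg, one_smul] at e2
  rw [neg_one_smul] at e1
  rw [e4, e5, sub_add_sub_comm, e1, e2]
  nth_rewrite 3 [← e3]
  abel

/-- `u` and `g` represent `F` composed with the parametrix and with the error kernel. The weak
equation is `F` applied to the identity `kernelOp_flatKernel_add`. -/
theorem exists_parametrixImage (hp : IsPartitionConst κ A) (hb : IsRelLipschitz b C)
    (hd : ∀ t ∈ Ioo (0 : ℝ) 1, DifferentiableAt ℝ b t) {J : ℕ} (hJ : J ≠ 0)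
    (hbJ : ∀ t ∈ Icc (0 : ℝ) 1, ‖b t‖ < 2 ^ J) {F : (ℝ → X) → ℂ} {N : ℝ}
    (hF : IsVariationFunctional F N) :
    ∃ u g : ℝ → X, (∀ t ∈ Ico (0 : ℝ) 1, ContinuousWithinAt u (Ici t) t) ∧
      (∀ t ∈ Ico (0 : ℝ) 1, ‖u t‖ ≤ N * (12 * kernelConst A C * A)) ∧
      (∀ (n : ℕ) (t : ℕ → ℝ), Monotone t → (∀ j, t j ∈ Ico (0 : ℝ) 1) →
        ∑ j ∈ Finset.range n, ‖u (t (j + 1)) - u (t j)‖ ^ 2 ≤ (N * parametrixConst A C) ^ 2) ∧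
      (∀ φ, MemLp φ 2 (volume.restrict (Ioo 0 1)) →
        F (kernelOp (flatKernel κ b J) φ) = ∫ t in Ioo (0 : ℝ) 1, inner ℂ (u t) (φ t)) ∧
      StronglyMeasurable g ∧ (∀ᵐ t ∂volume.restrict (Ioo 0 1), ‖g t‖ ≤
        N * (errorConst A C + errorConst A C)) ∧
      ∀ ψ ψ' : ℝ → X, Continuous ψ → (∀ t ∈ Ioo (0 : ℝ) 1, HasDerivAt ψ (ψ' t) t) →
        MemLp ψ' 2 (volume.restrict (Ioo 0 1)) → ψ 0 = 0 → ψ 1 = 0 →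
        ∃ k, V2Le ψ k ∧ -(∫ t in Ioo (0 : ℝ) 1, inner ℂ (u t) (ψ' t + b t (ψ t))) - F ψ =
          ∫ t in Ioo (0 : ℝ) 1, inner ℂ (g t) (ψ t) := by
  have hk := hp.isVariationKernel_flatKernel hb J
  have he := hp.isVariationKernel_errorKernel hb hd J
  have hA := hp.minus.nonneg
  have hC := hb.nonneg
  have hK := kernelConst_nonneg hA hC
  obtain ⟨u, hu1, hu2, hu3, hu4⟩ := hk.exists_rightContinuous_representing
    (L := parametrixConst A C) (by unfold parametrixConst; positivity)
    (hp.v2Le_sum_flatKernel_sub hb J) hF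
  obtain ⟨g, hg1, hg2, hg3⟩ := he.exists_representing hF
  refine ⟨u, g, hu1, hu2, hu3, hu4, hg1, hg2, fun ψ ψ' hψ hψ' hi h0 h1 => ?_⟩
  have hcont : ∀ {v : ℝ → X}, Continuous v → MemLp v 2 (volume.restrict (Ioo 0 1)) := fun {v} hv => by
    obtain ⟨M, hM⟩ := (isCompact_Icc (a := (0 : ℝ)) (b := 1)).exists_bound_of_continuousOn
      hv.continuousOn
    refine MemLp.of_bound hv.aestronglyMeasurable M ?_
    filter_upwards [ae_restrict_mem measurableSet_Ioo] with t ht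
    exact hM t (Ioo_subset_Icc_self ht)
  have hφ : MemLp (fun t => ψ' t + b t (ψ t)) 2 (volume.restrict (Ioo 0 1)) :=
    hi.add (hcont (hb.continuous.clm_apply hψ))
  have hφi := hφ.integrable one_le_two
  have hψi := (hcont hψ).integrable one_le_two
  have hid := fun s (hs : s ∈ Icc (0 : ℝ) 1) =>
    hp.kernelOp_flatKernel_add hb hd hJ hbJ hψ hψ' (hi.integrable one_le_two) h0 h1 hs
  have hV1 := hk.v2Le_kernelOp hφi
  have hV2 := he.v2Le_kernelOp hψi
  have hc1 := hk.continuousOn_kernelOp hφi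
  have hc2 := he.continuousOn_kernelOp hψi
  -- The same identity shows that the test function has finite 2-variation, so `F ψ` is covered by
  -- the bounds for `F`.
  have hV := ((hV1.add hV2).const_smul (-1)).congr (v := ψ) fun s hs => by
    dsimp only
    rw [hid s hs]; simp
  refine ⟨_, hV, ?_⟩
  rw [← hu4 _ hφ, ← hg3 _ (hcont hψ)]
  have e1 := hF.add _ _ _ _ hc1 hc2 hV1 hV2
  have e2 := hF.smul (-1) _ _ (hc1.add hc2) (hV1.add hV2)
  have e3 := hF.congr (v := ψ) ((hc1.add hc2).const_smul (-1 : ℂ)) ((hV1.add hV2).const_smul (-1))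
    fun s hs => by
      simp only [Pi.add_apply, Pi.smul_apply]
      rw [hid s hs]; simp
  have e4 : F (fun s => (-1 : ℂ) • (kernelOp (flatKernel κ b J) (fun t => ψ' t + b t (ψ t)) s +
      kernelOp (fun t s => errorKernel (kappaMinus κ) 1 b J t s -
        errorKernel (kappaPlus κ) (-1) b J t s) ψ s)) = F ψ := e3
  rw [← e4]
  linear_combination e1 - e2

end IsPartitionConst

end FlatParametrix

/-! ### Unitarity of the evolution and conjugation to moving coordinates. -/

section Flow

variable {X : Type*} [NormedAddCommGroup X] [InnerProductSpace ℂ X] [CompleteSpace X]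

/-- `P* Q` is constant for two solutions `P`, `Q` of the evolution equation. -/
theorem star_mul_eq_of_hasDerivWithinAt {A P Q : ℝ → X →L[ℂ] X}
    (hA : ∀ t ∈ Icc (0 : ℝ) 1, IsSelfAdjoint (A t))
    (hP : ∀ t ∈ Icc (0 : ℝ) 1, HasDerivWithinAt P ((-Complex.I) • (A t * P t)) (Icc 0 1) t)
    (hQ : ∀ t ∈ Icc (0 : ℝ) 1, HasDerivWithinAt Q ((-Complex.I) • (A t * Q t)) (Icc 0 1) t)
    {t s : ℝ} (ht : t ∈ Icc (0 : ℝ) 1) (hs : s ∈ Icc (0 : ℝ) 1) :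
    star (P t) * Q t = star (P s) * Q s := by
  have hd : ∀ r ∈ Icc (0 : ℝ) 1,
      HasDerivWithinAt (fun r => star (P r) * Q r) 0 (Icc 0 1) r := fun r hr => by
    have h := (hP r hr).star.mul (hQ r hr)
    refine h.congr_deriv ?_
    rw [star_smul, star_mul, (hA r hr).star_eq, star_neg, smul_mul_assoc, mul_smul_comm,
      mul_assoc, ← add_smul]
    simp
  have := (convex_Icc (0 : ℝ) 1).norm_image_sub_le_of_norm_hasDerivWithin_le (C := 0) hd
    (fun r _ => norm_zero.le) hs ht
  rw [zero_mul] at this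
  exact sub_eq_zero.1 (norm_le_zero_iff.1 this)

variable {A : ℝ → X →L[ℂ] X}

theorem star_evolution_mul_evolution (hA : ContinuousOn A (Icc 0 1))
    (hA' : ∀ t ∈ Icc (0 : ℝ) 1, IsSelfAdjoint (A t)) {t s : ℝ} (ht : t ∈ Icc (0 : ℝ) 1)
    (hs : s ∈ Icc (0 : ℝ) 1) : star (evolution A t s) * evolution A t s = 1 := by
  rw [star_mul_eq_of_hasDerivWithinAt hA' (fun r hr => hasDerivWithinAt_evolution hA hs hr)
    (fun r hr => hasDerivWithinAt_evolution hA hs hr) ht hs, evolution_self]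
  simp

theorem star_evolution_zero_mul_evolution (hA : ContinuousOn A (Icc 0 1))
    (hA' : ∀ t ∈ Icc (0 : ℝ) 1, IsSelfAdjoint (A t)) {t s : ℝ} (ht : t ∈ Icc (0 : ℝ) 1)
    (hs : s ∈ Icc (0 : ℝ) 1) :
    star (evolution A t 0) * evolution A t s = star (evolution A s 0) := by
  rw [star_mul_eq_of_hasDerivWithinAt hA'
    (fun r hr => hasDerivWithinAt_evolution hA (by simp) hr)
    (fun r hr => hasDerivWithinAt_evolution hA hs hr) ht hs, evolution_self, mul_one]

/-- Conservation of `P* Q` identifies `S(0,t)` with `S(t,0)*`; that `S(0,t)` is an isometry is then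
the second half of the unitarity of `S(t,0)`. -/
theorem evolution_mul_star (hA : ContinuousOn A (Icc 0 1))
    (hA' : ∀ t ∈ Icc (0 : ℝ) 1, IsSelfAdjoint (A t)) {t : ℝ} (ht : t ∈ Icc (0 : ℝ) 1) :
    evolution A t 0 * star (evolution A t 0) = 1 := by
  have h0 : (0 : ℝ) ∈ Icc (0 : ℝ) 1 := by simp
  have h1 := star_evolution_zero_mul_evolution hA hA' h0 ht
  rw [evolution_self, star_one, one_mul] at h1
  have h2 := star_evolution_mul_evolution hA hA' h0 ht
  rwa [h1, star_star] at h2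

/-- The evolution from time `0`, extended from `[0,1]` by constants. -/
noncomputable def flow (A : ℝ → X →L[ℂ] X) (t : ℝ) : X →L[ℂ] X :=
  evolution A (projIcc 0 1 zero_le_one t) 0

theorem projIcc_coe_eq {t : ℝ} (ht : t ∈ Icc (0 : ℝ) 1) :
    (projIcc (0 : ℝ) 1 zero_le_one t : ℝ) = t := by
  rw [projIcc_of_mem _ ht]

theorem flow_of_mem {t : ℝ} (ht : t ∈ Icc (0 : ℝ) 1) : flow A t = evolution A t 0 := by
  rw [flow, projIcc_coe_eq ht]

theorem flow_mem_unitary (hA : ContinuousOn A (Icc 0 1))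
    (hA' : ∀ t ∈ Icc (0 : ℝ) 1, IsSelfAdjoint (A t)) (t : ℝ) :
    flow A t ∈ unitary (X →L[ℂ] X) :=
  Unitary.mem_iff.2 ⟨star_evolution_mul_evolution hA hA' (Subtype.coe_prop _) (by simp),
    evolution_mul_star hA hA' (Subtype.coe_prop _)⟩

theorem evolution_eq_flow_mul (hA : ContinuousOn A (Icc 0 1))
    (hA' : ∀ t ∈ Icc (0 : ℝ) 1, IsSelfAdjoint (A t)) {t s : ℝ} (ht : t ∈ Icc (0 : ℝ) 1)
    (hs : s ∈ Icc (0 : ℝ) 1) : evolution A t s = flow A t * star (flow A s) := by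
  rw [flow_of_mem ht, flow_of_mem hs, ← star_evolution_zero_mul_evolution hA hA' ht hs,
    ← mul_assoc, evolution_mul_star hA hA' ht, one_mul]

theorem hasDerivWithinAt_flow (hA : ContinuousOn A (Icc 0 1)) {t : ℝ} (ht : t ∈ Icc (0 : ℝ) 1) :
    HasDerivWithinAt (flow A) ((-Complex.I) • (A t * flow A t)) (Icc 0 1) t := by
  rw [flow_of_mem ht]
  exact (hasDerivWithinAt_evolution hA (by simp) ht).congr (fun r hr => flow_of_mem hr)
    (flow_of_mem ht)

theorem hasDerivAt_flow (hA : ContinuousOn A (Icc 0 1)) {t : ℝ} (ht : t ∈ Ioo (0 : ℝ) 1) :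
    HasDerivAt (flow A) ((-Complex.I) • (A t * flow A t)) t :=
  (hasDerivWithinAt_flow hA (Ioo_subset_Icc_self ht)).hasDerivAt (Icc_mem_nhds ht.1 ht.2)

theorem continuous_flow (hA : ContinuousOn A (Icc 0 1)) : Continuous (flow A) := by
  have h : ContinuousOn (flow A) (Icc 0 1) := fun t ht =>
    (hasDerivWithinAt_flow hA ht).continuousWithinAt
  have h2 : flow A = fun t => flow A (projIcc 0 1 zero_le_one t : ℝ) := by
    ext1 t
    simp only [flow, projIcc_val]
  rw [h2]
  exact h.comp_continuous (by fun_prop) fun t => Subtype.coe_prop _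

theorem norm_apply_of_mem_unitary {W : X →L[ℂ] X} (hW : W ∈ unitary (X →L[ℂ] X)) (x : X) :
    ‖W x‖ = ‖x‖ := by
  have h : inner ℂ (W x) (W x) = inner ℂ x x := by
    rw [← ContinuousLinearMap.adjoint_inner_left]
    have h1 := DFunLike.congr_fun (Unitary.star_mul_self_of_mem hW) x
    have h2 : (ContinuousLinearMap.adjoint W) (W x) = x := h1
    rw [h2]
  rw [inner_self_eq_norm_sq_to_K, inner_self_eq_norm_sq_to_K] at h
  have h3 : ‖W x‖ ^ 2 = ‖x‖ ^ 2 := by exact_mod_cast h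
  exact (sq_eq_sq₀ (norm_nonneg _) (norm_nonneg _)).1 h3

theorem apply_star_apply_of_mem_unitary {W : X →L[ℂ] X} (hW : W ∈ unitary (X →L[ℂ] X)) (x : X) :
    W (star W x) = x := DFunLike.congr_fun (Unitary.mul_star_self_of_mem hW) x

theorem star_apply_apply_of_mem_unitary {W : X →L[ℂ] X} (hW : W ∈ unitary (X →L[ℂ] X)) (x : X) :
    star W (W x) = x := DFunLike.congr_fun (Unitary.star_mul_self_of_mem hW) x

theorem inner_star_apply_right (W : X →L[ℂ] X) (x y : X) :
    inner ℂ x (star W y) = inner ℂ (W x) y :=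
  ContinuousLinearMap.adjoint_inner_right W x y

theorem cfc_conj_unitary {W : X →L[ℂ] X} (hW : W ∈ unitary (X →L[ℂ] X)) {f : ℝ → ℝ}
    (hf : Continuous f) {B : X →L[ℂ] X} (hB : IsSelfAdjoint B) :
    cfc f (star W * B * W) = star W * cfc f B * W := by
  have h := StarAlgHomClass.map_cfc (R := ℝ) (S := ℂ)
    (Unitary.conjStarAlgAut ℂ (X →L[ℂ] X) (star ⟨W, hW⟩)) f B hf.continuousOn (by
      change Continuous fun x => Unitary.conjStarAlgAut ℂ (X →L[ℂ] X) (star ⟨W, hW⟩) x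
      simp only [Unitary.conjStarAlgAut_star_apply]
      fun_prop) hB (by
      rw [Unitary.conjStarAlgAut_star_apply]
      exact hB.conjugate' W)
  simp only [Unitary.conjStarAlgAut_star_apply] at h
  exact h.symm

/-- The operators `B(t)` in the coordinates moving with the flow. -/
noncomputable def flowConj (A B : ℝ → X →L[ℂ] X) (t : ℝ) : X →L[ℂ] X :=
  star (flow A t) * B (projIcc 0 1 zero_le_one t) * flow A t

theorem flowConj_of_mem (A B : ℝ → X →L[ℂ] X) {t : ℝ} (ht : t ∈ Icc (0 : ℝ) 1) :
    flowConj A B t = star (flow A t) * B t * flow A t := by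
  rw [flowConj, projIcc_coe_eq ht]

variable {B : ℝ → X →L[ℂ] X} {C : ℝ}

/-- The hypothesis at the vector `U(s)x`, pulled back by unitaries. Projection to `[0,1]` does not
increase distances, so the bound extends to all times; `|C|` ensures a nonnegative constant. -/
theorem isRelLipschitz_flowConj (hA : ContinuousOn A (Icc 0 1))
    (hA' : ∀ t ∈ Icc (0 : ℝ) 1, IsSelfAdjoint (A t))
    (hB' : ∀ t ∈ Icc (0 : ℝ) 1, IsSelfAdjoint (B t))
    (h : ∀ t ∈ Icc (0 : ℝ) 1, ∀ s ∈ Icc (0 : ℝ) 1, ∀ x : X,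
      ‖B t (evolution A t s x) - evolution A t s (B s x)‖ ≤ C * |t - s| * (‖B s x‖ + ‖x‖)) :
    IsRelLipschitz (flowConj A B) |C| where
  nonneg := abs_nonneg C
  selfAdjoint t := (hB' _ (Subtype.coe_prop _)).conjugate' _
  lip t s x := by
    have hU := flow_mem_unitary hA hA'
    set t' : ℝ := (projIcc (0 : ℝ) 1 zero_le_one t).1 with ht'
    set s' : ℝ := (projIcc (0 : ℝ) 1 zero_le_one s).1 with hs'
    have ht : t' ∈ Icc (0 : ℝ) 1 := Subtype.coe_prop _
    have hs : s' ∈ Icc (0 : ℝ) 1 := Subtype.coe_prop _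
    have hft : flow A t = flow A t' := by simp only [flow, ht', projIcc_val]
    have hfs : flow A s = flow A s' := by simp only [flow, hs', projIcc_val]
    have hd : |t' - s'| ≤ |t - s| := abs_projIcc_sub_projIcc zero_le_one
    have h1 := h t' ht s' hs (flow A s' x)
    rw [evolution_eq_flow_mul hA hA' ht hs, mul_apply_eq_comp, mul_apply_eq_comp,
      star_apply_apply_of_mem_unitary (hU _)] at h1
    have e1 : flow A t' ((flowConj A B t - flowConj A B s) x) =
        B t' (flow A t' x) - flow A t' (star (flow A s') (B s' (flow A s' x))) := by
      simp only [flowConj, sub_apply, mul_apply_eq_comp, map_sub, hft, hfs]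
      rw [apply_star_apply_of_mem_unitary (hU _)]
    have e2 : ‖flowConj A B s x‖ = ‖B s' (flow A s' x)‖ := by
      simp only [flowConj, mul_apply_eq_comp, hfs]
      exact norm_apply_of_mem_unitary (Unitary.star_mem (hU _)) _
    rw [← norm_apply_of_mem_unitary (hU t') ((flowConj A B t - flowConj A B s) x), e1, e2,
      ← norm_apply_of_mem_unitary (hU s') x]
    refine h1.trans ?_
    gcongr
    exact le_abs_self C

theorem differentiableAt_flowConj (hA : ContinuousOn A (Icc 0 1))
    (hB : DifferentiableOn ℝ B (Icc 0 1)) {t : ℝ} (ht : t ∈ Ioo (0 : ℝ) 1) :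
    DifferentiableAt ℝ (flowConj A B) t := by
  have hn : Icc (0 : ℝ) 1 ∈ nhds t := Icc_mem_nhds ht.1 ht.2
  have hf : DifferentiableAt ℝ (flow A) t := (hasDerivAt_flow hA ht).differentiableAt
  have h2 : DifferentiableAt ℝ B t := (hB t (Ioo_subset_Icc_self ht)).differentiableAt hn
  refine ((hf.star.mul h2).mul hf).congr_of_eventuallyEq ?_
  filter_upwards [hn] with r hr
  exact flowConj_of_mem A B hr

theorem norm_flowConj_of_mem (hA : ContinuousOn A (Icc 0 1))
    (hA' : ∀ t ∈ Icc (0 : ℝ) 1, IsSelfAdjoint (A t)) {t : ℝ} (ht : t ∈ Icc (0 : ℝ) 1) :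
    ‖flowConj A B t‖ ≤ ‖B t‖ := by
  have hU := flow_mem_unitary hA hA' t
  rw [flowConj_of_mem A B ht]
  refine ContinuousLinearMap.opNorm_le_bound _ (norm_nonneg _) fun x => ?_
  rw [mul_apply_eq_comp, mul_apply_eq_comp, norm_apply_of_mem_unitary (Unitary.star_mem hU),
    ← norm_apply_of_mem_unitary hU x]
  exact (B t).le_opNorm _

theorem cfc_eq_zero_of_norm_lt {κ c : ℕ → ℝ → ℝ} {ε : ℝ} (hκ : IsDyadicPartition κ)
    (hc : IsHalfCutoff κ c ε) {B : X →L[ℂ] X} {J j : ℕ} (hJ : J ≠ 0) (hB : ‖B‖ < 2 ^ J)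
    (hj : J ≤ j) : cfc (c j) B = 0 := by
  rw [← cfc_const_zero ℝ B]
  refine cfc_congr fun ξ hξ => ?_
  have h1 : κ j ξ = 0 := hκ.eq_zero_of_lt ((abs_le_norm_of_mem_spectrum hξ).trans_lt
    (hB.trans_le (pow_le_pow_right₀ one_le_two hj))) (by omega)
  have h2 := hc.abs_le j ξ
  rw [h1, abs_zero] at h2
  exact abs_eq_zero.1 (le_antisymm h2 (abs_nonneg _))

/-- The cut-offs `c_j(B)` vanish for `j ≥ J`, so the series is a finite sum. Writing `S(t,s) =
U(t)U(s)*` makes all inner unitaries cancel, and taking adjoints reverses the order of the factors.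
-/
theorem star_tsum_eq_halfKernel {κ c : ℕ → ℝ → ℝ} {ε : ℝ} (hκ : IsDyadicPartition κ)
    (hc : IsHalfCutoff κ c ε) (hA : ContinuousOn A (Icc 0 1))
    (hA' : ∀ t ∈ Icc (0 : ℝ) 1, IsSelfAdjoint (A t))
    (hB' : ∀ t ∈ Icc (0 : ℝ) 1, IsSelfAdjoint (B t)) {J : ℕ} (hJ : J ≠ 0)
    (hBJ : ∀ t ∈ Icc (0 : ℝ) 1, ‖B t‖ < 2 ^ J) {t s : ℝ} (ht : t ∈ Icc (0 : ℝ) 1)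
    (hs : s ∈ Icc (0 : ℝ) 1) :
    star (if 0 < ε * (t - s) then ∑' j, cfc (c j) (B t) * evolution A t s * cfc (c j) (B s)
      * cfc (fun ξ : ℝ => Real.exp ((t - s) * ξ)) (B s) else 0) =
    flow A s * halfKernel c ε (flowConj A B) J t s * star (flow A t) := by
  have hU := flow_mem_unitary hA hA'
  have hex : Continuous fun ξ : ℝ => Real.exp ((t - s) * ξ) := by fun_prop
  unfold halfKernel halfSemigroup
  by_cases h : 0 < ε * (t - s)
  · simp only [if_pos h]
    rw [tsum_eq_sum (s := Finset.range J) fun j hj => by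
        rw [cfc_eq_zero_of_norm_lt hκ hc hJ (hBJ t ht) (by simpa using hj)]
        simp,
      star_sum, Finset.mul_sum, Finset.sum_mul]
    refine Finset.sum_congr rfl fun j _ => ?_
    have hcj := (hc.smooth j).continuous
    rw [flowConj_of_mem A B ht, flowConj_of_mem A B hs, cfc_conj_unitary (hU s) hex (hB' s hs),
      cfc_conj_unitary (hU s) hcj (hB' s hs), cfc_conj_unitary (hU t) hcj (hB' t ht),
      evolution_eq_flow_mul hA hA' ht hs]
    simp only [star_mul, star_star, (isSelfAdjoint_cfc _ _).star_eq]
    have e1 : ∀ r Y, flow A r * (star (flow A r) * Y) = Y := fun r Y => by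
      rw [← mul_assoc, Unitary.mul_star_self_of_mem (hU r), one_mul]
    simp only [mul_assoc, e1, Unitary.mul_star_self_of_mem (hU t), mul_one]
  · simp [if_neg h]

theorem star_parametrix {κ : ℕ → ℝ → ℝ} (hκ : IsDyadicPartition κ) (hA : ContinuousOn A (Icc 0 1))
    (hA' : ∀ t ∈ Icc (0 : ℝ) 1, IsSelfAdjoint (A t))
    (hB' : ∀ t ∈ Icc (0 : ℝ) 1, IsSelfAdjoint (B t)) {J : ℕ} (hJ : J ≠ 0)
    (hBJ : ∀ t ∈ Icc (0 : ℝ) 1, ‖B t‖ < 2 ^ J) {t s : ℝ} (ht : t ∈ Icc (0 : ℝ) 1)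
    (hs : s ∈ Icc (0 : ℝ) 1) :
    star (parametrix κ A B t s) =
      flow A s * flatKernel κ (flowConj A B) J t s * star (flow A t) := by
  have h1 := star_tsum_eq_halfKernel hκ (isHalfCutoff_kappaMinus hκ) hA hA' hB' hJ hBJ ht hs
  have h2 := star_tsum_eq_halfKernel hκ (isHalfCutoff_kappaPlus hκ) hA hA' hB' hJ hBJ ht hs
  rw [flatKernel, mul_sub, sub_mul, ← h1, ← h2, ← star_sub, parametrix]
  simp only [one_mul, neg_one_mul, neg_sub, sub_pos]

theorem parametrixAdjoint_eq {κ : ℕ → ℝ → ℝ} (hκ : IsDyadicPartition κ)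
    (hA : ContinuousOn A (Icc 0 1))
    (hA' : ∀ t ∈ Icc (0 : ℝ) 1, IsSelfAdjoint (A t))
    (hB' : ∀ t ∈ Icc (0 : ℝ) 1, IsSelfAdjoint (B t)) {J : ℕ} (hJ : J ≠ 0)
    (hBJ : ∀ t ∈ Icc (0 : ℝ) 1, ‖B t‖ < 2 ^ J) (φ : ℝ → X) {s : ℝ} (hs : s ∈ Icc (0 : ℝ) 1) :
    parametrixAdjoint κ A B φ s =
      flow A s (kernelOp (flatKernel κ (flowConj A B) J) (fun t => star (flow A t) (φ t)) s) := by
  have hU := flow_mem_unitary hA hA'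
  have h1 : ∀ t ∈ Ioo (0 : ℝ) 1, ContinuousLinearMap.adjoint (parametrix κ A B t s) (φ t) =
      flow A s (flatKernel κ (flowConj A B) J t s (star (flow A t) (φ t))) := fun t ht => by
    have := DFunLike.congr_fun
      (star_parametrix hκ hA hA' hB' hJ hBJ (Ioo_subset_Icc_self ht) hs) (φ t)
    exact this
  unfold parametrixAdjoint kernelOp
  rw [intervalIntegral.integral_of_le zero_le_one, integral_Ioc_eq_integral_Ioo,
    setIntegral_congr_fun measurableSet_Ioo h1]
  -- As an equivalence, the unitary comes out of the integral without any integrability.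
  exact (Unitary.linearIsometryEquiv ⟨flow A s, hU s⟩).toContinuousLinearEquiv.integral_comp_comm _

end Flow

/-! ### Transfer of norms and functionals between the two coordinate systems. -/

section Transfer

variable {X : Type*} [NormedAddCommGroup X] [InnerProductSpace ℂ X] [CompleteSpace X]
variable {A B : ℝ → X →L[ℂ] X}

/-- Applying `U(t')*` to `u(t') - S(t',t)u(t)` turns it into a plain increment of `U*u` without
changing its norm. -/
theorem v2Norm_le_of_v2Le (hA : ContinuousOn A (Icc 0 1))
    (hA' : ∀ t ∈ Icc (0 : ℝ) 1, IsSelfAdjoint (A t)) {v : ℝ → X} {k : ℝ}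
    (h : V2Le (fun t => star (flow A t) (v t)) k) : v2Norm A v ≤ ENNReal.ofReal k := by
  have hU := flow_mem_unitary hA hA'
  have hsq : v2NormSq A v ≤ ENNReal.ofReal k ^ 2 := by
    unfold v2NormSq
    have : Nonempty (ℕ × {t : ℕ → ℝ // Monotone t ∧ ∀ j, t j ∈ Icc (0 : ℝ) 1}) :=
      ⟨(0, ⟨fun _ => 0, monotone_const, fun _ => by simp⟩)⟩
    rw [ENNReal.add_iSup]
    refine iSup_le fun ⟨n, t, ht, ht'⟩ => ?_
    have h1 := h.sq_le (n := n) ht ht'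
    have e0 : ‖v 0‖ = ‖star (flow A 0) (v 0)‖ :=
      (norm_apply_of_mem_unitary (Unitary.star_mem (hU 0)) _).symm
    have e1 : ∀ j, ‖v (t (j + 1)) - evolution A (t (j + 1)) (t j) (v (t j))‖ =
        ‖star (flow A (t (j + 1))) (v (t (j + 1))) - star (flow A (t j)) (v (t j))‖ := fun j => by
      rw [evolution_eq_flow_mul hA hA' (ht' _) (ht' _), mul_apply_eq_comp,
        ← norm_apply_of_mem_unitary (hU (t (j + 1))) (star (flow A (t (j + 1))) _ - _), map_sub,
        apply_star_apply_of_mem_unitary (hU _)]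
    have e2 : ∀ x : X, ‖x‖ₑ ^ 2 = ENNReal.ofReal (‖x‖ ^ 2) := fun x => by
      rw [ENNReal.ofReal_pow (norm_nonneg _), ofReal_norm]
    simp only [e2]
    rw [← ENNReal.ofReal_sum_of_nonneg (fun _ _ => by positivity),
      ← ENNReal.ofReal_add (by positivity) (by positivity), ← ENNReal.ofReal_pow h.nonneg]
    refine ENNReal.ofReal_le_ofReal ?_
    rw [e0]
    simpa only [e1] using h1
  unfold v2Norm
  calc v2NormSq A v ^ (1 / 2 : ℝ) ≤ (ENNReal.ofReal k ^ 2) ^ (1 / 2 : ℝ) :=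
        ENNReal.rpow_le_rpow hsq (by norm_num)
    _ = _ := by
      rw [← ENNReal.rpow_natCast, ← ENNReal.rpow_mul]
      norm_num

theorem mem_V2C_of_v2Le (hA : ContinuousOn A (Icc 0 1))
    (hA' : ∀ t ∈ Icc (0 : ℝ) 1, IsSelfAdjoint (A t)) {v : ℝ → X} {k : ℝ}
    (hv : ContinuousOn v (Icc 0 1)) (h : V2Le (fun t => star (flow A t) (v t)) k) : v ∈ V2C A :=
  ⟨hv, (v2Norm_le_of_v2Le hA hA' h).trans_lt ENNReal.ofReal_lt_top⟩

theorem norm_apply_le_of_v2Le (hA : ContinuousOn A (Icc 0 1))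
    (hA' : ∀ t ∈ Icc (0 : ℝ) 1, IsSelfAdjoint (A t)) {f : V2C A →ₗ[ℂ] ℂ} (hf : v2DualNorm A f < ⊤)
    (v : V2C A) {k : ℝ} (h : V2Le (fun t => star (flow A t) ((v : ℝ → X) t)) k) :
    ‖f v‖ ≤ (v2DualNorm A f).toReal * k := by
  have hk := h.nonneg
  have hle : ∀ w : V2C A, v2Norm A (w : ℝ → X) ≤ 1 → ‖f w‖ ≤ (v2DualNorm A f).toReal := fun w hw => by
    rw [← toReal_enorm]
    exact ENNReal.toReal_mono hf.ne (le_iSup₂ (f := fun (v : V2C A)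
      (_ : v2Norm A (v : ℝ → X) ≤ 1) => ‖f v‖ₑ) w hw)
  -- Normalizing by `k + δ` covers `k = 0`.
  have hδ : ∀ δ : ℝ, 0 < δ → ‖f v‖ ≤ (v2DualNorm A f).toReal * (k + δ) := fun δ hδ => by
    have hpos : 0 < k + δ := by linarith
    have h1 := hle ((((k + δ)⁻¹ : ℝ) : ℂ) • v) (by
      refine (v2Norm_le_of_v2Le hA hA' (k := 1) ?_).trans ENNReal.ofReal_one.le
      refine ((h.const_smul (((k + δ)⁻¹ : ℝ) : ℂ)).mono ?_).congr fun s _ => ?_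
      · rw [Complex.norm_real, Real.norm_of_nonneg (by positivity), inv_mul_le_iff₀ hpos]
        linarith
      · simp)
    rw [map_smul, norm_smul, Complex.norm_real, Real.norm_of_nonneg (by positivity),
      inv_mul_le_iff₀ hpos] at h1
    linarith
  have hN : 0 ≤ (v2DualNorm A f).toReal := ENNReal.toReal_nonneg
  refine le_of_forall_pos_le_add fun δ hδ0 => ?_
  refine (hδ (δ / ((v2DualNorm A f).toReal + 1)) (by positivity)).trans ?_
  rw [mul_add]
  gcongr
  rw [mul_div_assoc', div_le_iff₀ (by positivity)]
  nlinarith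

/-- The functional `f` in the coordinates moving with the flow. -/
noncomputable def flowFunctional (f : V2C A →ₗ[ℂ] ℂ) (v : ℝ → X) : ℂ :=
  open Classical in
  if h : (fun t => flow A t (v t)) ∈ V2C A then f ⟨_, h⟩ else 0

theorem flowFunctional_of_mem (f : V2C A →ₗ[ℂ] ℂ) {v : ℝ → X}
    (h : (fun t => flow A t (v t)) ∈ V2C A) : flowFunctional f v = f ⟨_, h⟩ := dif_pos h

theorem flow_apply_mem_V2C (hA : ContinuousOn A (Icc 0 1))
    (hA' : ∀ t ∈ Icc (0 : ℝ) 1, IsSelfAdjoint (A t)) {v : ℝ → X} {k : ℝ}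
    (hv : ContinuousOn v (Icc 0 1)) (h : V2Le v k) : (fun t => flow A t (v t)) ∈ V2C A := by
  refine mem_V2C_of_v2Le hA hA' (k := k) ((continuous_flow hA).continuousOn.clm_apply hv) ?_
  simpa only [star_apply_apply_of_mem_unitary (flow_mem_unitary hA hA' _)] using h

theorem isVariationFunctional_flowFunctional (hA : ContinuousOn A (Icc 0 1))
    (hA' : ∀ t ∈ Icc (0 : ℝ) 1, IsSelfAdjoint (A t)) {f : V2C A →ₗ[ℂ] ℂ}
    (hf : v2DualNorm A f < ⊤) :
    IsVariationFunctional (flowFunctional f) (v2DualNorm A f).toReal where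
  nonneg := ENNReal.toReal_nonneg
  add u v k l hu hv hk hl := by
    have h1 := flow_apply_mem_V2C hA hA' hu hk
    have h2 := flow_apply_mem_V2C hA hA' hv hl
    rw [flowFunctional_of_mem f h1, flowFunctional_of_mem f h2,
      flowFunctional_of_mem f (v := fun s => u s + v s)
        (flow_apply_mem_V2C hA hA' (hu.add hv) (hk.add hl)), ← map_add]
    congr 1
    ext t
    simp
  smul c u k hu hk := by
    have h1 := flow_apply_mem_V2C hA hA' hu hk
    rw [flowFunctional_of_mem f h1,
      flowFunctional_of_mem f (v := fun s => c • u s)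
        (flow_apply_mem_V2C hA hA' (hu.const_smul c) (hk.const_smul c)),
      show c * f ⟨_, h1⟩ = f (c • ⟨_, h1⟩) from (map_smul f c _).symm]
    congr 1
    ext t
    simp
  bound u k hu hk := by
    rw [flowFunctional_of_mem f (flow_apply_mem_V2C hA hA' hu hk)]
    refine norm_apply_le_of_v2Le hA hA' hf _ ?_
    simpa only [star_apply_apply_of_mem_unitary (flow_mem_unitary hA hA' _)] using hk

/-- Elements of `V2C A` are functions on the whole line. Two of them that agree on `[0,1]` differ by
a vector of norm zero, on which `f` vanishes. -/
theorem apply_eq_flowFunctional (hA : ContinuousOn A (Icc 0 1))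
    (hA' : ∀ t ∈ Icc (0 : ℝ) 1, IsSelfAdjoint (A t)) {f : V2C A →ₗ[ℂ] ℂ}
    (hf : v2DualNorm A f < ⊤) {v w : ℝ → X} (hv : v ∈ V2C A) {k : ℝ}
    (hw : ContinuousOn w (Icc 0 1)) (hk : V2Le w k)
    (h : ∀ t ∈ Icc (0 : ℝ) 1, v t = flow A t (w t)) : f ⟨v, hv⟩ = flowFunctional f w := by
  have h1 := flow_apply_mem_V2C hA hA' hw hk
  rw [flowFunctional_of_mem f h1, ← sub_eq_zero, ← map_sub, ← norm_le_zero_iff]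
  refine (norm_apply_le_of_v2Le hA hA' hf (k := 0) _ (V2Le.zero.congr fun t ht => ?_)).trans
    (mul_zero _).le
  simp [h t ht]

/-- Extension by zero to the right end point. -/
theorem V2Le.extend_zero {v : ℝ → X} {M R : ℝ} (hM : 0 ≤ M) (hR : 0 ≤ R)
    (hv : ∀ t ∈ Ico (0 : ℝ) 1, ‖v t‖ ≤ R)
    (hvar : ∀ (n : ℕ) (t : ℕ → ℝ), Monotone t → (∀ j, t j ∈ Ico (0 : ℝ) 1) →
      ∑ j ∈ Finset.range n, ‖v (t (j + 1)) - v (t j)‖ ^ 2 ≤ M ^ 2) :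
    V2Le ((Iio 1).indicator v) (2 * R + M) := by
  refine V2Le.of_sq (by positivity) fun n t ht ht' => ?_
  have hlt : ∀ n, t n < 1 → ∑ j ∈ Finset.range n,
      ‖(Iio 1).indicator v (t (j + 1)) - (Iio 1).indicator v (t j)‖ ^ 2 ≤ M ^ 2 := fun n hn => by
    have hle : ∀ j, t (min j n) < 1 := fun j => (ht (min_le_right _ _)).trans_lt hn
    refine le_trans (le_of_eq ?_) (hvar n (fun j => t (min j n))
      (fun i j hij => ht (min_le_min hij le_rfl)) fun j => ⟨(ht' _).1, hle j⟩)
    refine Finset.sum_congr rfl fun j hj => ?_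
    have hj' := Finset.mem_range.1 hj
    have h1 := hle (j + 1)
    have h2 := hle j
    rw [min_eq_left (by omega)] at h1 h2
    rw [min_eq_left (by omega), min_eq_left (by omega), indicator_of_mem (mem_Iio.2 h1),
      indicator_of_mem (mem_Iio.2 h2)]
  -- A monotone partition crosses to the end point 1 at most once, and that jump costs at most `R²`.
  have hsum : ∀ n, ∑ j ∈ Finset.range n,
      ‖(Iio 1).indicator v (t (j + 1)) - (Iio 1).indicator v (t j)‖ ^ 2 ≤ M ^ 2 + R ^ 2 := by
    intro n
    induction n with
    | zero => simp; positivity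
    | succ n ih =>
      by_cases h1 : t (n + 1) < 1
      · exact (hlt _ h1).trans (by nlinarith)
      · rw [Finset.sum_range_succ, indicator_of_notMem (s := Iio 1) (a := t (n + 1)) (by simpa using h1)]
        by_cases h2 : t n < 1
        · rw [indicator_of_mem (mem_Iio.2 h2), zero_sub, norm_neg]
          exact add_le_add (hlt n h2) (pow_le_pow_left₀ (norm_nonneg _) (hv _ ⟨(ht' n).1, h2⟩) 2)
        · rw [indicator_of_notMem (s := Iio 1) (a := t n) (by simpa using h2)]
          simpa using ih
  have h0 : ‖(Iio 1).indicator v 0‖ ^ 2 ≤ R ^ 2 := by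
    rw [indicator_of_mem (by simp)]
    exact pow_le_pow_left₀ (norm_nonneg _) (hv 0 (by simp)) 2
  have := hsum n
  nlinarith [mul_nonneg hR hM]

theorem memLp_of_continuousOn {v : ℝ → X} (hv : ContinuousOn v (Icc 0 1)) :
    MemLp v 2 (volume.restrict (Ioo 0 1)) := by
  obtain ⟨M, hM⟩ := isCompact_Icc.exists_bound_of_continuousOn hv
  refine MemLp.of_bound ((hv.mono Ioo_subset_Icc_self).aestronglyMeasurable measurableSet_Ioo) M ?_
  filter_upwards [ae_restrict_mem measurableSet_Ioo] with t ht
  exact hM t (Ioo_subset_Icc_self ht)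

theorem intervalIntegral_zero_one_eq {Y : Type*} [NormedAddCommGroup Y] [NormedSpace ℝ Y]
    (v : ℝ → Y) : ∫ t in (0 : ℝ)..1, v t = ∫ t in Ioo (0 : ℝ) 1, v t := by
  rw [intervalIntegral.integral_of_le zero_le_one, integral_Ioc_eq_integral_Ioo]

end Transfer

/-! ### Assembly of the theorem. -/

theorem mainTheorem5 (κ : ℕ → ℝ → ℝ) (hκ : IsDyadicPartition κ) (C : ℝ) :
    ∃ K : ℝ≥0, ∀ (X : Type*) [NormedAddCommGroup X] [InnerProductSpace ℂ X] [CompleteSpace X]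
      (A B : ℝ → X →L[ℂ] X),
      ContDiffOn ℝ ∞ A (Icc 0 1) → ContDiffOn ℝ ∞ B (Icc 0 1) →
      (∀ t ∈ Icc (0 : ℝ) 1, IsSelfAdjoint (A t)) →
      (∀ t ∈ Icc (0 : ℝ) 1, IsSelfAdjoint (B t)) →
      (∀ t ∈ Icc (0 : ℝ) 1, ∀ s ∈ Icc (0 : ℝ) 1, ∀ x : X,
        ‖B t (evolution A t s x) - evolution A t s (B s x)‖
          ≤ C * |t - s| * (‖B s x‖ + ‖x‖)) →
      ∀ f : V2C A →ₗ[ℂ] ℂ, v2DualNorm A f < ⊤ →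
        ∃ u : ℝ → X,
          IsParametrixImage κ A B f u ∧
          MemV2 A u ∧ v2Norm A u ≤ K * v2DualNorm A f ∧
          ∃ g : ℝ → X,
            IsWeakError A B (fun t => Complex.I • u t) f g ∧
            AEStronglyMeasurable g (volume.restrict (Icc 0 1)) ∧
            eLpNorm g ∞ (volume.restrict (Icc 0 1)) ≤ K * v2DualNorm A f := by
  obtain ⟨a, hp⟩ := hκ.exists_isPartitionConst
  have ha := hp.minus.nonneg
  have hKC := kernelConst_nonneg ha (abs_nonneg C)
  set K₁ : ℝ := 12 * kernelConst a |C| * a with hK₁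
  set K₂ : ℝ := parametrixConst a |C| with hK₂
  set K₃ : ℝ := errorConst a |C| + errorConst a |C| with hK₃
  have hK₁0 : 0 ≤ K₁ := by positivity
  have hK₂0 : 0 ≤ K₂ := by rw [hK₂]; unfold parametrixConst; positivity
  have hK₃0 : 0 ≤ K₃ := by rw [hK₃]; unfold errorConst; positivity
  -- `K₁` bounds the size of the solution, `K₂` its variation and `K₃` the error. They involve only
  -- `a`, obtained from the partition, and `C`; the number `J` of dyadic pieces is chosen after
  -- them.
  refine ⟨(2 * K₁ + K₂ + K₃).toNNReal, ?_⟩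
  intro X _ _ _ A B hA hB hA' hB' hAB f hf
  have hAc := hA.continuousOn
  have hU := flow_mem_unitary hAc hA'
  have hb := isRelLipschitz_flowConj hAc hA' hB' hAB
  have hd : ∀ t ∈ Ioo (0 : ℝ) 1, DifferentiableAt ℝ (flowConj A B) t := fun t ht =>
    differentiableAt_flowConj hAc (hB.differentiableOn (by simp)) ht
  obtain ⟨M, hM⟩ := isCompact_Icc.exists_bound_of_continuousOn hB.continuousOn
  obtain ⟨J₀, hJ₀⟩ := pow_unbounded_of_one_lt M (one_lt_two (α := ℝ))
  have hJ : J₀ + 1 ≠ 0 := J₀.succ_ne_zero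
  have hBJ : ∀ t ∈ Icc (0 : ℝ) 1, ‖B t‖ < 2 ^ (J₀ + 1) := fun t ht =>
    (hM t ht).trans_lt (hJ₀.trans_le (pow_le_pow_right₀ one_le_two J₀.le_succ))
  generalize J₀ + 1 = J at hJ hBJ
  have hbJ : ∀ t ∈ Icc (0 : ℝ) 1, ‖flowConj A B t‖ < 2 ^ J := fun t ht =>
    (norm_flowConj_of_mem hAc hA' ht).trans_lt (hBJ t ht)
  have hF := isVariationFunctional_flowFunctional hAc hA' hf
  set N : ℝ := (v2DualNorm A f).toReal with hN
  have hN0 : 0 ≤ N := ENNReal.toReal_nonneg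
  have hKN : ∀ k : ℝ, k ≤ 2 * K₁ + K₂ + K₃ → ENNReal.ofReal (N * k) ≤
      ((2 * K₁ + K₂ + K₃).toNNReal : ℝ≥0∞) * v2DualNorm A f := fun k hk => by
    have e1 : v2DualNorm A f = ENNReal.ofReal N := (ENNReal.ofReal_toReal hf.ne).symm
    rw [e1]
    change _ ≤ ENNReal.ofReal (2 * K₁ + K₂ + K₃) * ENNReal.ofReal N
    rw [← ENNReal.ofReal_mul (by positivity), mul_comm N]
    exact ENNReal.ofReal_le_ofReal (mul_le_mul_of_nonneg_right hk hN0)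
  obtain ⟨u, g, hu1, hu2, hu3, hu4, hg1, hg2, hg3⟩ :=
    hp.exists_parametrixImage hb hd hJ hbJ hF
  -- The bounds for `u` hold on `[0,1)` only, so the value at the end point is set to zero.
  have hV : V2Le (fun t => star (flow A t) ((Iio 1).indicator (fun t => flow A t (u t)) t))
      (N * (2 * K₁ + K₂)) := by
    have h1 := V2Le.extend_zero (mul_nonneg hN0 hK₂0) (mul_nonneg hN0 hK₁0) hu2 hu3
    refine (h1.mono (le_of_eq (by ring))).congr fun t ht => ?_
    by_cases h : t < 1
    · simp only [indicator_of_mem (mem_Iio.2 h)]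
      rw [star_apply_apply_of_mem_unitary (hU t)]
    · simp [h]
  have hVn := v2Norm_le_of_v2Le hAc hA' hV
  refine ⟨(Iio 1).indicator fun t => flow A t (u t), fun φ hφ => ?_, ⟨fun t ht => ?_,
    hVn.trans_lt ENNReal.ofReal_lt_top⟩, hVn.trans (hKN _ (by linarith)),
    fun t => flow A t (g t), fun ψ hψ hψc hψs => ?_, ?_, ?_⟩
  · have hφ' : MemLp (fun t => star (flow A t) (φ t)) 2 (volume.restrict (Ioo 0 1)) :=
      memLp_of_continuousOn ((continuous_flow hAc).star.continuousOn.clm_apply hφ)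
    have hk := hp.isVariationKernel_flatKernel hb J
    have hφi := hφ'.integrable one_le_two
    have heq := fun s (hs : s ∈ Icc (0 : ℝ) 1) =>
      parametrixAdjoint_eq hκ hAc hA' hB' hJ hBJ φ hs
    have hmem : parametrixAdjoint κ A B φ ∈ V2C A := by
      refine mem_V2C_of_v2Le hAc hA' ?_ ((hk.v2Le_kernelOp hφi).congr fun s hs => ?_)
      · exact ((continuous_flow hAc).continuousOn.clm_apply (hk.continuousOn_kernelOp hφi)).congr heq
      · rw [heq s hs, star_apply_apply_of_mem_unitary (hU s)]
    refine ⟨hmem, ?_⟩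
    rw [apply_eq_flowFunctional hAc hA' hf hmem (hk.continuousOn_kernelOp hφi)
      (hk.v2Le_kernelOp hφi) heq, hu4 _ hφ', intervalIntegral_zero_one_eq]
    refine setIntegral_congr_fun measurableSet_Ioo fun t ht => ?_
    rw [indicator_of_mem (mem_Iio.2 ht.2), inner_star_apply_right]
  · have h1 : ContinuousWithinAt (fun t => flow A t (u t)) (Ici t) t :=
      (continuous_flow hAc).continuousWithinAt.clm_apply (hu1 t ht)
    refine h1.congr_of_eventuallyEq ?_ (indicator_of_mem (mem_Iio.2 ht.2) _)
    filter_upwards [nhdsWithin_le_nhds (eventually_lt_nhds ht.2)] with r hr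
    exact indicator_of_mem (mem_Iio.2 hr) _
  · have h01 : ∀ t, t ∉ Ioo (0 : ℝ) 1 → ψ t = 0 := fun t ht =>
      image_eq_zero_of_notMem_tsupport fun h => ht (hψs h)
    -- In moving coordinates `∂_t + iA` becomes `∂_t`.
    have hψd : ∀ t ∈ Ioo (0 : ℝ) 1, HasDerivAt (fun t => star (flow A t) (ψ t))
        (star (flow A t) (deriv ψ t + Complex.I • A t (ψ t))) t := fun t ht => by
      have h1 := (hasDerivAt_flow hAc ht).star.clm_apply_of_real
        (hψ.differentiable (by simp) t).hasDerivAt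
      refine h1.congr_deriv ?_
      rw [star_smul, star_mul, (hA' t (Ioo_subset_Icc_self ht)).star_eq]
      simp [mul_apply_eq_comp, add_comm]
    obtain ⟨k, hk, hint⟩ := hg3 (fun t => star (flow A t) (ψ t))
      (fun t => star (flow A t) (deriv ψ t + Complex.I • A t (ψ t)))
      ((continuous_flow hAc).star.clm_apply hψ.continuous) hψd
      (memLp_of_continuousOn ((continuous_flow hAc).star.continuousOn.clm_apply
        ((hψ.continuous_deriv (by simp)).continuousOn.add
          ((hAc.clm_apply hψ.continuous.continuousOn).const_smul Complex.I))))
      (by simp [h01 0]) (by simp [h01 1])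
    have hmem : ψ ∈ V2C A := mem_V2C_of_v2Le hAc hA' hψ.continuous.continuousOn hk
    refine ⟨hmem, ?_⟩
    rw [apply_eq_flowFunctional hAc hA' hf hmem
      ((continuous_flow hAc).star.clm_apply hψ.continuous).continuousOn hk
      fun t _ => (apply_star_apply_of_mem_unitary (hU t) _).symm]
    have e1 : ∫ t in (0 : ℝ)..1, inner ℂ (flow A t (g t)) (ψ t) =
        ∫ t in Ioo (0 : ℝ) 1, inner ℂ (g t) (star (flow A t) (ψ t)) := by
      rw [intervalIntegral_zero_one_eq]
      simp only [inner_star_apply_right]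
    rw [e1, ← hint, applyDtAB, intervalIntegral_zero_one_eq, ← integral_neg]
    congr 1
    refine setIntegral_congr_fun measurableSet_Ioo fun t ht => ?_
    rw [indicator_of_mem (mem_Iio.2 ht.2), flowConj_of_mem A B (Ioo_subset_Icc_self ht),
      mul_apply_eq_comp, mul_apply_eq_comp, apply_star_apply_of_mem_unitary (hU t), ← map_add,
      inner_star_apply_right]
    -- `D_t + A - iB = -i(∂_t + iA + B)`. Paired with `i u`, the scalars combine to `conj(i)(-i) =
    -- -1`, the sign in the weak equation.
    have e2 : (-Complex.I) • deriv ψ t + A t (ψ t) - Complex.I • B t (ψ t) =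
        (-Complex.I) • (deriv ψ t + Complex.I • A t (ψ t) + B t (ψ t)) := by
      simp only [smul_add, smul_smul, neg_smul, neg_mul, Complex.I_mul_I, neg_neg, one_smul]
      abel
    rw [e2, inner_smul_left, inner_smul_right, Complex.conj_I, ← mul_assoc, neg_mul_neg,
      Complex.I_mul_I, neg_one_mul]
  · exact (ContinuousLinearMap.apply ℂ X).flip.aestronglyMeasurable_comp₂
      (continuous_flow hAc).aestronglyMeasurable hg1.aestronglyMeasurable
  · rw [← restrict_Ioo_eq_restrict_Icc]
    refine le_trans ?_ (hKN K₃ (by linarith))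
    rw [eLpNorm_exponent_top]
    refine eLpNormEssSup_le_of_ae_bound ?_
    filter_upwards [hg2] with t ht
    rwa [norm_apply_of_mem_unitary (hU t)]
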